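/- **Model.** Let $d\ge 2$, $\varepsilon\in(0,1)$, and let $Y_\varepsilon(dt)=F(t)\,dt+\varepsilon W(dt)$, $t\in[-1,1]^d$, be observed, where $W$ is a Brownian sheet (Gaussian white noise). For $\beta,L>0$ let $m_\beta$ be the largest integer strictly less than $\beta$ and let $\mathbb H(\beta,L)$ be the set of $m_\beta$-times continuously differentiable $g:\mathbb R\to\mathbb R$ with $\|g^{(m)}\|_\infty\le L$ for all $0\le m\le m_\beta$ and $|g^{(m_\beta)}(t+h)-g^{(m_\beta)}(t)|\le Lh^{\beta-m_\beta}$ for all $t\in\mathbb R$, $h>0$. Put $\mathbb F_d(\beta,L)=\{F:\mathbb R^d\to\mathbb R : F(z)=f(z^{T}\theta),\ f\in\mathbb H(\beta,L),\ \theta\in\mathbb S^{d-1}\}$. For $r>0$, the risk at a point $x$ of an estimator $\tilde F(x)$ is $\mathcal R^{(\varepsilon)}_{r,x}(\tilde F,F)=(\mathbb E_F|\tilde F(x)-F(x)|^r)^{1/r}$, and $$\psi_\varepsilon(\beta,L)=L^{1/(2\beta+1)}\bigl(\varepsilon\sqrt{\ln(1/\varepsilon)}\bigr)^{2\beta/(2\beta+1)}.$$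 **Estimator ($d=2$).** Let $\mathcal K:\mathbb R\to\mathbb R$ be a symmetric Lipschitz function with $\int\mathcal K=1$, supported in $[-\sqrt2/8,\sqrt2/8]$ (so that all windows used below at points of $[-1/2,1/2]^2$ lie in $[-1,1]^2$), and let $K(u,v)=\mathcal K(u)\mathcal K(v)$. For a $2\times2$ matrix $E$ let $\hat F_E(x)=\det(E)\int K(E(t-x))\,Y_\varepsilon(dt)$. For $\theta,\nu\in\mathbb S^1$, $h\in(0,1]$ let $$E_{(\theta,h)}=\begin{pmatrix}h^{-1}\theta_1&h^{-1}\theta_2\\-\theta_2&\theta_1\end{pmatrix},\qquad \overline E_{(\theta,h)(\nu,h)}=\frac1{2(1+|\nu^T\theta|)}\begin{pmatrix}h^{-1}(\theta_1+\nu_1)&h^{-1}(\theta_2+\nu_2)\\-(\theta_2+\nu_2)&\theta_1+\nu_1\end{pmatrix},$$ and let $E_{(\theta,h)(\nu,h)}=\overline E_{(\theta,h)(\nu,h)}$ if $\nu^T\theta\ge0$ and $\overline E_{(-\theta,h)(\nu,h)}$ if $\nu^T\theta<0$. Write $\hat F_{(\theta,h)}$, $\hat F_{(\theta,h)(\nu,h)}$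 for the estimators with these matrices; the kernel integrals are taken in versions continuous in $\theta$ and, for $\overline E_{(\theta,h)(\nu,h)}$, in $(\theta,\nu)$. For a constant $C$ put $\mathrm{TH}(\eta)=C\varepsilon\sqrt{\eta^{-1}\ln(1/\varepsilon)}$, $\mathcal H_\varepsilon=\{2^{-k}:k=0,1,\dots\}\cap[\varepsilon^2,1]$, $$R_{(\theta,h)}(x)=\sup_{\eta\in\mathcal H_\varepsilon,\,\eta\le h}\Bigl\{\sup_{\nu\in\mathbb S^1}|\hat F_{(\theta,\eta)(\nu,\eta)}(x)-\hat F_{(\nu,\eta)}(x)|-\mathrm{TH}(\eta)\Bigr\},\quad \mathcal P(x)=\{(\theta,h)\in\mathbb S^1\times\mathcal H_\varepsilon:R_{(\theta,h)}(x)\le0\}.$$ If $\mathcal P(x)\ne\emptyset$, let $\tilde h$ be the largest $h$ occurring in $\mathcal P(x)$ and let $\hat\theta$ be any measurable choice with $(\hat\theta,\tilde h)\in\mathcal P(x)$; otherwise $\hat\theta=(1,0)^T$. Let $\hat h=\sup\{h\in\mathcal H_\varepsilon:|\hat F_{(\hat\theta,h)}(x)-\hat F_{(\hat\theta,\eta)}(x)|\le\mathrm{TH}(\eta)\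 \forall\eta\in\mathcal H_\varepsilon,\eta\le h\}$. The estimator of $F(x)$ is $\hat F_{(\hat\theta,\hat h)}(x)$. **Theorem.** (i) For every $\mathcal K$ as above and every $r>0$ there are constants $C=C(r,\mathcal K)$, $C_{r,1}(\mathcal K)$ and a function $L\mapsto C_{r,2}(L,\mathcal K)$ such that the following holds for every $b>0$ with $\int z^j\mathcal K(z)\,dz=0$, $j=1,\dots,m_b$, every $\varepsilon\in(0,1)$ and every $x\in[-1/2,1/2]^2$. The estimator $\hat F_{(\hat\theta,\hat h)}(x)$ with the constant $C$ in the threshold exists as a measurable function of the observation (one function for all $F\in\bigcup_{\beta\le b,L>0}\mathbb F_2(\beta,L)$), and every such estimator satisfies, for all $0<\beta\le b$ and $L>0$ with $\varepsilon\le\exp\{-\max[1,(2L\|\mathcal K\|_1\|\mathcal K\|_\infty^{-1})^2]\}$, $$\sup_{F\in\mathbb F_2(\beta,L)}\mathcal R^{(\varepsilon)}_{r,x}\bigl(\hat F_{(\hat\theta,\hat h)},F\bigr)\le\|\mathcal K\|_\infty^2\Bigl[C_{r,1}(\mathcal K)\,\psi_\varepsilon(\beta,L)+C_{r,2}(L,\mathcal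 K)\,\varepsilon\sqrt{\ln(1/\varepsilon)}\Bigr].$$ (ii) For all $d\ge2$, $r>0$, $\beta>0$ there is $\kappa>0$ such that for every $L>0$ and all sufficiently small $\varepsilon>0$ (depending on $d,r,\beta,L$), for every $x\in[-1/2,1/2]^d$, $$\inf_{\tilde F}\sup_{F\in\mathbb F_d(\beta,L)}\mathcal R^{(\varepsilon)}_{r,x}(\tilde F,F)\ge\kappa\,\psi_\varepsilon(\beta,L),$$ where the infimum is over all estimators (measurable functions of the observation). -/

import Mathlib

open MeasureTheory ProbabilityTheory Set
open scoped ENNReal Matrix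

noncomputable section

namespace SingleIndex

/-! ### The white noise model on `[-1,1]^d` -/

/-- `ℝ^d` with its Euclidean structure. -/
abbrev E (d : ℕ) : Type := EuclideanSpace ℝ (Fin d)

/-- The unit sphere of `ℝ^d`: the index vectors. -/
abbrev Sph (d : ℕ) : Set (E d) := Metric.sphere (0 : E d) 1

/-- The observation domain `[-1,1]^d`. -/
def domain (d : ℕ) : Set (E d) := {t | ∀ i, t i ∈ Icc (-1 : ℝ) 1}

/-- The cube `[-1/2,1/2]^d` of points at which the function is estimated. -/
def innerCube (d : ℕ) : Set (E d) := {x | ∀ i, x i ∈ Icc (-(1 / 2) : ℝ) (1 / 2)}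

/-- Lebesgue measure on the observation domain. -/
def domMeasure (d : ℕ) : Measure (E d) := volume.restrict (domain d)

/-- The space `L²([-1,1]^d)` of test functions. -/
abbrev L2 (d : ℕ) : Type := Lp ℝ 2 (domMeasure d)

/-- The class in `L²([-1,1]^d)` of a function that is square integrable on `[-1,1]^d`
(and `0` for the other functions, to which it is never applied). -/
def toL2 {d : ℕ} (φ : E d → ℝ) : L2 d :=
  open scoped Classical in if h : MemLp φ 2 (domMeasure d) then h.toLp φ else 0

/-- `W` is the white noise `φ ↦ ∫ φ(t) W(dt)` on `[-1,1]^d`, i.e. the Wiener integral against a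
Brownian sheet: the centered Gaussian process on `L²([-1,1]^d)` with
`𝔼 [W(φ) W(ψ)] = ∫ φ ψ`. -/
structure IsWhiteNoise {d : ℕ} {Ω : Type*} [MeasurableSpace Ω] (P : Measure Ω)
    (W : L2 d → Ω → ℝ) : Prop where
  measurable : ∀ φ, Measurable (W φ)
  gaussian : IsGaussianProcess W P
  centered : ∀ φ, ∫ ω, W φ ω ∂P = 0
  covariance : ∀ φ ψ, ∫ ω, W φ ω * W ψ ω ∂P = inner ℝ φ ψ

/-- The observation `Y_ε(dt) = F(t) dt + ε W(dt)`, i.e. all the integrals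
`Y_ε(φ) = ∫ φ(t) F(t) dt + ε ∫ φ(t) W(dt)`, `φ ∈ L²([-1,1]^d)`. -/
def obs {d : ℕ} {Ω : Type*} (ε : ℝ) (W : L2 d → Ω → ℝ) (F : E d → ℝ) (φ : L2 d) (ω : Ω) : ℝ :=
  (∫ t, φ t * F t ∂(domMeasure d)) + ε * W φ ω

/-- The pointwise risk `(𝔼_F |T - F(x)|^r)^{1/r}` of an estimator `T` of `F(x)`; an estimator is a
function of the observation `(Y_ε(φ))_φ`. -/
def pointwiseRisk {d : ℕ} {Ω : Type*} [MeasurableSpace Ω] (P : Measure Ω) (W : L2 d → Ω → ℝ)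
    (ε r : ℝ) (x : E d) (T : (L2 d → ℝ) → ℝ) (F : E d → ℝ) : ℝ≥0∞ :=
  (∫⁻ ω, ENNReal.ofReal |T (fun φ => obs ε W F φ ω) - F x| ^ r ∂P) ^ (1 / r)

/-! ### Function classes and rate -/

/-- The largest integer strictly less than `a > 0`. -/
def mInt (a : ℝ) : ℕ := ⌈a⌉₊ - 1

/-- The Hölder class `ℍ(β, L)`. -/
def holderClass (β L : ℝ) : Set (ℝ → ℝ) :=
  {g | ContDiff ℝ (mInt β) g ∧
    (∀ m ≤ mInt β, ∀ t, |iteratedDeriv m g t| ≤ L) ∧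
    ∀ t h : ℝ, 0 < h →
      |iteratedDeriv (mInt β) g (t + h) - iteratedDeriv (mInt β) g t| ≤ L * h ^ (β - mInt β)}

/-- The single-index Hölder class `𝔽_d(β, L)` of the functions `z ↦ f (zᵀ θ)`. -/
def singleIndexClass (d : ℕ) (β L : ℝ) : Set (E d → ℝ) :=
  {F | ∃ f ∈ holderClass β L, ∃ θ ∈ Sph d, ∀ z, F z = f (inner ℝ z θ)}

/-- The union `𝔽(b)` of all the classes `𝔽_2(β, L)` with `0 < β ≤ b` and `L > 0`. -/
def adaptationClass (b : ℝ) : Set (E 2 → ℝ) :=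
  {F | ∃ β L : ℝ, 0 < β ∧ β ≤ b ∧ 0 < L ∧ F ∈ singleIndexClass 2 β L}

/-- The rate `ψ_ε(β, L)`. -/
def rate (ε β L : ℝ) : ℝ :=
  L ^ (1 / (2 * β + 1)) * (ε * √(Real.log (1 / ε))) ^ (2 * β / (2 * β + 1))

/-! ### Kernels -/

/-- `‖K‖_∞` for a bounded function. -/
def supNorm (K : ℝ → ℝ) : ℝ := ⨆ u, |K u|

/-- `‖K‖_1`. -/
def l1Norm (K : ℝ → ℝ) : ℝ := ∫ u, |K u|

/-- The matrix `E_{(θ,h)}`. -/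
def mat (θ : Sph 2) (h : ℝ) : Matrix (Fin 2) (Fin 2) ℝ :=
  !![h⁻¹ * θ.1 0, h⁻¹ * θ.1 1;
     -θ.1 1, θ.1 0]

/-- The matrix `Ē_{(θ,h)(ν,h)}`. -/
def matBar (θ ν : Sph 2) (h : ℝ) : Matrix (Fin 2) (Fin 2) ℝ :=
  !![(θ.1 0 + ν.1 0) / (2 * h * (1 + |inner ℝ ν.1 θ.1|)),
       (θ.1 1 + ν.1 1) / (2 * h * (1 + |inner ℝ ν.1 θ.1|));
     -((θ.1 1 + ν.1 1) / (2 * (1 + |inner ℝ ν.1 θ.1|))),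
       (θ.1 0 + ν.1 0) / (2 * (1 + |inner ℝ ν.1 θ.1|))]

/-- The product kernel `K(u, v) = K(u) K(v)` evaluated at `A (t - x)`. -/
def prodKer (K : ℝ → ℝ) (A : Matrix (Fin 2) (Fin 2) ℝ) (x t : E 2) : ℝ :=
  K ((A *ᵥ (fun i => t i - x i)) 0) * K ((A *ᵥ (fun i => t i - x i)) 1)

/-- The weight function `t ↦ det(A) K(A (t - x))` of a kernel estimator at `x`. -/
def weight (K : ℝ → ℝ) (A : Matrix (Fin 2) (Fin 2) ℝ) (x : E 2) : E 2 → ℝ :=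
  fun t => A.det * prodKer K A x t

/-- The assumptions on the kernel apart from the vanishing moments. The last two fields say that
at every point `x ∈ [-1/2,1/2]²` the windows of the kernel estimators `F̂_{(θ,h)}(x)` and
`F̂_{(θ,h)(ν,h)}(x)` lie in the observation domain (no boundary effects); they amount to
`K = 0` outside `[-√2/8, √2/8]`. -/
structure IsKernel (K : ℝ → ℝ) : Prop where
  even : ∀ u, K (-u) = K u
  lipschitz : ∃ Q, LipschitzWith Q K
  compact : HasCompactSupport K
  integral_one : ∫ u, K u = 1
  window : ∀ x ∈ innerCube 2, ∀ θ : Sph 2, ∀ h ∈ Ioc (0 : ℝ) 1, ∀ t,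
    prodKer K (mat θ h) x t ≠ 0 → t ∈ domain 2
  window_pair : ∀ x ∈ innerCube 2, ∀ θ ν : Sph 2, 0 ≤ (inner ℝ ν.1 θ.1 : ℝ) →
    ∀ h ∈ Ioc (0 : ℝ) 1, ∀ t, prodKer K (matBar θ ν h) x t ≠ 0 → t ∈ domain 2

/-- Vanishing moments up to the order `m_b`. -/
def VanishingMoments (K : ℝ → ℝ) (b : ℝ) : Prop :=
  ∀ j : ℕ, 1 ≤ j → j ≤ mInt b → ∫ z, z ^ j * K z = 0

/-! ### The selection rule

In the next definitions `X h θ` stands for the value of `F̂_{(θ,h)}(x)` and `V h (θ, ν)` for the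
value of the kernel estimator with the matrix `Ē_{(θ,h)(ν,h)}`, for one realization of the
observation. -/

/-- The threshold `TH(η)`. -/
def threshold (C ε η : ℝ) : ℝ := C * ε * √(η⁻¹ * Real.log (1 / ε))

/-- The dyadic bandwidth grid `ℋ_ε`. -/
def grid (ε : ℝ) : Set ℝ := {h | (∃ k : ℕ, h = (2 : ℝ)⁻¹ ^ k) ∧ ε ^ 2 ≤ h ∧ h ≤ 1}

/-- The estimator `F̂_{(θ,h)(ν,h)}(x)`, which uses `Ē_{(θ,h)(ν,h)}` if `νᵀθ ≥ 0` and
`Ē_{(-θ,h)(ν,h)}` otherwise. -/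
def pairEst (V : ℝ → Sph 2 × Sph 2 → ℝ) (h : ℝ) (θ ν : Sph 2) : ℝ :=
  if 0 ≤ (inner ℝ ν.1 θ.1 : ℝ) then V h (θ, ν) else V h (-θ, ν)

/-- The statistic `R_{(θ,h)}(x)`. -/
def selStat (X : ℝ → Sph 2 → ℝ) (V : ℝ → Sph 2 × Sph 2 → ℝ) (C ε : ℝ) (θ : Sph 2) (h : ℝ) : ℝ :=
  sSup ((fun η => (⨆ ν : Sph 2, |pairEst V η θ ν - X η ν|) - threshold C ε η) ''
    {η | η ∈ grid ε ∧ η ≤ h})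

/-- The set `𝒫(x)`. -/
def selSet (X : ℝ → Sph 2 → ℝ) (V : ℝ → Sph 2 × Sph 2 → ℝ) (C ε : ℝ) : Set (Sph 2 × ℝ) :=
  {p | p.2 ∈ grid ε ∧ selStat X V C ε p.1 p.2 ≤ 0}

/-- `θ` is an admissible value of `θ̂`: `(θ, h̃) ∈ 𝒫(x)` with `h̃` the largest bandwidth occurring
in `𝒫(x)` if `𝒫(x)` is not empty, and `θ = (1,0)ᵀ` otherwise. -/
def IsSelectedIndex (X : ℝ → Sph 2 → ℝ) (V : ℝ → Sph 2 × Sph 2 → ℝ) (C ε : ℝ) (θ : Sph 2) : Prop :=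
  ((selSet X V C ε).Nonempty →
    ∃ h, (θ, h) ∈ selSet X V C ε ∧ ∀ q ∈ selSet X V C ε, q.2 ≤ h) ∧
  (selSet X V C ε = ∅ → θ.1 0 = 1 ∧ θ.1 1 = 0)

/-- The bandwidth `ĥ` that belongs to the index `θ`. -/
def selBandwidth (X : ℝ → Sph 2 → ℝ) (C ε : ℝ) (θ : Sph 2) : ℝ :=
  sSup {h | h ∈ grid ε ∧ ∀ η ∈ grid ε, η ≤ h → |X h θ - X η θ| ≤ threshold C ε η}

/-- `T` is the estimator `F̂_{(θ̂,ĥ)}(x)` computed from the observation `Y` with the constant `C` in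
the threshold: the kernel estimators are taken in versions that are continuous in the directions,
and `θ̂` is any measurable choice. -/
def IsSelectedEstimator {Ω : Type*} [MeasurableSpace Ω] (P : Measure Ω) (K : ℝ → ℝ) (C ε : ℝ)
    (x : E 2) (Y : L2 2 → Ω → ℝ) (T : Ω → ℝ) : Prop :=
  ∃ (X : ℝ → Sph 2 → Ω → ℝ) (V : ℝ → Sph 2 × Sph 2 → Ω → ℝ) (θhat : Ω → Sph 2),
    (∀ h ∈ grid ε, ∀ θ, X h θ =ᵐ[P] Y (toL2 (weight K (mat θ h) x))) ∧
    (∀ h ∈ grid ε, ∀ᵐ ω ∂P, Continuous fun θ => X h θ ω) ∧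
    (∀ h ∈ grid ε, ∀ p, V h p =ᵐ[P] Y (toL2 (weight K (matBar p.1 p.2 h) x))) ∧
    (∀ h ∈ grid ε, ∀ᵐ ω ∂P, Continuous fun p => V h p ω) ∧
    Measurable θhat ∧
    (∀ᵐ ω ∂P, IsSelectedIndex (fun h θ => X h θ ω) (fun h p => V h p ω) C ε (θhat ω)) ∧
    (∀ᵐ ω ∂P, T ω = X (selBandwidth (fun h θ => X h θ ω) C ε (θhat ω)) (θhat ω) ω)

end SingleIndex

end

/-!
Upper bound. Write `F(z) = f(zᵀθ₀)`. In the coordinates of its window, the mean of every kernel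
estimator in use is a smoothing of `f` of width proportional to `h` along the window, and of a width
independent of `h` in the orthogonal direction; the latter only depends on the component of the
window direction orthogonal to `θ₀`. As the kernel has vanishing moments, the mean of `F̂_{(θ,h)}` is
`S(θ) + O(L h ^ β)` with a limit `S(θ)` that does not depend on `h`, and `S(θ₀) = F(x)`
(`abs_meanEst_sub_le`). If one of the two directions of the pair estimator is `θ₀`, its mean is
`O(L h ^ β)` close to `S` at the other direction (`abs_pairEst_index_left_sub_le`,
`abs_pairEst_index_right_sub_le`). So, as long as the noise stays below half the threshold,
`(θ₀, h₀)` passes the first selection step, `h₀` being the bandwidth that balances bias and noise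
(`exists_oracle_bandwidth`), and the comparison with the pair `(θ̂, θ₀)` shows that `S(θ̂)` is close to
`S(θ₀) = F(x)`; the second step cannot reject `h₀` because `S(θ̂)` does not depend on the bandwidth.
This is the pathwise inequality `abs_selected_sub_le`.

The noise is a family of Gaussian processes indexed by directions. Chaining along nets
(`NetSeq.lintegral_majorant_rpow_le`) gives continuous versions, and bounds the moment of order
proportional to `log (1 / ε)` of the supremum of the noise in units of the threshold by a constant
(`IsKernel.exists_noise_bound`). A moment of this order makes the event that the noise exceeds a large
constant negligible (`risk_le_of_dichotomy`, `IsKernel.exists_risk_bound`). The same construction of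
continuous versions, applied to the observed values themselves, defines the estimator as a measurable
function of the observation; the index is chosen as the least accepted angle
(`IsKernel.exists_isSelectedEstimator`).

Lower bound. Zero is tested against the uniform mixture of about `ε ^ (-1 / (2 β + 1))` ridge
functions through `x`, of the same profile and different directions. By the Cameron–Martin formula
(`IsWhiteNoise.lintegral_shift`) the second moment of the likelihood ratio of the mixture is the mean
of `exp (⟨F_i, F_j⟩ / ε ^ 2)`. The diagonal terms are bounded by the number of functions, and the other
ones by a constant since ridge functions in different directions are nearly orthogonal
(`inner_ridge_ne_le`). So the second moment is bounded, no statistic separates zero from the mixture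
(`rpow_div_le_of_likelihood`), and the common value of the ridge functions at `x`, which is of the order
of the rate, is a lower bound for the risk (`exists_lower_bound`).
-/

noncomputable section

namespace SingleIndex

/-! ### Gaussian moments and the white noise process -/

/-- The absolute moments of a centered Gaussian variable of standard deviation `s`, bounded through
its exponential moments; the order `p` may depend on other parameters. -/
theorem lintegral_abs_rpow_gaussianReal_le (s : NNReal) {p : ℝ} (hp : 1 ≤ p) :
    ∫⁻ x, ENNReal.ofReal |x| ^ p ∂(gaussianReal 0 (s ^ 2)) ≤ ENNReal.ofReal (4 * s * √p) ^ p := by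
  have hp0 : 0 < p := by linarith
  rcases eq_or_ne s 0 with rfl | hs
  · simp [gaussianReal_zero_var, hp0]
  have hs0 : (0 : ℝ) < s := by positivity
  have hsp : 0 < √p := Real.sqrt_pos.2 hp0
  have hpp : √p * √p = p := Real.mul_self_sqrt hp0.le
  -- `|x| ^ p ≤ (s √p) ^ p exp (l |x|)`
  set l : ℝ := √p / s with hl
  have hl0 : 0 < l := by positivity
  have key : ∀ x : ℝ, |x| ^ p ≤
      (s * √p) ^ p * (Real.exp (l * x) + Real.exp (-l * x)) := by
    intro x
    have h1 : l * |x| / p ≤ Real.exp (l * |x| / p) := by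
      have := Real.add_one_le_exp (l * |x| / p); linarith
    have h2 : (l * |x| / p) ^ p ≤ Real.exp (l * |x|) := by
      refine (Real.rpow_le_rpow (by positivity) h1 hp0.le).trans_eq ?_
      rw [← Real.exp_mul]; congr 1; field_simp
    have h3 : Real.exp (l * |x|) ≤ Real.exp (l * x) + Real.exp (-l * x) := by
      rcases abs_cases x with ⟨h, _⟩ | ⟨h, _⟩ <;> rw [h]
      · linarith [Real.exp_pos (-l * x)]
      · have : l * -x = -l * x := by ring
        rw [this]; linarith [Real.exp_pos (l * x)]
    have h4 : |x| = (s * √p) * (l * |x| / p) := by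
      rw [hl]; field_simp; rw [Real.sq_sqrt hp0.le]
    calc |x| ^ p = (s * √p) ^ p * (l * |x| / p) ^ p := by
          rw [← Real.mul_rpow (by positivity) (by positivity), ← h4]
      _ ≤ _ := by gcongr; exact h2.trans h3
  have hint : ∀ t : ℝ, ∫⁻ x, ENNReal.ofReal (Real.exp (t * x)) ∂(gaussianReal 0 (s ^ 2)) =
      ENNReal.ofReal (Real.exp (s ^ 2 * t ^ 2 / 2)) := by
    intro t
    rw [← ofReal_integral_eq_lintegral_ofReal (integrable_exp_mul_gaussianReal t)
      (ae_of_all _ fun x => (Real.exp_pos _).le)]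
    have := mgf_gaussianReal (p := gaussianReal 0 (s ^ 2)) (X := id) (μ := 0) (v := s ^ 2)
      (by simp) t
    rw [mgf] at this
    simp only [id] at this
    rw [this]; simp
  have hls : (s : ℝ) ^ 2 * l ^ 2 = p := by
    rw [hl]; field_simp; exact Real.sq_sqrt hp0.le
  calc ∫⁻ x, ENNReal.ofReal |x| ^ p ∂(gaussianReal 0 (s ^ 2))
      ≤ ∫⁻ x, ENNReal.ofReal ((s * √p) ^ p) * (ENNReal.ofReal (Real.exp (l * x)) +
          ENNReal.ofReal (Real.exp (-l * x))) ∂(gaussianReal 0 (s ^ 2)) := by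
        refine lintegral_mono fun x => ?_
        rw [ENNReal.ofReal_rpow_of_nonneg (abs_nonneg _) hp0.le,
          ← ENNReal.ofReal_add (Real.exp_pos _).le (Real.exp_pos _).le,
          ← ENNReal.ofReal_mul (by positivity)]
        exact ENNReal.ofReal_le_ofReal (key x)
    _ = ENNReal.ofReal ((s * √p) ^ p * (2 * Real.exp (p / 2))) := by
        rw [lintegral_const_mul _ (by fun_prop), lintegral_add_left (by fun_prop), hint, hint,
          ENNReal.ofReal_mul (by positivity), neg_sq, hls,
          ← ENNReal.ofReal_add (Real.exp_pos _).le (Real.exp_pos _).le, two_mul]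
    _ ≤ ENNReal.ofReal (4 * s * √p) ^ p := by
        rw [ENNReal.ofReal_rpow_of_nonneg (by positivity) hp0.le]
        refine ENNReal.ofReal_le_ofReal ?_
        have e1 : (4 * s * √p : ℝ) ^ p = (s * √p) ^ p * (4 : ℝ) ^ p := by
          rw [← Real.mul_rpow (by positivity) (by positivity)]; ring_nf
        rw [e1]
        gcongr
        have e2 : (4 : ℝ) ^ p = 2 ^ p * 2 ^ p := by
          rw [← Real.mul_rpow (by norm_num) (by norm_num)]; norm_num
        rw [e2]
        gcongr
        · simpa using Real.rpow_le_rpow_of_exponent_le (x := 2) (by norm_num) hp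
        · have : Real.exp (p / 2) = (Real.exp (1 / 2)) ^ p := by
            rw [← Real.exp_mul]; ring_nf
          rw [this]
          gcongr
          have h5 : Real.exp (1 / 2) * Real.exp (1 / 2) = Real.exp 1 := by
            rw [← Real.exp_add]; norm_num
          nlinarith [Real.exp_one_lt_d9, Real.exp_pos (1 / 2)]

variable {d : ℕ} {Ω : Type*} [MeasurableSpace Ω] {P : Measure Ω} {W : L2 d → Ω → ℝ}

namespace IsWhiteNoise

theorem memLp_two (hW : IsWhiteNoise P W) (φ : L2 d) : MemLp (W φ) 2 P :=
  (hW.gaussian.hasGaussianLaw_eval φ).memLp_two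

theorem integrable_mul (hW : IsWhiteNoise P W) (φ ψ : L2 d) :
    Integrable (fun ω => W φ ω * W ψ ω) P :=
  (hW.memLp_two φ).integrable_mul (hW.memLp_two ψ)

theorem integrable (hW : IsWhiteNoise P W) (φ : L2 d) : Integrable (W φ) P :=
  (hW.gaussian.hasGaussianLaw_eval φ).integrable

/-- A centered Gaussian combination `a W(φ) + b W(ψ)` has the law of `W(a φ + b ψ)`. -/
theorem map_combination (hW : IsWhiteNoise P W) (a b : ℝ) (φ ψ : L2 d) :
    P.map (fun ω => a * W φ ω + b * W ψ ω) = gaussianReal 0 (‖a • φ + b • ψ‖₊ ^ 2) := by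
  have hP : IsProbabilityMeasure P := hW.gaussian.isProbabilityMeasure
  have hG : HasGaussianLaw (fun ω => a * W φ ω + b * W ψ ω) P := by
    have h := (hW.gaussian.hasGaussianLaw_prodMk (s := φ) (t := ψ))
    exact h.map_fun (a • ContinuousLinearMap.fst ℝ ℝ ℝ + b • ContinuousLinearMap.snd ℝ ℝ ℝ)
  have hmean : ∫ ω, (a * W φ ω + b * W ψ ω) ∂P = 0 := by
    rw [integral_add ((hW.integrable φ).const_mul a) ((hW.integrable ψ).const_mul b),
      integral_const_mul, integral_const_mul, hW.centered, hW.centered]; simp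
  rw [hG.map_eq_gaussianReal, hmean]
  congr 1
  rw [variance_of_integral_eq_zero hG.aemeasurable hmean]
  have : ∫ ω, (a * W φ ω + b * W ψ ω) ^ 2 ∂P = ‖a • φ + b • ψ‖ ^ 2 := by
    have e : ∀ ω, (a * W φ ω + b * W ψ ω) ^ 2 = a ^ 2 * (W φ ω * W φ ω) +
        (2 * a * b * (W φ ω * W ψ ω) + b ^ 2 * (W ψ ω * W ψ ω)) := fun ω => by ring
    simp_rw [e]
    have i : Integrable (fun ω => 2 * a * b * (W φ ω * W ψ ω) + b ^ 2 * (W ψ ω * W ψ ω)) P :=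
      ((hW.integrable_mul φ ψ).const_mul _).add ((hW.integrable_mul ψ ψ).const_mul _)
    rw [integral_add ((hW.integrable_mul φ φ).const_mul _) i,
      integral_add ((hW.integrable_mul φ ψ).const_mul _) ((hW.integrable_mul ψ ψ).const_mul _),
      integral_const_mul, integral_const_mul, integral_const_mul, hW.covariance, hW.covariance,
      hW.covariance, ← real_inner_self_eq_norm_sq, inner_add_add_self]
    simp only [inner_smul_left, inner_smul_right, real_inner_comm φ ψ]
    simp only [conj_trivial]
    ring
  rw [this]
  ext
  simp

theorem map_eval (hW : IsWhiteNoise P W) (φ : L2 d) :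
    P.map (W φ) = gaussianReal 0 (‖φ‖₊ ^ 2) := by
  simpa using hW.map_combination 1 0 φ 0

theorem map_sub (hW : IsWhiteNoise P W) (φ ψ : L2 d) :
    P.map (fun ω => W φ ω - W ψ ω) = gaussianReal 0 (‖φ - ψ‖₊ ^ 2) := by
  simpa [sub_eq_add_neg] using hW.map_combination 1 (-1) φ ψ

theorem lintegral_abs_rpow_le (hW : IsWhiteNoise P W) (φ : L2 d) {p : ℝ} (hp : 1 ≤ p) :
    ∫⁻ ω, ENNReal.ofReal |W φ ω| ^ p ∂P ≤ ENNReal.ofReal (4 * ‖φ‖ * √p) ^ p := by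
  have h := lintegral_abs_rpow_gaussianReal_le ‖φ‖₊ hp
  rwa [← hW.map_eval φ, lintegral_map (by fun_prop) (hW.measurable φ)] at h

theorem lintegral_abs_sub_rpow_le (hW : IsWhiteNoise P W) (φ ψ : L2 d) {p : ℝ} (hp : 1 ≤ p) :
    ∫⁻ ω, ENNReal.ofReal |W φ ω - W ψ ω| ^ p ∂P ≤ ENNReal.ofReal (4 * ‖φ - ψ‖ * √p) ^ p := by
  have h := lintegral_abs_rpow_gaussianReal_le ‖φ - ψ‖₊ hp
  have hm : Measurable fun ω => W φ ω - W ψ ω := (hW.measurable φ).sub (hW.measurable ψ)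
  rwa [← hW.map_sub φ ψ, lintegral_map (by fun_prop) hm] at h

end IsWhiteNoise

/-! ### Continuous versions and suprema of processes on a compact space -/

/-- A sequence of finite nets of a metric space: the `n`-th net is `2⁻ⁿ`-dense and has at most
`64 * 4 ^ n` points, the growth of a space of dimension at most two. -/
structure NetSeq (T : Type*) [MetricSpace T] where
  /-- the number of points of the `n`-th net -/
  num : ℕ → ℕ
  /-- the points of the `n`-th net -/
  pt : ∀ n, Fin (num n) → T
  num_le : ∀ n, num n ≤ 64 * 4 ^ n
  exists_dist_le : ∀ n t, ∃ i, dist t (pt n i) ≤ (1 / 2) ^ n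

namespace NetSeq

variable {T : Type*} [MetricSpace T] (N : NetSeq T)

/-- The unnormalized hat function of the `i`-th point of the `n`-th net. -/
def hat (n : ℕ) (i : Fin (N.num n)) (t : T) : ℝ := max 0 (2 * (1 / 2) ^ n - dist t (N.pt n i))

/-- The interpolation of the values of `y` at the `n`-th net by a continuous partition of unity. -/
def interp (n : ℕ) (y : T → ℝ) (t : T) : ℝ :=
  (∑ i, N.hat n i t * y (N.pt n i)) / ∑ i, N.hat n i t

theorem hat_nonneg (n : ℕ) (i : Fin (N.num n)) (t : T) : 0 ≤ N.hat n i t := le_max_left _ _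

theorem dist_le_of_hat_ne_zero {n : ℕ} {i : Fin (N.num n)} {t : T} (h : N.hat n i t ≠ 0) :
    dist t (N.pt n i) ≤ 2 * (1 / 2) ^ n := by
  by_contra! h'
  exact h (max_eq_left (by linarith))

theorem sum_hat_pos (n : ℕ) (t : T) : 0 < ∑ i, N.hat n i t := by
  obtain ⟨i, hi⟩ := N.exists_dist_le n t
  refine lt_of_lt_of_le ?_ (Finset.single_le_sum (fun i _ => N.hat_nonneg n i t)
    (Finset.mem_univ i))
  have : (0 : ℝ) < (1 / 2) ^ n := by positivity
  exact lt_max_of_lt_right (by linarith)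

theorem continuous_interp (n : ℕ) (y : T → ℝ) : Continuous (N.interp n y) := by
  unfold interp hat
  refine Continuous.div (by fun_prop) (by fun_prop) fun t => (N.sum_hat_pos n t).ne'

theorem interp_le {n : ℕ} {y : T → ℝ} {t : T} {c : ℝ}
    (h : ∀ i, dist t (N.pt n i) ≤ 2 * (1 / 2) ^ n → y (N.pt n i) ≤ c) : N.interp n y t ≤ c := by
  rw [interp, div_le_iff₀ (N.sum_hat_pos n t), Finset.mul_sum]
  refine Finset.sum_le_sum fun i _ => ?_
  by_cases hi : N.hat n i t = 0
  · simp [hi]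
  · rw [mul_comm]
    exact mul_le_mul_of_nonneg_right (h i (N.dist_le_of_hat_ne_zero hi)) (N.hat_nonneg n i t)

theorem le_interp {n : ℕ} {y : T → ℝ} {t : T} {c : ℝ}
    (h : ∀ i, dist t (N.pt n i) ≤ 2 * (1 / 2) ^ n → c ≤ y (N.pt n i)) : c ≤ N.interp n y t := by
  rw [interp, le_div_iff₀ (N.sum_hat_pos n t), Finset.mul_sum]
  refine Finset.sum_le_sum fun i _ => ?_
  by_cases hi : N.hat n i t = 0
  · simp [hi]
  · rw [mul_comm c]
    exact mul_le_mul_of_nonneg_left (h i (N.dist_le_of_hat_ne_zero hi)) (N.hat_nonneg n i t)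

/-- Neighbouring points of two consecutive nets. -/
def Close (n : ℕ) (i : Fin (N.num n)) (j : Fin (N.num (n + 1))) : Prop :=
  dist (N.pt n i) (N.pt (n + 1) j) ≤ 4 * (1 / 2) ^ n

theorem abs_interp_succ_sub_le {n : ℕ} {y : T → ℝ} {B : ℝ}
    (h : ∀ i j, N.Close n i j → |y (N.pt n i) - y (N.pt (n + 1) j)| ≤ B) (t : T) :
    |N.interp (n + 1) y t - N.interp n y t| ≤ B := by
  have close : ∀ i j, dist t (N.pt n i) ≤ 2 * (1 / 2) ^ n →
      dist t (N.pt (n + 1) j) ≤ 2 * (1 / 2) ^ (n + 1) → N.Close n i j := by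
    intro i j hi hj
    have : (0 : ℝ) < (1 / 2) ^ n := by positivity
    have h3 := dist_triangle_left (N.pt n i) (N.pt (n + 1) j) t
    rw [pow_succ] at hj
    unfold Close
    linarith
  rw [abs_le]
  constructor
  · have : N.interp n y t - B ≤ N.interp (n + 1) y t := by
      refine N.le_interp fun j hj => ?_
      rw [sub_le_iff_le_add]
      refine N.interp_le fun i hi => ?_
      linarith [(abs_le.1 (h i j (close i j hi hj))).2]
    linarith
  · have : N.interp (n + 1) y t - B ≤ N.interp n y t := by
      refine N.le_interp fun i hi => ?_
      rw [sub_le_iff_le_add]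
      refine N.interp_le fun j hj => ?_
      linarith [(abs_le.1 (h i j (close i j hi hj))).1]
    linarith

/-- Geometric decay of the increments of `y` along the nets, which makes the interpolations
converge uniformly. The constant is a natural number to make this a measurable condition. -/
def Regular (y : T → ℝ) : Prop :=
  ∃ C : ℕ, ∀ n i j, N.Close n i j → |y (N.pt n i) - y (N.pt (n + 1) j)| ≤ C * (2 / 3) ^ n

open scoped Classical in
/-- The uniform limit of the interpolations of `y`, if the increments of `y` decay along the nets,
and `0` otherwise. It depends only on the values of `y` at the points of the nets. -/
def ext (y : T → ℝ) (t : T) : ℝ :=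
  if N.Regular y then Filter.limUnder Filter.atTop (fun n => N.interp n y t) else 0

theorem tendsto_interp {y : T → ℝ} (hy : N.Regular y) (t : T) :
    Filter.Tendsto (fun n => N.interp n y t) Filter.atTop (nhds (N.ext y t)) := by
  rw [ext, if_pos hy]
  obtain ⟨C, hC⟩ := hy
  refine CauchySeq.tendsto_limUnder (cauchySeq_of_le_geometric (2 / 3) C (by norm_num) fun n => ?_)
  rw [dist_comm, Real.dist_eq]
  exact N.abs_interp_succ_sub_le (hC n) t

theorem continuous_ext (y : T → ℝ) : Continuous (N.ext y) := by
  by_cases hy : N.Regular y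
  · have hlim : TendstoUniformly (fun n => N.interp n y) (N.ext y) Filter.atTop := by
      obtain ⟨C, hC⟩ := id hy
      rw [Metric.tendstoUniformly_iff]
      intro δ hδ
      have h0 : Filter.Tendsto (fun n : ℕ => C * (2 / 3 : ℝ) ^ n / (1 - 2 / 3)) Filter.atTop
          (nhds (C * 0 / (1 - 2 / 3))) :=
        ((tendsto_pow_atTop_nhds_zero_of_lt_one (by norm_num) (by norm_num)).const_mul _).div_const _
      rw [mul_zero, zero_div] at h0
      filter_upwards [h0.eventually (gt_mem_nhds hδ)] with n hn t
      rw [dist_comm]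
      refine lt_of_le_of_lt ?_ hn
      refine dist_le_of_le_geometric_of_tendsto (2 / 3) C (by norm_num) (fun m => ?_)
        (N.tendsto_interp hy t) n
      rw [dist_comm, Real.dist_eq]
      exact N.abs_interp_succ_sub_le (hC m) t
    exact hlim.continuous (Filter.Frequently.of_forall fun n => N.continuous_interp n y)
  · have : N.ext y = fun _ => 0 := by ext t; simp [NetSeq.ext, hy]
    rw [this]; exact continuous_const

theorem Regular.add {N : NetSeq T} {y z : T → ℝ} (hy : N.Regular y) (hz : N.Regular z) :
    N.Regular (fun t => y t + z t) := by
  obtain ⟨C, hC⟩ := hy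
  obtain ⟨D, hD⟩ := hz
  refine ⟨C + D, fun n i j hij => ?_⟩
  have e : y (N.pt n i) + z (N.pt n i) - (y (N.pt (n + 1) j) + z (N.pt (n + 1) j)) =
    (y (N.pt n i) - y (N.pt (n + 1) j)) + (z (N.pt n i) - z (N.pt (n + 1) j)) := by ring
  rw [e]
  push_cast
  rw [add_mul]
  exact (abs_add_le _ _).trans (add_le_add (hC n i j hij) (hD n i j hij))

theorem Regular.const_mul {N : NetSeq T} {y : T → ℝ} (hy : N.Regular y) (c : ℝ) :
    N.Regular (fun t => c * y t) := by
  obtain ⟨C, hC⟩ := hy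
  obtain ⟨D, hD⟩ := exists_nat_ge |c|
  refine ⟨D * C, fun n i j hij => ?_⟩
  rw [← mul_sub, abs_mul]
  push_cast
  rw [mul_assoc]
  exact mul_le_mul hD (hC n i j hij) (abs_nonneg _) (Nat.cast_nonneg _)

theorem regular_of_lipschitz {y : T → ℝ} {c : ℝ} (hy : ∀ s t, |y s - y t| ≤ c * dist s t) :
    N.Regular y := by
  obtain ⟨D, hD⟩ := exists_nat_ge (4 * |c|)
  refine ⟨D, fun n i j hij => ?_⟩
  calc |y (N.pt n i) - y (N.pt (n + 1) j)| ≤ |c| * (4 * (1 / 2) ^ n) :=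
        (hy _ _).trans (mul_le_mul (le_abs_self c) hij dist_nonneg (abs_nonneg c))
    _ = 4 * |c| * (1 / 2) ^ n := by ring
    _ ≤ D * (2 / 3) ^ n :=
        mul_le_mul hD (pow_le_pow_left₀ (by norm_num) (by norm_num) n) (by positivity)
          (Nat.cast_nonneg D)

section Measurability

variable {Ω : Type*} [MeasurableSpace Ω] {y : T → Ω → ℝ}

theorem measurable_interp (hy : ∀ t, Measurable (y t)) (n : ℕ) (t : T) :
    Measurable fun ω => N.interp n (fun s => y s ω) t := by
  unfold interp
  exact (Finset.measurable_sum _ fun i _ => (hy _).const_mul _).div_const _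

theorem measurableSet_regular (hy : ∀ t, Measurable (y t)) :
    MeasurableSet {ω | N.Regular fun t => y t ω} := by
  have : {ω | N.Regular fun t => y t ω} = ⋃ C : ℕ, ⋂ n, ⋂ i, ⋂ j, ⋂ _ : N.Close n i j,
      {ω | |y (N.pt n i) ω - y (N.pt (n + 1) j) ω| ≤ C * (2 / 3) ^ n} := by
    ext ω; simp [Regular]
  rw [this]
  refine MeasurableSet.iUnion fun C => MeasurableSet.iInter fun n => MeasurableSet.iInter fun i =>
    MeasurableSet.iInter fun j => MeasurableSet.iInter fun _ => ?_
  have h1 := hy (N.pt n i)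
  have h2 := hy (N.pt (n + 1) j)
  exact measurableSet_le (by fun_prop) measurable_const

theorem measurable_ext (hy : ∀ t, Measurable (y t)) (t : T) :
    Measurable fun ω => N.ext (fun s => y s ω) t := by
  classical
  refine measurable_of_tendsto_metrizable (f := fun n ω =>
    {ω | N.Regular fun t => y t ω}.indicator (fun ω => N.interp n (fun s => y s ω) t) ω)
    (fun n => (N.measurable_interp hy n t).indicator (N.measurableSet_regular hy)) ?_
  rw [tendsto_pi_nhds]
  intro ω
  by_cases h : N.Regular fun s => y s ω
  · simpa [Set.indicator, h] using N.tendsto_interp h t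
  · simp [Set.indicator, h, NetSeq.ext]

/-- The limit of the interpolations is a version of a process that is Lipschitz in mean. -/
theorem ext_ae_eq {P : Measure Ω} (hy : ∀ t, Measurable (y t))
    (hreg : ∀ᵐ ω ∂P, N.Regular fun t => y t ω) {c : ℝ≥0∞} (hc : c ≠ ∞)
    (hlip : ∀ s t, ∫⁻ ω, ENNReal.ofReal |y s ω - y t ω| ∂P ≤ c * ENNReal.ofReal (dist s t)) (t : T) :
    (fun ω => N.ext (fun s => y s ω) t) =ᵐ[P] y t := by
  set a : ℕ → Ω → ℝ≥0∞ := fun n ω => ENNReal.ofReal |N.interp n (fun s => y s ω) t - y t ω|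
  have ham : ∀ n, Measurable (a n) := fun n => by
    have := N.measurable_interp hy n t
    have := hy t
    fun_prop
  have hbound : ∀ n, ∫⁻ ω, a n ω ∂P ≤ c * ENNReal.ofReal (2 * (1 / 2) ^ n) := by
    intro n
    have hS := N.sum_hat_pos n t
    have hpt : ∀ ω, a n ω ≤ ∑ i, ENNReal.ofReal (N.hat n i t / ∑ i, N.hat n i t) *
        ENNReal.ofReal |y (N.pt n i) ω - y t ω| := by
      intro ω
      have e : N.interp n (fun s => y s ω) t - y t ω =
          ∑ i, (N.hat n i t / ∑ i, N.hat n i t) * (y (N.pt n i) ω - y t ω) := by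
        rw [interp]
        simp_rw [mul_sub, Finset.sum_sub_distrib, ← Finset.sum_mul, ← Finset.sum_div]
        rw [div_self hS.ne', one_mul, Finset.sum_div]
        congr 1
        exact Finset.sum_congr rfl fun i _ => by ring
      simp only [a]
      rw [e]
      refine (ENNReal.ofReal_le_ofReal (Finset.abs_sum_le_sum_abs _ _)).trans ?_
      rw [ENNReal.ofReal_sum_of_nonneg fun i _ => abs_nonneg _]
      refine Finset.sum_le_sum fun i _ => ?_
      have h0 : 0 ≤ N.hat n i t / ∑ i, N.hat n i t := div_nonneg (N.hat_nonneg _ _ _) hS.le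
      rw [abs_mul, abs_of_nonneg h0, ENNReal.ofReal_mul h0]
    have hm : ∀ i, Measurable fun ω => ENNReal.ofReal |y (N.pt n i) ω - y t ω| := fun i => by
      have := hy (N.pt n i)
      have := hy t
      fun_prop
    calc ∫⁻ ω, a n ω ∂P ≤ _ := lintegral_mono hpt
      _ = ∑ i, ENNReal.ofReal (N.hat n i t / ∑ i, N.hat n i t) *
          ∫⁻ ω, ENNReal.ofReal |y (N.pt n i) ω - y t ω| ∂P := by
        rw [lintegral_finsetSum _ fun i _ => (hm i).const_mul _]
        exact Finset.sum_congr rfl fun i _ => lintegral_const_mul _ (hm i)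
      _ ≤ ∑ i, ENNReal.ofReal (N.hat n i t / ∑ i, N.hat n i t) *
          (c * ENNReal.ofReal (2 * (1 / 2) ^ n)) := by
        refine Finset.sum_le_sum fun i _ => ?_
        by_cases hi : N.hat n i t = 0
        · simp [hi]
        · gcongr
          refine (hlip _ _).trans ?_
          gcongr
          rw [dist_comm]; exact N.dist_le_of_hat_ne_zero hi
      _ = c * ENNReal.ofReal (2 * (1 / 2) ^ n) := by
        rw [← Finset.sum_mul, ← ENNReal.ofReal_sum_of_nonneg fun i _ =>
          div_nonneg (N.hat_nonneg _ _ _) hS.le, ← Finset.sum_div, div_self hS.ne']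
        simp
  have htot : ∫⁻ ω, ∑' n, a n ω ∂P ≠ ∞ := by
    rw [lintegral_tsum fun n => (ham n).aemeasurable]
    refine ne_top_of_le_ne_top ?_ (ENNReal.tsum_le_tsum hbound)
    rw [ENNReal.tsum_mul_left]
    refine ENNReal.mul_ne_top hc ?_
    have hs : Summable fun n : ℕ => 2 * (1 / 2 : ℝ) ^ n :=
      (summable_geometric_of_lt_one (by norm_num) (by norm_num)).mul_left 2
    rw [← ENNReal.ofReal_tsum_of_nonneg (fun n => by positivity) hs]
    exact ENNReal.ofReal_ne_top
  filter_upwards [hreg, ae_lt_top (Measurable.tsum ham) htot] with ω h1 h2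
  have h3 := ENNReal.tendsto_atTop_zero_of_tsum_ne_top h2.ne
  have h4 : Filter.Tendsto (fun n => |N.interp n (fun s => y s ω) t - y t ω|) Filter.atTop
      (nhds 0) := by
    have := (ENNReal.tendsto_toReal ENNReal.zero_ne_top).comp h3
    simpa [a, Function.comp_def, ENNReal.toReal_ofReal] using this
  have h5 : Filter.Tendsto (fun n => N.interp n (fun s => y s ω) t) Filter.atTop (nhds (y t ω)) := by
    rw [tendsto_iff_dist_tendsto_zero]
    simpa [Real.dist_eq] using h4
  exact tendsto_nhds_unique (N.tendsto_interp h1 t) h5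

end Measurability

open scoped Classical in
/-- A pathwise bound, computed along the nets from the `n₀`-th one on, for the supremum of the
continuous extension. The weights `(3 / 2) ^ n` make the increments summable in `n`. -/
def majorant (p : ℝ) (n₀ : ℕ) (y : T → ℝ) : ℝ≥0∞ :=
  (∑ i, ENNReal.ofReal |y (N.pt n₀ i)| ^ p + ∑' n, ∑ i, ∑ j, if N.Close (n₀ + n) i j then
    ENNReal.ofReal ((3 / 2) ^ n * |y (N.pt (n₀ + n) i) - y (N.pt (n₀ + n + 1) j)|) ^ p
      else 0) ^ (1 / p)

theorem abs_le_majorant {p : ℝ} (hp : 0 < p) (n₀ : ℕ) (y : T → ℝ) (i : Fin (N.num n₀)) :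
    ENNReal.ofReal |y (N.pt n₀ i)| ≤ N.majorant p n₀ y := by
  rw [majorant, one_div, ENNReal.le_rpow_inv_iff hp]
  exact le_add_right (Finset.single_le_sum (f := fun i => ENNReal.ofReal |y (N.pt n₀ i)| ^ p)
    (fun i _ => zero_le) (Finset.mem_univ i))

theorem abs_sub_le_majorant {p : ℝ} (hp : 0 < p) (n₀ : ℕ) (y : T → ℝ) (n : ℕ)
    {i : Fin (N.num (n₀ + n))} {j : Fin (N.num (n₀ + n + 1))} (hij : N.Close (n₀ + n) i j) :
    ENNReal.ofReal ((3 / 2) ^ n * |y (N.pt (n₀ + n) i) - y (N.pt (n₀ + n + 1) j)|) ≤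
      N.majorant p n₀ y := by
  classical
  rw [majorant, one_div, ENNReal.le_rpow_inv_iff hp]
  refine le_add_left (le_trans ?_ (ENNReal.le_tsum n))
  refine le_trans ?_ (Finset.single_le_sum (fun i _ => zero_le) (Finset.mem_univ i))
  refine le_trans ?_ (Finset.single_le_sum (fun j _ => zero_le) (Finset.mem_univ j))
  rw [if_pos hij]

theorem abs_sub_le_toReal_majorant {p : ℝ} (hp : 0 < p) {n₀ : ℕ} {y : T → ℝ}
    (hU : N.majorant p n₀ y ≠ ∞) {n : ℕ}
    {i : Fin (N.num (n₀ + n))} {j : Fin (N.num (n₀ + n + 1))} (hij : N.Close (n₀ + n) i j) :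
    |y (N.pt (n₀ + n) i) - y (N.pt (n₀ + n + 1) j)| ≤
      (N.majorant p n₀ y).toReal * (2 / 3) ^ n := by
  have h := (ENNReal.ofReal_le_iff_le_toReal hU).1 (N.abs_sub_le_majorant hp n₀ y n hij)
  have e : (3 / 2 : ℝ) ^ n * (2 / 3) ^ n = 1 := by rw [← mul_pow]; norm_num
  calc _ = (3 / 2) ^ n * |y (N.pt (n₀ + n) i) - y (N.pt (n₀ + n + 1) j)| * (2 / 3) ^ n := by
        rw [mul_right_comm, e, one_mul]
    _ ≤ _ := by gcongr

theorem regular_of_majorant_ne_top {p : ℝ} (hp : 0 < p) {y : T → ℝ}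
    (hU : N.majorant p 0 y ≠ ∞) : N.Regular y := by
  obtain ⟨C, hC⟩ := exists_nat_ge (N.majorant p 0 y).toReal
  refine ⟨C, fun n => ?_⟩
  have h : ∀ (i : Fin (N.num (0 + n))) (j : Fin (N.num (0 + n + 1))), N.Close (0 + n) i j →
      |y (N.pt (0 + n) i) - y (N.pt (0 + n + 1) j)| ≤ C * (2 / 3) ^ n := fun i j hij =>
    (N.abs_sub_le_toReal_majorant hp hU hij).trans (by gcongr)
  rw [zero_add] at h
  exact h

/-- Summation of the increments along the nets: `1 + ∑ (2 / 3) ^ n = 4`. -/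
theorem abs_ext_le {p : ℝ} (hp : 0 < p) (n₀ : ℕ) {y : T → ℝ} (hy : N.Regular y) (t : T) :
    ENNReal.ofReal |N.ext y t| ≤ 4 * N.majorant p n₀ y := by
  by_cases hU : N.majorant p n₀ y = ∞
  · rw [hU]; simp
  set u := (N.majorant p n₀ y).toReal with hu
  have h0 : |N.interp n₀ y t| ≤ u := by
    have : ∀ i, |y (N.pt n₀ i)| ≤ u := fun i =>
      (ENNReal.ofReal_le_iff_le_toReal hU).1 (N.abs_le_majorant hp n₀ y i)
    exact abs_le.2 ⟨N.le_interp fun i _ => (abs_le.1 (this i)).1,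
      N.interp_le fun i _ => (abs_le.1 (this i)).2⟩
  have h1 : dist (N.interp (n₀ + 0) y t) (N.ext y t) ≤ u / (1 - 2 / 3) := by
    refine dist_le_of_le_geometric_of_tendsto₀ (2 / 3) u (by norm_num) (fun n => ?_)
      (f := fun n => N.interp (n₀ + n) y t) ?_
    · rw [dist_comm, Real.dist_eq]
      exact N.abs_interp_succ_sub_le
        (fun i j hij => N.abs_sub_le_toReal_majorant hp hU hij) t
    · have := (N.tendsto_interp hy t).comp (Filter.tendsto_add_atTop_nat n₀)
      simpa [Function.comp_def, add_comm] using this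
  rw [add_zero, Real.dist_eq, abs_sub_comm] at h1
  have h2 : |N.ext y t| ≤ 4 * u := by
    have := abs_add_le (N.ext y t - N.interp n₀ y t) (N.interp n₀ y t)
    rw [sub_add_cancel] at this
    have e : u / (1 - 2 / 3) = 3 * u := by ring
    linarith
  calc ENNReal.ofReal |N.ext y t| ≤ ENNReal.ofReal (4 * u) := ENNReal.ofReal_le_ofReal h2
    _ = 4 * N.majorant p n₀ y := by
      rw [ENNReal.ofReal_mul (by norm_num), hu, ENNReal.ofReal_toReal hU]; simp

section MajorantMoment

variable {Ω : Type*} [MeasurableSpace Ω] {y : T → Ω → ℝ}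

theorem measurable_majorant (hy : ∀ t, Measurable (y t)) (p : ℝ) (n₀ : ℕ) :
    Measurable fun ω => N.majorant p n₀ fun t => y t ω := by
  classical
  unfold majorant
  refine Measurable.pow_const (Measurable.add (Finset.measurable_sum _ fun i _ => ?_)
    (Measurable.tsum fun n => Finset.measurable_sum _ fun i _ =>
      Finset.measurable_sum _ fun j _ => ?_)) _
  · have := hy (N.pt n₀ i)
    fun_prop
  · split_ifs
    · have h1 := hy (N.pt (n₀ + n) i)
      have h2 := hy (N.pt (n₀ + n + 1) j)
      fun_prop
    · exact measurable_const

/-- The chaining bound: moments of order `p ≥ 16` of the supremum, under bounds of the moments of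
the values and of the increments, from the scale `2 ^ (-n₀)` on at which the increments are
dominated by the values. The factor `16 ^ n₀` comes from a union bound over the `n₀`-th net. -/
theorem lintegral_majorant_rpow_le {P : Measure Ω} (hy : ∀ t, Measurable (y t)) {p a b : ℝ}
    (hp : 16 ≤ p) (n₀ : ℕ) (hb : 0 ≤ b) (hab : b * (4 * (1 / 2) ^ n₀) ≤ a)
    (hval : ∀ t, ∫⁻ ω, ENNReal.ofReal |y t ω| ^ p ∂P ≤ ENNReal.ofReal a ^ p)
    (hinc : ∀ s t, ∫⁻ ω, ENNReal.ofReal |y s ω - y t ω| ^ p ∂P ≤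
      ENNReal.ofReal (b * dist s t) ^ p) :
    ∫⁻ ω, N.majorant p n₀ (fun t => y t ω) ^ p ∂P ≤ 2 ^ 16 * 16 ^ n₀ * ENNReal.ofReal a ^ p := by
  classical
  have hp0 : 0 < p := by linarith
  have e0 : ∀ ω, N.majorant p n₀ (fun t => y t ω) ^ p = _ := fun ω => by
    rw [majorant, ← ENNReal.rpow_mul, one_div_mul_cancel hp0.ne', ENNReal.rpow_one]
  simp_rw [e0]
  have hm1 : ∀ t, Measurable fun ω => ENNReal.ofReal |y t ω| ^ p := fun t => by
    have := hy t
    fun_prop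
  have hm2 : ∀ n (i : Fin (N.num (n₀ + n))) (j : Fin (N.num (n₀ + n + 1))),
      Measurable fun ω => if N.Close (n₀ + n) i j then
        ENNReal.ofReal ((3 / 2) ^ n * |y (N.pt (n₀ + n) i) ω - y (N.pt (n₀ + n + 1) j) ω|) ^ p
          else 0 := fun n i j => by
    split_ifs
    · have h1 := hy (N.pt (n₀ + n) i)
      have h2 := hy (N.pt (n₀ + n + 1) j)
      fun_prop
    · exact measurable_const
  rw [lintegral_add_left (Finset.measurable_sum _ fun i _ => hm1 _),
    lintegral_finsetSum _ fun i _ => hm1 _,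
    lintegral_tsum fun n => (Finset.measurable_sum _ fun i _ =>
      Finset.measurable_sum _ fun j _ => hm2 n i j).aemeasurable]
  have hS1 : ∑ i, ∫⁻ ω, ENNReal.ofReal |y (N.pt n₀ i) ω| ^ p ∂P ≤
      64 * 16 ^ n₀ * ENNReal.ofReal a ^ p := by
    refine (Finset.sum_le_sum fun i _ => hval _).trans ?_
    rw [Finset.sum_const, Finset.card_univ, Fintype.card_fin, nsmul_eq_mul]
    gcongr
    calc ((N.num n₀ : ℕ) : ℝ≥0∞) ≤ ((64 * 4 ^ n₀ : ℕ) : ℝ≥0∞) := by exact_mod_cast N.num_le n₀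
      _ ≤ ((64 * 16 ^ n₀ : ℕ) : ℝ≥0∞) := by
        exact_mod_cast Nat.mul_le_mul_left _ (Nat.pow_le_pow_left (by norm_num) n₀)
      _ = _ := by push_cast; rfl
  have hpair : ∀ n (i : Fin (N.num (n₀ + n))) (j : Fin (N.num (n₀ + n + 1))),
      ∫⁻ ω, (if N.Close (n₀ + n) i j then
        ENNReal.ofReal ((3 / 2) ^ n * |y (N.pt (n₀ + n) i) ω - y (N.pt (n₀ + n + 1) j) ω|) ^ p
          else 0) ∂P ≤ (1 / 32) ^ n * ENNReal.ofReal a ^ p := by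
    intro n i j
    split_ifs with hij
    · have h1 := hy (N.pt (n₀ + n) i)
      have h2 := hy (N.pt (n₀ + n + 1) j)
      have e1 : ∀ ω, ENNReal.ofReal
          ((3 / 2) ^ n * |y (N.pt (n₀ + n) i) ω - y (N.pt (n₀ + n + 1) j) ω|) ^ p =
          ENNReal.ofReal ((3 / 2) ^ n) ^ p *
            ENNReal.ofReal |y (N.pt (n₀ + n) i) ω - y (N.pt (n₀ + n + 1) j) ω| ^ p := fun ω => by
        rw [ENNReal.ofReal_mul (by positivity), ENNReal.mul_rpow_of_nonneg _ _ hp0.le]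
      simp_rw [e1]
      rw [lintegral_const_mul _ (by fun_prop)]
      calc _ ≤ ENNReal.ofReal ((3 / 2) ^ n) ^ p *
            ENNReal.ofReal (b * (4 * (1 / 2) ^ (n₀ + n))) ^ p := by
            gcongr
            refine (hinc _ _).trans ?_
            gcongr
            exact hij
        _ = ENNReal.ofReal ((3 / 4) ^ n * (b * (4 * (1 / 2) ^ n₀))) ^ p := by
            rw [← ENNReal.mul_rpow_of_nonneg _ _ hp0.le, ← ENNReal.ofReal_mul (by positivity)]
            congr 2
            rw [pow_add]
            have : (3 / 4 : ℝ) ^ n = (3 / 2) ^ n * (1 / 2) ^ n := by rw [← mul_pow]; norm_num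
            rw [this]; ring
        _ ≤ ENNReal.ofReal ((3 / 4) ^ n * a) ^ p := by gcongr
        _ = ENNReal.ofReal ((3 / 4) ^ n) ^ p * ENNReal.ofReal a ^ p := by
            rw [ENNReal.ofReal_mul (by positivity), ENNReal.mul_rpow_of_nonneg _ _ hp0.le]
        _ ≤ _ := by
            gcongr
            calc ENNReal.ofReal ((3 / 4) ^ n) ^ p ≤ ENNReal.ofReal ((3 / 4) ^ n) ^ (16 : ℝ) := by
                  refine ENNReal.rpow_le_rpow_of_exponent_ge ?_ hp
                  exact ENNReal.ofReal_le_one.2 (pow_le_one₀ (by norm_num) (by norm_num))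
              _ = ENNReal.ofReal (((3 / 4) ^ 16) ^ n) := by
                  have : (16 : ℝ) = ((16 : ℕ) : ℝ) := by norm_num
                  rw [this, ENNReal.rpow_natCast, ← ENNReal.ofReal_pow (by positivity)]
                  rw [← pow_mul, ← pow_mul, mul_comm]
              _ ≤ ENNReal.ofReal ((1 / 32) ^ n) := by
                  apply ENNReal.ofReal_le_ofReal
                  exact pow_le_pow_left₀ (by norm_num) (by norm_num) n
              _ = (1 / 32) ^ n := by
                  rw [ENNReal.ofReal_pow (by norm_num), ENNReal.ofReal_div_of_pos (by norm_num)]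
                  simp
    · simp
  have hlev : ∀ n, ∫⁻ ω, (∑ i, ∑ j, if N.Close (n₀ + n) i j then
        ENNReal.ofReal ((3 / 2) ^ n * |y (N.pt (n₀ + n) i) ω - y (N.pt (n₀ + n + 1) j) ω|) ^ p
          else 0) ∂P ≤ (1 / 2) ^ n * (2 ^ 14 * 16 ^ n₀ * ENNReal.ofReal a ^ p) := by
    intro n
    rw [lintegral_finsetSum _ fun i _ => Finset.measurable_sum _ fun j _ => hm2 n i j]
    calc _ ≤ ∑ i : Fin (N.num (n₀ + n)), ∑ j : Fin (N.num (n₀ + n + 1)),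
          (1 / 32) ^ n * ENNReal.ofReal a ^ p := by
          refine Finset.sum_le_sum fun i _ => ?_
          rw [lintegral_finsetSum _ fun j _ => hm2 n i j]
          exact Finset.sum_le_sum fun j _ => hpair n i j
      _ = ((N.num (n₀ + n) * N.num (n₀ + n + 1) : ℕ) : ℝ≥0∞) *
          ((1 / 32) ^ n * ENNReal.ofReal a ^ p) := by
          simp only [Finset.sum_const, Finset.card_univ, Fintype.card_fin, nsmul_eq_mul]
          push_cast; ring
      _ ≤ ((2 ^ 14 * 16 ^ n₀ * 16 ^ n : ℕ) : ℝ≥0∞) * ((1 / 32) ^ n * ENNReal.ofReal a ^ p) := by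
          refine mul_le_mul_left (Nat.cast_le.2 ?_) _
          calc N.num (n₀ + n) * N.num (n₀ + n + 1)
              ≤ (64 * 4 ^ (n₀ + n)) * (64 * 4 ^ (n₀ + n + 1)) :=
                Nat.mul_le_mul (N.num_le _) (N.num_le _)
            _ = 2 ^ 14 * 16 ^ n₀ * 16 ^ n := by
                have : (16 : ℕ) = 4 * 4 := rfl
                rw [this, mul_pow, mul_pow]; ring
      _ = _ := by
          push_cast
          have : (1 / 2 : ℝ≥0∞) ^ n = 16 ^ n * (1 / 32) ^ n := by
            rw [← mul_pow]; congr 1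
            rw [show (32 : ℝ≥0∞) = 16 * 2 by norm_num, one_div, one_div,
              ENNReal.mul_inv (by simp) (by simp), ← mul_assoc,
              ENNReal.mul_inv_cancel (by simp) (by simp), one_mul]
          rw [this]; ring
  have hS2 : ∑' n, ∫⁻ ω, (∑ i, ∑ j, if N.Close (n₀ + n) i j then
        ENNReal.ofReal ((3 / 2) ^ n * |y (N.pt (n₀ + n) i) ω - y (N.pt (n₀ + n + 1) j) ω|) ^ p
          else 0) ∂P ≤ 2 * (2 ^ 14 * 16 ^ n₀ * ENNReal.ofReal a ^ p) := by
    refine (ENNReal.tsum_le_tsum hlev).trans ?_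
    rw [ENNReal.tsum_mul_right, ENNReal.tsum_geometric]
    gcongr
    simp
  refine (add_le_add hS1 hS2).trans ?_
  calc _ = (64 + 2 * 2 ^ 14) * (16 ^ n₀ * ENNReal.ofReal a ^ p) := by ring
    _ ≤ 2 ^ 16 * (16 ^ n₀ * ENNReal.ofReal a ^ p) := by gcongr; norm_num
    _ = _ := by ring

end MajorantMoment

end NetSeq

/-! ### Nets of the circle, and Gaussian suprema over them -/

/-- The point of the circle with angle `φ`. -/
def circ (φ : ℝ) : Sph 2 :=
  ⟨!₂[Real.cos φ, Real.sin φ], by simp [EuclideanSpace.norm_eq, Fin.sum_univ_two]⟩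

@[simp] theorem circ_zero (φ : ℝ) : (circ φ).1 0 = Real.cos φ := rfl

@[simp] theorem circ_one (φ : ℝ) : (circ φ).1 1 = Real.sin φ := rfl

theorem sph_sq_add_sq (θ : Sph 2) : θ.1 0 ^ 2 + θ.1 1 ^ 2 = 1 := by
  have h := EuclideanSpace.real_norm_sq_eq θ.1
  rw [mem_sphere_zero_iff_norm.1 θ.2, Fin.sum_univ_two] at h
  linarith

theorem sph_ext {θ ν : Sph 2} (h0 : θ.1 0 = ν.1 0) (h1 : θ.1 1 = ν.1 1) : θ = ν := by
  ext i
  fin_cases i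
  · exact h0
  · exact h1

theorem inner_eq_coord (θ ν : E 2) : (inner ℝ θ ν : ℝ) = θ 0 * ν 0 + θ 1 * ν 1 := by
  simp [PiLp.inner_apply, Fin.sum_univ_two, mul_comm]

theorem dist_circ_le (φ ψ : ℝ) : dist (circ φ) (circ ψ) ≤ |φ - ψ| := by
  rw [Subtype.dist_eq, EuclideanSpace.dist_eq, Fin.sum_univ_two]
  apply Real.sqrt_le_iff.2 ⟨abs_nonneg _, ?_⟩
  simp only [circ_zero, circ_one, Real.dist_eq, sq_abs]
  have h1 := Real.one_sub_sq_div_two_le_cos (x := φ - ψ)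
  rw [Real.cos_sub] at h1
  nlinarith [Real.sin_sq_add_cos_sq φ, Real.sin_sq_add_cos_sq ψ]

theorem continuous_circ : Continuous circ := by
  have : LipschitzWith 1 circ := LipschitzWith.of_dist_le_mul fun φ ψ => by
    simpa [Real.dist_eq] using dist_circ_le φ ψ
  exact this.continuous

theorem exists_circ_eq (θ : Sph 2) : ∃ φ ∈ Icc (-Real.pi) Real.pi, circ φ = θ := by
  have h := sph_sq_add_sq θ
  set z : ℂ := ⟨θ.1 0, θ.1 1⟩ with hz
  have hn : ‖z‖ = 1 := by
    rw [Complex.norm_def, Complex.normSq_mk, ← sq, ← sq, h, Real.sqrt_one]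
  have hz0 : z ≠ 0 := by intro h0; simp [h0] at hn
  refine ⟨z.arg, ⟨(Complex.neg_pi_lt_arg z).le, Complex.arg_le_pi z⟩, ?_⟩
  refine sph_ext ?_ ?_
  · rw [circ_zero, Complex.cos_arg hz0, hn, div_one]
  · rw [circ_one, Complex.sin_arg, hn, div_one]

/-- Equally spaced points of the circle. -/
def circleNet : NetSeq (Sph 2) where
  num n := 8 * 2 ^ n
  pt n i := circ (-Real.pi + i * (1 / 2) ^ n)
  num_le n := Nat.mul_le_mul (by norm_num) (Nat.pow_le_pow_left (by norm_num) n)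
  exists_dist_le n t := by
    obtain ⟨φ, ⟨h1, h2⟩, rfl⟩ := exists_circ_eq t
    have hp : (0 : ℝ) < 2 ^ n := by positivity
    have h0 : 0 ≤ (φ + Real.pi) * 2 ^ n := mul_nonneg (by linarith) hp.le
    refine ⟨⟨⌊(φ + Real.pi) * 2 ^ n⌋₊, ?_⟩, ?_⟩
    · rw [Nat.floor_lt h0]
      push_cast
      gcongr
      linarith [Real.pi_lt_d2]
    · refine (dist_circ_le _ _).trans ?_
      have h3 := Nat.floor_le h0
      have h4 := Nat.lt_floor_add_one ((φ + Real.pi) * 2 ^ n)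
      have e : (1 / 2 : ℝ) ^ n * 2 ^ n = 1 := by rw [← mul_pow]; norm_num
      have hq : (0 : ℝ) < (1 / 2) ^ n := by positivity
      have e2 : φ - (-Real.pi + ⌊(φ + Real.pi) * 2 ^ n⌋₊ * (1 / 2) ^ n) =
          (1 / 2) ^ n * ((φ + Real.pi) * 2 ^ n - ⌊(φ + Real.pi) * 2 ^ n⌋₊) := by
        linear_combination (-(φ + Real.pi)) * e
      simp only
      rw [e2, abs_mul, abs_of_pos hq]
      refine mul_le_of_le_one_right hq.le ?_
      rw [abs_le]; constructor <;> linarith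

/-- Product nets of the torus. -/
def torusNet : NetSeq (Sph 2 × Sph 2) where
  num n := (8 * 2 ^ n) * (8 * 2 ^ n)
  pt n i := (circleNet.pt n (finProdFinEquiv.symm i).1, circleNet.pt n (finProdFinEquiv.symm i).2)
  num_le n := by
    have : (4 : ℕ) = 2 * 2 := rfl
    rw [this, mul_pow]
    exact (by ring : 8 * 2 ^ n * (8 * 2 ^ n) = 64 * (2 ^ n * 2 ^ n)).le
  exists_dist_le n t := by
    obtain ⟨i, hi⟩ := circleNet.exists_dist_le n t.1
    obtain ⟨j, hj⟩ := circleNet.exists_dist_le n t.2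
    refine ⟨finProdFinEquiv (i, j), ?_⟩
    rw [Equiv.symm_apply_apply, Prod.dist_eq]
    exact max_le hi hj

section WhiteNoiseSup

variable {d : ℕ} {Ω : Type*} [MeasurableSpace Ω] {P : Measure Ω} {W : L2 d → Ω → ℝ}
  {T : Type*} [MetricSpace T] (N : NetSeq T) {Φ : T → L2 d} {σ Λ : ℝ}

theorem IsWhiteNoise.lintegral_majorant_le (hW : IsWhiteNoise P W) (hΛ : 0 ≤ Λ)
    (hval : ∀ t, ‖Φ t‖ ≤ σ) (hinc : ∀ s t, ‖Φ s - Φ t‖ ≤ Λ * dist s t) {p : ℝ} (hp : 16 ≤ p)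
    {n₀ : ℕ} (hn : Λ * (4 * (1 / 2) ^ n₀) ≤ σ) :
    ∫⁻ ω, N.majorant p n₀ (fun t => W (Φ t) ω) ^ p ∂P ≤
      2 ^ 16 * 16 ^ n₀ * ENNReal.ofReal (4 * σ * √p) ^ p := by
  refine N.lintegral_majorant_rpow_le (b := 4 * Λ * √p) (fun t => hW.measurable _) hp n₀
    (by positivity) ?_ (fun t => ?_) (fun s t => ?_)
  · calc 4 * Λ * √p * (4 * (1 / 2) ^ n₀) = 4 * (Λ * (4 * (1 / 2) ^ n₀)) * √p := by ring
      _ ≤ _ := by gcongr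
  · refine (hW.lintegral_abs_rpow_le _ (by linarith)).trans ?_
    gcongr
    exact hval t
  · refine (hW.lintegral_abs_sub_rpow_le _ _ (by linarith)).trans ?_
    have : 4 * ‖Φ s - Φ t‖ * √p ≤ 4 * Λ * √p * dist s t := by
      calc _ ≤ 4 * (Λ * dist s t) * √p := by gcongr; exact hinc s t
        _ = _ := by ring
    gcongr

theorem IsWhiteNoise.ae_regular (hW : IsWhiteNoise P W) (hΛ : 0 ≤ Λ)
    (hval : ∀ t, ‖Φ t‖ ≤ σ) (hinc : ∀ s t, ‖Φ s - Φ t‖ ≤ Λ * dist s t) :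
    ∀ᵐ ω ∂P, N.Regular fun t => W (Φ t) ω := by
  have h := hW.lintegral_majorant_le N hΛ (σ := max σ (4 * Λ))
    (fun t => (hval t).trans (le_max_left _ _)) hinc (p := 16) le_rfl (n₀ := 0)
    (by simp [mul_comm])
  have hm : Measurable fun ω => N.majorant 16 0 fun t => W (Φ t) ω :=
    N.measurable_majorant (fun t => hW.measurable _) _ _
  have hfin := ae_lt_top (hm.pow_const 16) (ne_top_of_le_ne_top (by finiteness) h)
  filter_upwards [hfin] with ω hω
  refine N.regular_of_majorant_ne_top (p := 16) (by norm_num) fun h0 => ?_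
  rw [h0] at hω
  simp at hω

theorem IsWhiteNoise.lintegral_abs_sub_le (hW : IsWhiteNoise P W)
    (hinc : ∀ s t, ‖Φ s - Φ t‖ ≤ Λ * dist s t) (s t : T) :
    ∫⁻ ω, ENNReal.ofReal |W (Φ s) ω - W (Φ t) ω| ∂P ≤
      ENNReal.ofReal (4 * Λ) * ENNReal.ofReal (dist s t) := by
  have h := hW.lintegral_abs_sub_rpow_le (Φ s) (Φ t) (p := 1) le_rfl
  simp only [ENNReal.rpow_one, Real.sqrt_one, mul_one] at h
  refine h.trans ?_
  rw [← ENNReal.ofReal_mul' dist_nonneg, mul_assoc]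
  gcongr
  exact hinc s t

end WhiteNoiseSup

/-! ### The kernel and the weights -/

namespace IsKernel

variable {K : ℝ → ℝ} (hK : IsKernel K)
include hK

theorem continuous : Continuous K := hK.lipschitz.choose_spec.continuous

theorem integrable : Integrable K := hK.continuous.integrable_of_hasCompactSupport hK.compact

theorem bddAbove : BddAbove (range fun u => |K u|) := by
  obtain ⟨C, hC⟩ := hK.compact.exists_bound_of_continuous hK.continuous
  exact ⟨C, by rintro _ ⟨u, rfl⟩; exact hC u⟩

theorem abs_le_supNorm (u : ℝ) : |K u| ≤ supNorm K := le_ciSup hK.bddAbove u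

theorem one_le_l1Norm : 1 ≤ l1Norm K := by
  have h := norm_integral_le_integral_norm (μ := volume) K
  rw [hK.integral_one] at h
  simpa [l1Norm] using h

theorem supNorm_pos : 0 < supNorm K := by
  by_contra! h
  have : ∀ u, K u = 0 := fun u => by
    have := (hK.abs_le_supNorm u).trans h
    simpa using this
  have h1 := hK.integral_one
  simp [this] at h1

/-- The boundary condition at the corner `(1/2, 1/2)` forces the kernel to vanish outside
`[-1/4, 1/4]`. -/
theorem abs_le_of_ne_zero {u : ℝ} (hu : K u ≠ 0) : |u| ≤ 1 / 4 := by
  wlog h0 : 0 ≤ u generalizing u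
  · rw [← abs_neg]
    exact this (by rwa [hK.even]) (by linarith)
  have h := hK.window_pair !₂[1 / 2, 1 / 2] (fun i => by fin_cases i <;> norm_num) (circ 0)
    (circ 0) (by simp) 1 (by simp) !₂[1 / 2 + 2 * u, 1 / 2 + 2 * u] ?_ 0
  · have := h.2
    simp at this
    rw [abs_of_nonneg h0]
    linarith
  · have hi : (inner ℝ (circ 0).1 (circ 0).1 : ℝ) = 1 := by
      rw [inner_eq_coord]; simp
    have e : (1 + 1) / (2 * (1 + 1)) * (2 * u) = u := by ring
    simp only [prodKer, matBar, hi, Matrix.mulVec, dotProduct, Fin.sum_univ_two]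
    simp [e, hu]

end IsKernel

/-- The common form of the matrices `mat` and `matBar`: window of width `h` along `(a, b)` and of
width one along `(-b, a)`, up to the length of `(a, b)`. -/
def dirMat (a b h : ℝ) : Matrix (Fin 2) (Fin 2) ℝ := !![h⁻¹ * a, h⁻¹ * b; -b, a]

theorem mat_eq_dirMat (θ : Sph 2) (h : ℝ) : mat θ h = dirMat (θ.1 0) (θ.1 1) h := rfl

/-- The normalization `1 / (2 (1 + |νᵀθ|))` of the averaged directions. -/
def pairScale (θ ν : Sph 2) : ℝ := 1 / (2 * (1 + |inner ℝ ν.1 θ.1|))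

theorem matBar_eq_dirMat (θ ν : Sph 2) (h : ℝ) : matBar θ ν h =
    dirMat ((θ.1 0 + ν.1 0) * pairScale θ ν) ((θ.1 1 + ν.1 1) * pairScale θ ν) h := by
  have e : ∀ x y : ℝ, x / (2 * h * y) = h⁻¹ * (x * (1 / (2 * y))) := fun x y => by
    rw [div_eq_mul_inv, mul_inv, mul_inv, one_div, mul_inv]; ring
  simp only [matBar, dirMat, pairScale, e, mul_one_div]

theorem det_dirMat (a b h : ℝ) : (dirMat a b h).det = h⁻¹ * (a ^ 2 + b ^ 2) := by
  rw [dirMat, Matrix.det_fin_two_of]; ring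

theorem prodKer_dirMat (K : ℝ → ℝ) (a b h : ℝ) (x t : E 2) :
    prodKer K (dirMat a b h) x t = K (h⁻¹ * (a * (t 0 - x 0) + b * (t 1 - x 1))) *
      K (a * (t 1 - x 1) - b * (t 0 - x 0)) := by
  simp only [prodKer, dirMat, Matrix.mulVec, dotProduct, Fin.sum_univ_two]
  simp
  congr 2 <;> ring

theorem abs_coord_le (θ : Sph 2) (i : Fin 2) : |θ.1 i| ≤ 1 := by
  have h := sph_sq_add_sq θ
  rw [← sq_le_one_iff_abs_le_one]
  fin_cases i
  · simp only [Fin.zero_eta]; nlinarith [sq_nonneg (θ.1 1)]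
  · simp only [Fin.mk_one]; nlinarith [sq_nonneg (θ.1 0)]

theorem abs_coord_sub_le (θ ν : Sph 2) (i : Fin 2) : |θ.1 i - ν.1 i| ≤ dist θ ν := by
  rw [Subtype.dist_eq, dist_eq_norm]
  exact PiLp.norm_apply_le (θ.1 - ν.1) i

theorem pairScale_pos (θ ν : Sph 2) : 0 < pairScale θ ν := by
  unfold pairScale; positivity

theorem pairScale_le (θ ν : Sph 2) : pairScale θ ν ≤ 1 / 2 := by
  unfold pairScale
  exact one_div_le_one_div_of_le (by norm_num) (by linarith [abs_nonneg (inner ℝ ν.1 θ.1 : ℝ)])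

theorem abs_pairScale_sub_le (θ ν θ' ν' : Sph 2) :
    |pairScale θ ν - pairScale θ' ν'| ≤ dist (θ, ν) (θ', ν') := by
  set δ := dist (θ, ν) (θ', ν') with hδ
  have hθ : ‖θ.1 - θ'.1‖ ≤ δ := by
    rw [← dist_eq_norm, ← Subtype.dist_eq]; exact le_max_left _ _
  have hν : ‖ν.1 - ν'.1‖ ≤ δ := by
    rw [← dist_eq_norm, ← Subtype.dist_eq]; exact le_max_right _ _
  set i := (inner ℝ ν.1 θ.1 : ℝ) with hi
  set i' := (inner ℝ ν'.1 θ'.1 : ℝ) with hi'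
  have h1 : |i - i'| ≤ 2 * δ := by
    have e : i - i' = inner ℝ (ν.1 - ν'.1) θ.1 + inner ℝ ν'.1 (θ.1 - θ'.1) := by
      rw [inner_sub_left, inner_sub_right]; ring
    rw [e]
    have a1 := abs_real_inner_le_norm (ν.1 - ν'.1) θ.1
    have a2 := abs_real_inner_le_norm ν'.1 (θ.1 - θ'.1)
    rw [mem_sphere_zero_iff_norm.1 θ.2, mul_one] at a1
    rw [mem_sphere_zero_iff_norm.1 ν'.2, one_mul] at a2
    exact (abs_add_le _ _).trans (by linarith)
  have h2 : |(|i| - |i'|)| ≤ 2 * δ := (abs_abs_sub_abs_le_abs_sub _ _).trans h1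
  have p1 := pairScale_pos θ ν
  have p2 := pairScale_pos θ' ν'
  have q1 := pairScale_le θ ν
  have q2 := pairScale_le θ' ν'
  have e : pairScale θ ν - pairScale θ' ν' =
      2 * (pairScale θ ν * pairScale θ' ν') * (|i'| - |i|) := by
    simp only [pairScale, ← hi, ← hi']
    field_simp
    ring
  rw [e, abs_mul, abs_of_pos (by positivity), abs_sub_comm]
  nlinarith [mul_le_mul q1 q2 p2.le (by norm_num), abs_nonneg (|i| - |i'|)]

theorem abs_pairCoord_le (θ ν : Sph 2) (i : Fin 2) :
    |(θ.1 i + ν.1 i) * pairScale θ ν| ≤ 1 := by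
  rw [abs_mul, abs_of_pos (pairScale_pos θ ν)]
  have := abs_add_le (θ.1 i) (ν.1 i)
  nlinarith [abs_coord_le θ i, abs_coord_le ν i, pairScale_le θ ν, pairScale_pos θ ν,
    abs_nonneg (θ.1 i + ν.1 i)]

theorem abs_pairCoord_sub_le (θ ν θ' ν' : Sph 2) (i : Fin 2) :
    |(θ.1 i + ν.1 i) * pairScale θ ν - (θ'.1 i + ν'.1 i) * pairScale θ' ν'| ≤
      3 * dist (θ, ν) (θ', ν') := by
  set δ := dist (θ, ν) (θ', ν') with hδ
  have hθ : |θ.1 i - θ'.1 i| ≤ δ := (abs_coord_sub_le θ θ' i).trans (le_max_left _ _)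
  have hν : |ν.1 i - ν'.1 i| ≤ δ := (abs_coord_sub_le ν ν' i).trans (le_max_right _ _)
  have hs := abs_pairScale_sub_le θ ν θ' ν'
  have e : (θ.1 i + ν.1 i) * pairScale θ ν - (θ'.1 i + ν'.1 i) * pairScale θ' ν' =
      ((θ.1 i - θ'.1 i) + (ν.1 i - ν'.1 i)) * pairScale θ ν +
        (θ'.1 i + ν'.1 i) * (pairScale θ ν - pairScale θ' ν') := by ring
  rw [e]
  have a1 : |((θ.1 i - θ'.1 i) + (ν.1 i - ν'.1 i)) * pairScale θ ν| ≤ (δ + δ) * (1 / 2) := by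
    rw [abs_mul, abs_of_pos (pairScale_pos θ ν)]
    exact mul_le_mul ((abs_add_le _ _).trans (add_le_add hθ hν)) (pairScale_le θ ν)
      (pairScale_pos θ ν).le (by positivity)
  have a2 : |(θ'.1 i + ν'.1 i) * (pairScale θ ν - pairScale θ' ν')| ≤ (1 + 1) * δ := by
    rw [abs_mul]
    exact mul_le_mul ((abs_add_le _ _).trans (add_le_add (abs_coord_le θ' i) (abs_coord_le ν' i)))
      hs (abs_nonneg _) (by norm_num)
  refine (abs_add_le _ _).trans ?_
  linarith

/-! ### The observation domain and the change of variables -/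

theorem measurableSet_domain (d : ℕ) : MeasurableSet (domain d) := by
  have : domain d = ⋂ i, {t : E d | t i ∈ Icc (-1 : ℝ) 1} := by ext; simp [domain]
  rw [this]
  refine MeasurableSet.iInter fun i => ?_
  have hi : Measurable fun t : E d => t i := by fun_prop
  exact hi measurableSet_Icc

theorem volume_domain_lt_top (d : ℕ) : volume (domain d) < ∞ := by
  have h : domain d = (WithLp.ofLp : E d → Fin d → ℝ) ⁻¹' (univ.pi fun _ => Icc (-1) 1) := by
    ext; simp only [domain, mem_ofPred_eq, mem_preimage, mem_univ_pi]
  rw [h, (PiLp.volume_preserving_ofLp (Fin d)).measure_preimage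
    (MeasurableSet.univ_pi fun _ => measurableSet_Icc).nullMeasurableSet, volume_pi_pi]
  exact ENNReal.prod_lt_top fun i _ => by simp

instance (d : ℕ) : IsFiniteMeasure (domMeasure d) :=
  ⟨by rw [domMeasure, Measure.restrict_apply_univ]; exact volume_domain_lt_top d⟩

/-- The change of variables `t ↦ A (t - x)`, with the values of the linear map read as a pair. -/
theorem lintegral_comp_mulVec {A : Matrix (Fin 2) (Fin 2) ℝ} (hA : A.det ≠ 0) (x : E 2)
    (g : ℝ × ℝ → ℝ≥0∞) (hg : Measurable g) :
    ∫⁻ t : E 2, g ((A *ᵥ (fun i => t i - x i)) 0, (A *ᵥ (fun i => t i - x i)) 1) =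
      ENNReal.ofReal |A.det|⁻¹ * ∫⁻ p, g p := by
  have hm : Measurable fun w : Fin 2 → ℝ => g ((A *ᵥ w) 0, (A *ᵥ w) 1) := by
    have : Measurable fun w : Fin 2 → ℝ => A *ᵥ w :=
      (Matrix.mulVecLin A).continuous_of_finiteDimensional.measurable
    exact hg.comp ((measurable_pi_apply 0).comp this |>.prodMk ((measurable_pi_apply 1).comp this))
  have h1 : ∫⁻ t : E 2, g ((A *ᵥ (fun i => t i - x i)) 0, (A *ᵥ (fun i => t i - x i)) 1) =
      ∫⁻ w : Fin 2 → ℝ, g ((A *ᵥ (fun i => w i - x i)) 0, (A *ᵥ (fun i => w i - x i)) 1) := by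
    have hm' : Measurable fun w : Fin 2 → ℝ =>
        g ((A *ᵥ (fun i => w i - x i)) 0, (A *ᵥ (fun i => w i - x i)) 1) :=
      hm.comp (measurable_id.sub measurable_const)
    exact (PiLp.volume_preserving_ofLp (Fin 2)).lintegral_comp hm'
  have h2 : ∫⁻ w : Fin 2 → ℝ, g ((A *ᵥ (fun i => w i - x i)) 0, (A *ᵥ (fun i => w i - x i)) 1) =
      ∫⁻ w : Fin 2 → ℝ, g ((A *ᵥ w) 0, (A *ᵥ w) 1) :=
    lintegral_sub_right_eq_self (fun w : Fin 2 → ℝ => g ((A *ᵥ w) 0, (A *ᵥ w) 1)) (fun i => x i)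
  have h3 : ∫⁻ w : Fin 2 → ℝ, g ((A *ᵥ w) 0, (A *ᵥ w) 1) =
      ENNReal.ofReal |A.det|⁻¹ * ∫⁻ w : Fin 2 → ℝ, g (w 0, w 1) := by
    have hmap := Real.map_matrix_volume_pi_eq_smul_volume_pi hA
    have hm0 : Measurable fun w : Fin 2 → ℝ => g (w 0, w 1) := by fun_prop
    have hL : Measurable (Matrix.toLin' A) :=
      (Matrix.toLin' A).continuous_of_finiteDimensional.measurable
    have := lintegral_map (μ := volume) hm0 hL
    rw [hmap, lintegral_smul_measure, smul_eq_mul, abs_inv] at this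
    rw [this]
    rfl
  have h4 : ∫⁻ w : Fin 2 → ℝ, g (w 0, w 1) = ∫⁻ p, g p :=
    (volume_preserving_finTwoArrow ℝ).lintegral_comp hg
  rw [h1, h2, h3, h4]

theorem integral_comp_mulVec {A : Matrix (Fin 2) (Fin 2) ℝ} (hA : A.det ≠ 0) (x : E 2)
    (g : ℝ × ℝ → ℝ) (hg : Measurable g) :
    ∫ t : E 2, g ((A *ᵥ (fun i => t i - x i)) 0, (A *ᵥ (fun i => t i - x i)) 1) =
      |A.det|⁻¹ * ∫ p, g p := by
  have hL : Measurable fun t : E 2 =>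
      ((A *ᵥ (fun i => t i - x i)) 0, (A *ᵥ (fun i => t i - x i)) 1) := by
    simp only [Matrix.mulVec, dotProduct]; fun_prop
  have hmap : (volume : Measure (E 2)).map
      (fun t => ((A *ᵥ (fun i => t i - x i)) 0, (A *ᵥ (fun i => t i - x i)) 1)) =
      ENNReal.ofReal |A.det|⁻¹ • volume := by
    refine Measure.ext_of_lintegral _ fun f hf => ?_
    rw [lintegral_map hf hL, lintegral_comp_mulVec hA x f hf, lintegral_smul_measure, smul_eq_mul]
  rw [← integral_map (φ := fun t : E 2 =>
    ((A *ᵥ (fun i => t i - x i)) 0, (A *ᵥ (fun i => t i - x i)) 1)) hL.aemeasurable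
    hg.aestronglyMeasurable, hmap, integral_smul_measure, smul_eq_mul,
    ENNReal.toReal_ofReal (by positivity)]

/-! ### The weights as elements of `L²` -/

section ToL2

variable {d : ℕ}

theorem toL2_eq {φ : E d → ℝ} (h : MemLp φ 2 (domMeasure d)) : toL2 φ = h.toLp φ := by
  rw [toL2, dif_pos h]

theorem toL2_ae_eq {φ : E d → ℝ} (h : MemLp φ 2 (domMeasure d)) :
    toL2 φ =ᵐ[domMeasure d] φ := by
  rw [toL2_eq h]; exact h.coeFn_toLp

theorem ae_mem_domain (d : ℕ) : ∀ᵐ t ∂(domMeasure d), t ∈ domain d :=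
  ae_restrict_mem (measurableSet_domain d)

theorem memLp_of_continuous_of_bound {φ : E d → ℝ} (hφ : Continuous φ) {C : ℝ}
    (hC : ∀ t, |φ t| ≤ C) : MemLp φ 2 (domMeasure d) :=
  MemLp.of_bound hφ.aestronglyMeasurable C (ae_of_all _ hC)

theorem norm_toL2_sub_le {φ ψ : E d → ℝ} (hφ : MemLp φ 2 (domMeasure d))
    (hψ : MemLp ψ 2 (domMeasure d)) {c : ℝ} (hc : 0 ≤ c)
    (h : ∀ t ∈ domain d, |φ t - ψ t| ≤ c) :
    ‖toL2 φ - toL2 ψ‖ ≤ (domMeasure d).real univ ^ ((2 : ℝ≥0∞).toReal⁻¹) * c := by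
  refine Lp.norm_le_of_ae_bound hc ?_
  filter_upwards [ae_mem_domain d, toL2_ae_eq hφ, toL2_ae_eq hψ, Lp.coeFn_sub (toL2 φ) (toL2 ψ)]
    with t h1 h2 h3 h4
  rw [h4, Pi.sub_apply, h2, h3]
  exact h t h1

end ToL2

section Weights

variable {K : ℝ → ℝ}

theorem weight_dirMat (K : ℝ → ℝ) (a b h : ℝ) (x t : E 2) :
    weight K (dirMat a b h) x t = h⁻¹ * (a ^ 2 + b ^ 2) *
      (K (h⁻¹ * (a * (t 0 - x 0) + b * (t 1 - x 1))) * K (a * (t 1 - x 1) - b * (t 0 - x 0))) := by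
  rw [weight, det_dirMat, prodKer_dirMat]

theorem IsKernel.memLp_weight (hK : IsKernel K) (A : Matrix (Fin 2) (Fin 2) ℝ) (x : E 2) :
    MemLp (weight K A x) 2 (domMeasure 2) := by
  have hc := hK.continuous
  refine memLp_of_continuous_of_bound (C := |A.det| * (supNorm K * supNorm K)) ?_ fun t => ?_
  · unfold weight prodKer
    simp only [Matrix.mulVec, dotProduct, Fin.sum_univ_two]
    fun_prop
  · rw [weight, prodKer, abs_mul, abs_mul]
    have := hK.supNorm_pos
    gcongr <;> exact hK.abs_le_supNorm _

/-- The `L²` norm of the weights is of order `h ^ (-1/2)`. -/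
theorem IsKernel.exists_norm_weight_le (hK : IsKernel K) :
    ∃ σ : ℝ, 0 < σ ∧ ∀ (x : E 2) (a b h : ℝ), |a| ≤ 1 → |b| ≤ 1 → 0 < h →
      ‖toL2 (weight K (dirMat a b h) x)‖ ≤ σ * √(h⁻¹) := by
  have hKc := hK.continuous
  have hkk : ∫⁻ u, ENNReal.ofReal (K u ^ 2) ≠ ∞ := by
    have hi : Integrable fun u => K u ^ 2 := by
      refine Continuous.integrable_of_hasCompactSupport (by fun_prop) ?_
      exact hK.compact.comp_left (g := fun y : ℝ => y ^ 2) (by simp)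
    rw [← ofReal_integral_eq_lintegral_ofReal hi (ae_of_all _ fun u => sq_nonneg _)]
    exact ENNReal.ofReal_ne_top
  set k := (∫⁻ u, ENNReal.ofReal (K u ^ 2)).toReal with hk
  refine ⟨√2 * k + 1, by positivity, fun x a b h ha hb hh => ?_⟩
  set D := a ^ 2 + b ^ 2 with hD
  have hD2 : D ≤ 2 := by
    have := (sq_le_one_iff_abs_le_one a).2 ha
    have := (sq_le_one_iff_abs_le_one b).2 hb
    linarith
  have hD0 : 0 ≤ D := by positivity
  have hfin := hK.memLp_weight (dirMat a b h) x
  have hsq : ∫⁻ t, ENNReal.ofReal (weight K (dirMat a b h) x t ^ 2) ∂(domMeasure 2) ≤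
      ENNReal.ofReal (2 * h⁻¹ * k ^ 2) := by
    rcases eq_or_lt_of_le hD0 with h0 | h0
    · have : ∀ t, weight K (dirMat a b h) x t = 0 := fun t => by
        rw [weight_dirMat, ← hD, ← h0]; simp
      simp [this]
    have hdet : (dirMat a b h).det = h⁻¹ * D := det_dirMat a b h
    have hdp : 0 < h⁻¹ * D := by positivity
    calc _ ≤ ∫⁻ t, ENNReal.ofReal (weight K (dirMat a b h) x t ^ 2) :=
          setLIntegral_le_lintegral _ _
      _ = ∫⁻ t : E 2, (fun p : ℝ × ℝ => ENNReal.ofReal ((h⁻¹ * D) ^ 2) *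
            (ENNReal.ofReal (K p.1 ^ 2) * ENNReal.ofReal (K p.2 ^ 2)))
            ((dirMat a b h *ᵥ (fun i => t i - x i)) 0,
              (dirMat a b h *ᵥ (fun i => t i - x i)) 1) := by
          refine lintegral_congr fun t => ?_
          simp only
          rw [← ENNReal.ofReal_mul (by positivity), ← ENNReal.ofReal_mul (by positivity), weight,
            prodKer, hdet]
          congr 1; ring
      _ = ENNReal.ofReal |h⁻¹ * D|⁻¹ * (ENNReal.ofReal ((h⁻¹ * D) ^ 2) *
            (ENNReal.ofReal k * ENNReal.ofReal k)) := by
          refine (lintegral_comp_mulVec (by rw [hdet]; exact hdp.ne') x (fun p : ℝ × ℝ =>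
            ENNReal.ofReal ((h⁻¹ * D) ^ 2) * (ENNReal.ofReal (K p.1 ^ 2) *
              ENNReal.ofReal (K p.2 ^ 2))) (by fun_prop)).trans ?_
          rw [hdet, lintegral_const_mul _ (by fun_prop), Measure.volume_eq_prod,
            lintegral_prod_mul (f := fun u => ENNReal.ofReal (K u ^ 2))
              (g := fun u => ENNReal.ofReal (K u ^ 2)) (by fun_prop) (by fun_prop), hk, ENNReal.ofReal_toReal hkk]
      _ = ENNReal.ofReal (h⁻¹ * D * k ^ 2) := by
          have hk0 : 0 ≤ k := ENNReal.toReal_nonneg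
          rw [← ENNReal.ofReal_mul hk0, ← ENNReal.ofReal_mul (by positivity),
            ← ENNReal.ofReal_mul (by positivity), abs_of_pos hdp]
          congr 1; field_simp
      _ ≤ _ := by
          apply ENNReal.ofReal_le_ofReal
          have : h⁻¹ * D ≤ h⁻¹ * 2 := by gcongr
          nlinarith [sq_nonneg k]
  have hn : ‖toL2 (weight K (dirMat a b h) x)‖ ≤ √(2 * h⁻¹ * k ^ 2) := by
    rw [toL2_eq hfin, Lp.norm_toLp]
    refine ENNReal.toReal_le_of_le_ofReal (Real.sqrt_nonneg _) ?_
    rw [eLpNorm_eq_lintegral_rpow_enorm_toReal (by norm_num) (by norm_num)]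
    have e : ∀ t, ‖weight K (dirMat a b h) x t‖ₑ ^ (2 : ℝ≥0∞).toReal =
        ENNReal.ofReal (weight K (dirMat a b h) x t ^ 2) := fun t => by
      rw [Real.enorm_eq_ofReal_abs, ENNReal.toReal_ofNat, ENNReal.ofReal_rpow_of_nonneg
        (abs_nonneg _) (by norm_num)]
      norm_num
    simp_rw [e]
    rw [Real.sqrt_eq_rpow, ← ENNReal.ofReal_rpow_of_nonneg (by positivity) (by norm_num),
      ENNReal.toReal_ofNat]
    gcongr
  refine hn.trans ?_
  have hk0 : 0 ≤ k := ENNReal.toReal_nonneg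
  rw [Real.sqrt_mul (by positivity), Real.sqrt_mul (by norm_num), Real.sqrt_sq hk0]
  nlinarith [Real.sqrt_nonneg h⁻¹]

/-- The weights are Lipschitz functions of the direction. -/
theorem IsKernel.exists_norm_weight_sub_le (hK : IsKernel K) :
    ∃ Λ : ℝ, 0 < Λ ∧ ∀ x ∈ innerCube 2, ∀ a b a' b' h δ : ℝ, |a| ≤ 1 → |b| ≤ 1 → |a'| ≤ 1 →
      |b'| ≤ 1 → 0 < h → h ≤ 1 → |a - a'| ≤ δ → |b - b'| ≤ δ →
      ‖toL2 (weight K (dirMat a b h) x) - toL2 (weight K (dirMat a' b' h) x)‖ ≤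
        Λ * (h⁻¹) ^ 2 * δ := by
  obtain ⟨Q, hQ⟩ := hK.lipschitz
  set M := supNorm K with hM
  have hM0 : 0 < M := hK.supNorm_pos
  set v := (domMeasure 2).real univ ^ ((2 : ℝ≥0∞).toReal⁻¹) with hv
  have hv0 : 0 ≤ v := by positivity
  refine ⟨v * (4 * M ^ 2 + 16 * Q * M) + 1, by positivity, ?_⟩
  intro x hx a b a' b' h δ ha hb ha' hb' hh hh1 hδa hδb
  have hδ : 0 ≤ δ := (abs_nonneg _).trans hδa
  have hi1 : 1 ≤ h⁻¹ := (one_le_inv₀ hh).2 hh1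
  have hi0 : 0 < h⁻¹ := by positivity
  have hc : (0 : ℝ) ≤ (4 * M ^ 2 + 16 * Q * M) * (h⁻¹) ^ 2 * δ := by positivity
  refine (norm_toL2_sub_le (hK.memLp_weight _ _) (hK.memLp_weight _ _) hc ?_).trans ?_
  · intro t ht
    have hτ : ∀ i, |t i - x i| ≤ 2 := fun i => by
      have h1 := ht i
      have h2 := hx i
      rw [abs_le]; constructor <;> linarith [h1.1, h1.2, h2.1, h2.2]
    set τ0 := t 0 - x 0
    set τ1 := t 1 - x 1
    have h0 := hτ 0
    have h1 := hτ 1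
    rw [weight_dirMat, weight_dirMat]
    set u := h⁻¹ * (a * τ0 + b * τ1) with hu
    set u' := h⁻¹ * (a' * τ0 + b' * τ1) with hu'
    set w := a * τ1 - b * τ0 with hw
    set w' := a' * τ1 - b' * τ0 with hw'
    have lip : ∀ y z, |K y - K z| ≤ Q * |y - z| := fun y z => by
      simpa [Real.dist_eq] using hQ.dist_le_mul y z
    have d1 : |(a - a') * τ0| ≤ δ * 2 := by
      rw [abs_mul]; exact mul_le_mul hδa h0 (abs_nonneg _) hδ
    have d2 : |(b - b') * τ1| ≤ δ * 2 := by
      rw [abs_mul]; exact mul_le_mul hδb h1 (abs_nonneg _) hδ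
    have d3 : |(a - a') * τ1| ≤ δ * 2 := by
      rw [abs_mul]; exact mul_le_mul hδa h1 (abs_nonneg _) hδ
    have d4 : |(b - b') * τ0| ≤ δ * 2 := by
      rw [abs_mul]; exact mul_le_mul hδb h0 (abs_nonneg _) hδ
    have huu : |u - u'| ≤ 4 * (h⁻¹ * δ) := by
      have e : u - u' = h⁻¹ * ((a - a') * τ0 + (b - b') * τ1) := by rw [hu, hu']; ring
      rw [e, abs_mul, abs_of_pos hi0]
      have := (abs_add_le ((a - a') * τ0) ((b - b') * τ1)).trans (add_le_add d1 d2)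
      nlinarith
    have hww : |w - w'| ≤ 4 * (h⁻¹ * δ) := by
      have e : w - w' = (a - a') * τ1 - (b - b') * τ0 := by rw [hw, hw']; ring
      rw [e]
      have := (abs_sub ((a - a') * τ1) ((b - b') * τ0)).trans (add_le_add d3 d4)
      nlinarith
    have hDD : |(a ^ 2 + b ^ 2) - (a' ^ 2 + b' ^ 2)| ≤ 4 * δ := by
      have e : (a ^ 2 + b ^ 2) - (a' ^ 2 + b' ^ 2) =
        (a - a') * (a + a') + (b - b') * (b + b') := by ring
      rw [e]
      refine (abs_add_le _ _).trans ?_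
      rw [abs_mul, abs_mul]
      have s1 : |a + a'| ≤ 2 := (abs_add_le _ _).trans (by linarith)
      have s2 : |b + b'| ≤ 2 := (abs_add_le _ _).trans (by linarith)
      have := mul_le_mul hδa s1 (abs_nonneg _) hδ
      have := mul_le_mul hδb s2 (abs_nonneg _) hδ
      linarith
    have hD' : |a' ^ 2 + b' ^ 2| ≤ 2 := by
      have := (sq_le_one_iff_abs_le_one a').2 ha'
      have := (sq_le_one_iff_abs_le_one b').2 hb'
      rw [abs_of_nonneg (by positivity)]; linarith
    have e : h⁻¹ * (a ^ 2 + b ^ 2) * (K u * K w) - h⁻¹ * (a' ^ 2 + b' ^ 2) * (K u' * K w') =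
        h⁻¹ * (((a ^ 2 + b ^ 2) - (a' ^ 2 + b' ^ 2)) * (K u * K w) +
          (a' ^ 2 + b' ^ 2) * ((K u - K u') * K w + K u' * (K w - K w'))) := by ring
    rw [e, abs_mul, abs_of_pos hi0]
    have t1 : |((a ^ 2 + b ^ 2) - (a' ^ 2 + b' ^ 2)) * (K u * K w)| ≤ 4 * δ * (M * M) := by
      rw [abs_mul, abs_mul]
      have := hK.abs_le_supNorm u
      have := hK.abs_le_supNorm w
      gcongr
    have t2 : |(K u - K u') * K w + K u' * (K w - K w')| ≤
        Q * (4 * (h⁻¹ * δ)) * M + M * (Q * (4 * (h⁻¹ * δ))) := by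
      refine (abs_add_le _ _).trans (add_le_add ?_ ?_)
      · rw [abs_mul]
        exact mul_le_mul ((lip _ _).trans (by gcongr)) (hK.abs_le_supNorm w) (abs_nonneg _)
          (by positivity)
      · rw [abs_mul]
        exact mul_le_mul (hK.abs_le_supNorm u') ((lip _ _).trans (by gcongr)) (abs_nonneg _)
          hM0.le
    have t3 : |(a' ^ 2 + b' ^ 2) * ((K u - K u') * K w + K u' * (K w - K w'))| ≤
        2 * (Q * (4 * (h⁻¹ * δ)) * M + M * (Q * (4 * (h⁻¹ * δ)))) := by
      rw [abs_mul]
      exact mul_le_mul hD' t2 (abs_nonneg _) (by norm_num)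
    calc _ ≤ h⁻¹ * (4 * δ * (M * M) +
          2 * (Q * (4 * (h⁻¹ * δ)) * M + M * (Q * (4 * (h⁻¹ * δ))))) := by
          gcongr
          exact (abs_add_le _ _).trans (add_le_add t1 t3)
      _ ≤ h⁻¹ * (h⁻¹ * (4 * δ * (M * M)) +
          2 * (Q * (4 * (h⁻¹ * δ)) * M + M * (Q * (4 * (h⁻¹ * δ))))) := by
          have : 4 * δ * (M * M) ≤ h⁻¹ * (4 * δ * (M * M)) :=
            le_mul_of_one_le_left (by positivity) hi1
          gcongr
      _ = _ := by ring
  · have : 0 ≤ (h⁻¹) ^ 2 * δ := by positivity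
    nlinarith

variable {A : Matrix (Fin 2) (Fin 2) ℝ} {x : E 2} {f : ℝ → ℝ} {F : E 2 → ℝ} {θ₀ : Sph 2}

/-- The mean of a kernel estimator at a single-index function, in the coordinates of the window. -/
theorem IsKernel.integral_weight_mul (hK : IsKernel K) (hdet : 0 < A.det)
    (hwin : ∀ t, prodKer K A x t ≠ 0 → t ∈ domain 2) (hf : Continuous f)
    (hF : ∀ z, F z = f (inner ℝ z θ₀.1)) {y₀ c₁ c₂ : ℝ}
    (hc : ∀ t : E 2, (inner ℝ t θ₀.1 : ℝ) = y₀ + c₁ * (A *ᵥ (fun i => t i - x i)) 0 +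
      c₂ * (A *ᵥ (fun i => t i - x i)) 1) :
    ∫ t, toL2 (weight K A x) t * F t ∂(domMeasure 2) =
      ∫ p : ℝ × ℝ, K p.1 * K p.2 * f (y₀ + c₁ * p.1 + c₂ * p.2) := by
  have hKc := hK.continuous
  have h1 : ∫ t, toL2 (weight K A x) t * F t ∂(domMeasure 2) =
      ∫ t, weight K A x t * F t ∂(domMeasure 2) := by
    refine integral_congr_ae ?_
    filter_upwards [toL2_ae_eq (hK.memLp_weight A x)] with t ht
    rw [ht]
  have h2 : ∫ t, weight K A x t * F t ∂(domMeasure 2) = ∫ t, weight K A x t * F t := by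
    refine setIntegral_eq_integral_of_forall_compl_eq_zero fun t ht => ?_
    have : prodKer K A x t = 0 := by
      by_contra h; exact ht (hwin t h)
    simp [weight, this]
  have h3 : ∀ t, weight K A x t * F t = (fun p : ℝ × ℝ => A.det *
      (K p.1 * K p.2 * f (y₀ + c₁ * p.1 + c₂ * p.2)))
        ((A *ᵥ (fun i => t i - x i)) 0, (A *ᵥ (fun i => t i - x i)) 1) := fun t => by
    simp only
    rw [hF, hc t, weight, prodKer, mul_assoc]
  rw [h1, h2]
  simp_rw [h3]
  rw [integral_comp_mulVec hdet.ne' x (fun p : ℝ × ℝ => A.det *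
    (K p.1 * K p.2 * f (y₀ + c₁ * p.1 + c₂ * p.2))) (by fun_prop), integral_const_mul,
    abs_of_pos hdet, inv_mul_cancel_left₀ hdet.ne']

end Weights

/-! ### Smoothing of Hölder functions -/

/-- Taylor's formula for a function with Hölder continuous derivative of order `m`, by induction on
`m` through the derivative of the remainder. -/
theorem abs_sub_taylor_le {m : ℕ} {g : ℝ → ℝ} {L γ : ℝ} (hL : 0 ≤ L) (hγ : 0 < γ)
    (hg : ContDiff ℝ m g)
    (h : ∀ t s, |iteratedDeriv m g (t + s) - iteratedDeriv m g t| ≤ L * |s| ^ γ) (y z : ℝ) :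
    |g (y + z) - ∑ j ∈ Finset.range (m + 1), iteratedDeriv j g y * (z ^ j / j.factorial)| ≤
      L * |z| ^ (m + γ) := by
  induction m generalizing g z with
  | zero => simpa using h y z
  | succ m ih =>
    have hg1 : ContDiff ℝ m (deriv g) := ((contDiff_succ_iff_deriv (n := m)).1 (by simpa using hg)).2.2
    have hdiff : Differentiable ℝ g := hg.differentiable (by simp)
    have ih' := fun z => ih hg1 (by simpa only [iteratedDeriv_succ'] using h) z
    set r : ℝ → ℝ := fun z => g (y + z) -
      ∑ j ∈ Finset.range (m + 1 + 1), iteratedDeriv j g y * (z ^ j / j.factorial) with hr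
    set r' : ℝ → ℝ := fun z => deriv g (y + z) -
      ∑ j ∈ Finset.range (m + 1), iteratedDeriv j (deriv g) y * (z ^ j / j.factorial) with hr'
    have hder : ∀ w, HasDerivAt r (r' w) w := by
      intro w
      have h1 : HasDerivAt (fun z => g (y + z)) (deriv g (y + w)) w := by
        simpa using HasDerivAt.comp_const_add y w (hdiff (y + w)).hasDerivAt
      have h2 : HasDerivAt (fun z : ℝ => ∑ j ∈ Finset.range (m + 1 + 1),
          iteratedDeriv j g y * (z ^ j / j.factorial))
          (∑ j ∈ Finset.range (m + 1), iteratedDeriv j (deriv g) y * (w ^ j / j.factorial)) w := by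
        simp_rw [Finset.sum_range_succ' _ (m + 1)]
        have h3 : HasDerivAt (fun z : ℝ => ∑ j ∈ Finset.range (m + 1),
            iteratedDeriv (j + 1) g y * (z ^ (j + 1) / (j + 1).factorial))
            (∑ j ∈ Finset.range (m + 1), iteratedDeriv j (deriv g) y * (w ^ j / j.factorial)) w := by
          refine HasDerivAt.fun_sum fun j _ => ?_
          rw [iteratedDeriv_succ']
          refine HasDerivAt.const_mul _ ?_
          have := (hasDerivAt_pow (j + 1) w).div_const ((j + 1).factorial : ℝ)
          convert this using 1
          rw [Nat.factorial_succ]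
          push_cast
          field_simp
        simpa using h3.add_const (iteratedDeriv 0 g y * (1 / 1))
      exact h1.sub h2
    have hr0 : r 0 = 0 := by
      simp only [hr, Finset.sum_range_succ' _ (m + 1)]
      simp
    have hmv := Convex.norm_image_sub_le_of_norm_hasDerivWithin_le (f := r) (f' := r')
      (s := Icc (-|z|) |z|) (x := 0) (y := z) (C := L * |z| ^ (m + γ))
      (fun w _ => (hder w).hasDerivWithinAt) (fun w hw => ?_) (convex_Icc _ _)
      ⟨by simp, by simp⟩ ⟨neg_abs_le z, le_abs_self z⟩
    · rw [hr0, sub_zero, sub_zero, Real.norm_eq_abs, Real.norm_eq_abs] at hmv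
      refine hmv.trans_eq ?_
      rcases eq_or_ne z 0 with rfl | hz
      · rw [abs_zero, mul_zero, Real.zero_rpow (by positivity), mul_zero]
      · rw [mul_assoc, ← Real.rpow_add_one (abs_ne_zero.2 hz)]
        push_cast
        ring_nf
    · rw [Real.norm_eq_abs]
      refine (ih' w).trans ?_
      have : |w| ≤ |z| := abs_le.2 hw
      gcongr

theorem lt_of_mInt {β : ℝ} (hβ : 0 < β) : (mInt β : ℝ) < β ∧ β ≤ mInt β + 1 := by
  have h0 : 1 ≤ ⌈β⌉₊ := Nat.one_le_iff_ne_zero.2 (Nat.ceil_pos.2 hβ).ne'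
  have e : (mInt β : ℝ) + 1 = ⌈β⌉₊ := by
    rw [mInt, Nat.cast_sub h0]; simp
  have h1 := Nat.ceil_lt_add_one hβ.le
  have h2 := Nat.le_ceil β
  constructor <;> linarith

theorem mInt_mono {β b : ℝ} (h : β ≤ b) : mInt β ≤ mInt b :=
  Nat.sub_le_sub_right (Nat.ceil_mono h) 1

theorem abs_integral_le_of_abs_le {f g : ℝ → ℝ} (hg : Integrable g) (h : ∀ u, |f u| ≤ g u) :
    |∫ u, f u| ≤ ∫ u, g u :=
  norm_integral_le_of_norm_le (f := f) hg (ae_of_all _ h)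

section Holder

variable {β L : ℝ} {f : ℝ → ℝ}

theorem continuous_of_mem_holderClass (hf : f ∈ holderClass β L) : Continuous f :=
  hf.1.continuous

theorem abs_le_of_mem_holderClass (hf : f ∈ holderClass β L) (t : ℝ) : |f t| ≤ L := by
  simpa using hf.2.1 0 (Nat.zero_le _) t

theorem abs_sub_taylor_le_of_mem_holderClass (hβ : 0 < β) (hL : 0 < L) (hf : f ∈ holderClass β L)
    (y z : ℝ) : |f (y + z) - ∑ j ∈ Finset.range (mInt β + 1),
      iteratedDeriv j f y * (z ^ j / j.factorial)| ≤ L * |z| ^ β := by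
  have hm := lt_of_mInt hβ
  have h := abs_sub_taylor_le hL.le (sub_pos.2 hm.1) hf.1 (fun t s => ?_) y z
  · simpa using h
  · rcases lt_trichotomy s 0 with hs | rfl | hs
    · have := hf.2.2 (t + s) (-s) (by linarith)
      rw [abs_of_neg hs, abs_sub_comm]
      simpa using this
    · rw [abs_zero, Real.zero_rpow (sub_pos.2 hm.1).ne']
      simp
    · rw [abs_of_pos hs]
      exact hf.2.2 t s hs

variable {K : ℝ → ℝ} {b : ℝ}

theorem IsKernel.integrable_mul_continuous (hK : IsKernel K) {g : ℝ → ℝ} (hg : Continuous g) :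
    Integrable fun u => K u * g u := by
  have hc := hK.continuous
  refine Continuous.integrable_of_hasCompactSupport (by fun_prop) ?_
  exact hK.compact.mul_right

/-- The bias of a one-dimensional kernel smoother with vanishing moments. The factor in `|c| ≤ 4 h`
is the inverse of the size of the support of the kernel, which makes the window at most `h`. -/
theorem IsKernel.abs_smooth_sub_le (hK : IsKernel K) (hm : VanishingMoments K b) (hβ : 0 < β)
    (hβb : β ≤ b) (hL : 0 < L) (hf : f ∈ holderClass β L) {c h : ℝ} (hch : |c| ≤ 4 * h) (y : ℝ) :
    |(∫ u, K u * f (y + c * u)) - f y| ≤ l1Norm K * (L * h ^ β) := by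
  have hfc := continuous_of_mem_holderClass hf
  set p : ℝ → ℝ := fun z => ∑ j ∈ Finset.range (mInt β + 1),
      iteratedDeriv j f y * (z ^ j / j.factorial) with hp
  have hpc : Continuous p := by rw [hp]; fun_prop
  have hpoly : ∫ u, K u * p (c * u) = f y := by
    have e : ∀ u, K u * p (c * u) = ∑ j ∈ Finset.range (mInt β + 1),
        (iteratedDeriv j f y * (c ^ j / j.factorial)) * (K u * u ^ j) := fun u => by
      rw [hp]
      simp only [Finset.mul_sum]
      refine Finset.sum_congr rfl fun j _ => ?_
      rw [mul_pow]; ring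
    simp_rw [e]
    rw [integral_finsetSum _ fun j _ =>
      (hK.integrable_mul_continuous (continuous_pow j)).const_mul _]
    simp_rw [integral_const_mul]
    rw [Finset.sum_range_succ', Finset.sum_eq_zero, zero_add]
    · simp [hK.integral_one]
    · intro j hj
      have := hm (j + 1) (by omega)
        ((Nat.succ_le_of_lt (Finset.mem_range.1 hj)).trans (mInt_mono hβb))
      simp_rw [mul_comm (K _)]
      rw [this, mul_zero]
  have e : (∫ u, K u * f (y + c * u)) - f y = ∫ u, K u * (f (y + c * u) - p (c * u)) := by
    simp_rw [mul_sub]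
    rw [integral_sub (hK.integrable_mul_continuous (by fun_prop))
      (hK.integrable_mul_continuous (by fun_prop)), hpoly]
  rw [e, l1Norm, ← integral_mul_const]
  refine abs_integral_le_of_abs_le (hK.integrable.abs.mul_const _) fun u => ?_
  rw [abs_mul]
  by_cases hu : K u = 0
  · simp [hu]
  have hu' := hK.abs_le_of_ne_zero hu
  refine mul_le_mul_of_nonneg_left ?_ (abs_nonneg _)
  refine (abs_sub_taylor_le_of_mem_holderClass hβ hL hf y (c * u)).trans ?_
  have : |c * u| ≤ h := by
    rw [abs_mul]
    nlinarith [abs_nonneg c, abs_nonneg u]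
  gcongr

/-- The smoothing of `f` in the direction orthogonal to the window: the limit, as the bandwidth
tends to zero, of the means of the kernel estimators. -/
def crossSmooth (K f : ℝ → ℝ) (y c : ℝ) : ℝ := ∫ v, K v * f (y + c * v)

theorem IsKernel.abs_crossSmooth_le (hK : IsKernel K) (hf : f ∈ holderClass β L) (y c : ℝ) :
    |crossSmooth K f y c| ≤ l1Norm K * L := by
  rw [crossSmooth, l1Norm, ← integral_mul_const]
  refine abs_integral_le_of_abs_le (hK.integrable.abs.mul_const _) fun u => ?_
  rw [abs_mul]
  exact mul_le_mul_of_nonneg_left (abs_le_of_mem_holderClass hf _) (abs_nonneg _)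

theorem IsKernel.crossSmooth_zero (hK : IsKernel K) (f : ℝ → ℝ) (y : ℝ) :
    crossSmooth K f y 0 = f y := by
  simp [crossSmooth, integral_mul_const, hK.integral_one]

theorem IsKernel.crossSmooth_neg (hK : IsKernel K) (f : ℝ → ℝ) (y c : ℝ) :
    crossSmooth K f y (-c) = crossSmooth K f y c := by
  rw [crossSmooth, crossSmooth, ← integral_neg_eq_self]
  simp [hK.even]

/-- Smoothing along the window changes the mean only by the one-dimensional bias, whatever the
smoothing in the orthogonal direction. -/
theorem IsKernel.abs_integral_prod_sub_le (hK : IsKernel K) (hm : VanishingMoments K b)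
    (hβ : 0 < β) (hβb : β ≤ b) (hL : 0 < L) (hf : f ∈ holderClass β L) {c₁ h : ℝ}
    (hch : |c₁| ≤ 4 * h) (y c₂ : ℝ) :
    |(∫ p : ℝ × ℝ, K p.1 * K p.2 * f (y + c₁ * p.1 + c₂ * p.2)) - crossSmooth K f y c₂| ≤
      l1Norm K ^ 2 * (L * h ^ β) := by
  have hfc := continuous_of_mem_holderClass hf
  have hKc := hK.continuous
  have hint : Integrable (fun p : ℝ × ℝ => K p.1 * K p.2 * f (y + c₁ * p.1 + c₂ * p.2))
      (volume.prod volume) := by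
    refine (hK.integrable.mul_prod hK.integrable).mul_bdd (c := L) (by fun_prop) ?_
    exact ae_of_all _ fun p => abs_le_of_mem_holderClass hf _
  rw [Measure.volume_eq_prod, integral_prod_symm _ hint, crossSmooth]
  have e : ∀ v, ∫ u, K u * K v * f (y + c₁ * u + c₂ * v) =
      K v * ∫ u, K u * f (y + c₂ * v + c₁ * u) := fun v => by
    rw [← integral_const_mul]
    refine integral_congr_ae (ae_of_all _ fun u => ?_)
    simp only
    rw [add_right_comm]; ring
  have hint2 := hint.integral_prod_right
  simp only [e] at hint2 ⊢
  rw [← integral_sub hint2 (hK.integrable_mul_continuous (by fun_prop)), sq, mul_assoc,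
    l1Norm, ← integral_mul_const]
  refine abs_integral_le_of_abs_le (hK.integrable.abs.mul_const _) fun v => ?_
  rw [← mul_sub, abs_mul]
  exact mul_le_mul_of_nonneg_left (hK.abs_smooth_sub_le hm hβ hβb hL hf hch _) (abs_nonneg _)

end Holder

/-! ### The means of the kernel estimators -/

section Means

variable {K f : ℝ → ℝ} {F : E 2 → ℝ} {x : E 2} {θ₀ : Sph 2} {β L b h : ℝ}

/-- The common limit of the means of the kernel estimators with direction `θ` at a single-index
function with index `θ₀`. -/
def indexSmooth (K f : ℝ → ℝ) (x : E 2) (θ₀ θ : Sph 2) : ℝ :=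
  crossSmooth K f (inner ℝ x θ₀.1) (θ.1 0 * θ₀.1 1 - θ.1 1 * θ₀.1 0)

theorem IsKernel.indexSmooth_self (hK : IsKernel K) (f : ℝ → ℝ) (x : E 2) (θ₀ : Sph 2) :
    indexSmooth K f x θ₀ θ₀ = f (inner ℝ x θ₀.1) := by
  rw [indexSmooth, mul_comm (θ₀.1 0), sub_self, hK.crossSmooth_zero]

/-- The mean of the kernel estimator with the window along `s w`: by the normalization of `w`, the
inverse of its matrix maps `(u, v)` to `h u s + v s^⊥`, so that its mean is a smoothing of `f` of
width proportional to `h`, and of width independent of `h` in the orthogonal direction. -/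
theorem IsKernel.abs_mean_dirMat_sub_le (hK : IsKernel K) (hm : VanishingMoments K b)
    (hβ : 0 < β) (hβb : β ≤ b) (hL : 0 < L) (hf : f ∈ holderClass β L)
    (hF : ∀ z, F z = f (inner ℝ z θ₀.1)) {s₀ s₁ w : ℝ} (hs₀ : |s₀| ≤ 2) (hs₁ : |s₁| ≤ 2)
    (hw : w * (s₀ ^ 2 + s₁ ^ 2) = 1) (hh : 0 < h)
    (hwin : ∀ t, prodKer K (dirMat (s₀ * w) (s₁ * w) h) x t ≠ 0 → t ∈ domain 2) :
    |(∫ t, toL2 (weight K (dirMat (s₀ * w) (s₁ * w) h) x) t * F t ∂(domMeasure 2)) -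
      crossSmooth K f (inner ℝ x θ₀.1) (s₀ * θ₀.1 1 - s₁ * θ₀.1 0)| ≤
      l1Norm K ^ 2 * (L * h ^ β) := by
  set q₀ := θ₀.1 0
  set q₁ := θ₀.1 1
  have hq₀ : |q₀| ≤ 1 := abs_coord_le θ₀ 0
  have hq₁ : |q₁| ≤ 1 := abs_coord_le θ₀ 1
  have hw0 : 0 < w := by
    by_contra! h0
    nlinarith [mul_nonneg (neg_nonneg.2 h0) (by positivity : 0 ≤ s₀ ^ 2 + s₁ ^ 2)]
  have hdet : 0 < (dirMat (s₀ * w) (s₁ * w) h).det := by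
    have e : (s₀ * w) ^ 2 + (s₁ * w) ^ 2 = w := by linear_combination w * hw
    rw [det_dirMat, e]; positivity
  rw [hK.integral_weight_mul (θ₀ := θ₀) (f := f) (y₀ := inner ℝ x θ₀.1)
    (c₁ := h * (s₀ * q₀ + s₁ * q₁)) (c₂ := s₀ * q₁ - s₁ * q₀) hdet hwin
    (continuous_of_mem_holderClass hf) hF]
  · refine hK.abs_integral_prod_sub_le hm hβ hβb hL hf ?_ _ _
    rw [abs_mul, abs_of_pos hh, mul_comm]
    have : |s₀ * q₀ + s₁ * q₁| ≤ 4 := by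
      refine (abs_add_le _ _).trans ?_
      rw [abs_mul, abs_mul]
      nlinarith [abs_nonneg s₀, abs_nonneg s₁, abs_nonneg q₀, abs_nonneg q₁]
    gcongr
  · intro t
    have hh' : h * h⁻¹ = 1 := mul_inv_cancel₀ hh.ne'
    rw [inner_eq_coord, inner_eq_coord]
    simp only [dirMat, Matrix.mulVec, dotProduct, Fin.sum_univ_two]
    simp only [Matrix.of_apply, Matrix.cons_val', Matrix.cons_val_zero, Matrix.cons_val_one,
      Matrix.cons_val_fin_one]
    change t 0 * q₀ + t 1 * q₁ = _
    change _ = x 0 * q₀ + x 1 * q₁ + _ + _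
    linear_combination (-(w * (s₀ * q₀ + s₁ * q₁) * (s₀ * (t 0 - x 0) + s₁ * (t 1 - x 1)))) * hh'
      - (q₀ * (t 0 - x 0) + q₁ * (t 1 - x 1)) * hw

/-- The mean of the estimator `F̂_{(θ,h)}(x)`. -/
def meanEst (K : ℝ → ℝ) (x : E 2) (F : E 2 → ℝ) (h : ℝ) (θ : Sph 2) : ℝ :=
  ∫ t, toL2 (weight K (mat θ h) x) t * F t ∂(domMeasure 2)

/-- The mean of the kernel estimator with the matrix `Ē_{(θ,h)(ν,h)}`. -/
def meanPair (K : ℝ → ℝ) (x : E 2) (F : E 2 → ℝ) (h : ℝ) (p : Sph 2 × Sph 2) : ℝ :=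
  ∫ t, toL2 (weight K (matBar p.1 p.2 h) x) t * F t ∂(domMeasure 2)

variable (hK : IsKernel K) (hm : VanishingMoments K b) (hβ : 0 < β) (hβb : β ≤ b) (hL : 0 < L)
  (hf : f ∈ holderClass β L) (hF : ∀ z, F z = f (inner ℝ z θ₀.1)) (hx : x ∈ innerCube 2)
  (hh : h ∈ Ioc (0 : ℝ) 1)
include hK hm hβ hβb hL hf hF hx hh

theorem abs_meanEst_sub_le (θ : Sph 2) :
    |meanEst K x F h θ - indexSmooth K f x θ₀ θ| ≤ l1Norm K ^ 2 * (L * h ^ β) := by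
  have hwin := hK.window x hx θ h hh
  rw [mat_eq_dirMat] at hwin
  have := hK.abs_mean_dirMat_sub_le hm hβ hβb hL hf hF (s₀ := θ.1 0) (s₁ := θ.1 1) (w := 1)
    ((abs_coord_le θ 0).trans (by norm_num)) ((abs_coord_le θ 1).trans (by norm_num))
    (by rw [one_mul, sph_sq_add_sq]) hh.1 (by simpa using hwin)
  simpa [meanEst, mat_eq_dirMat, indexSmooth] using this

theorem abs_meanPair_sub_le {θ ν : Sph 2} (hθν : 0 ≤ (inner ℝ ν.1 θ.1 : ℝ)) :
    |meanPair K x F h (θ, ν) - crossSmooth K f (inner ℝ x θ₀.1)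
      ((θ.1 0 + ν.1 0) * θ₀.1 1 - (θ.1 1 + ν.1 1) * θ₀.1 0)| ≤ l1Norm K ^ 2 * (L * h ^ β) := by
  have hwin := hK.window_pair x hx θ ν hθν h hh
  rw [matBar_eq_dirMat] at hwin
  rw [meanPair, matBar_eq_dirMat]
  refine hK.abs_mean_dirMat_sub_le hm hβ hβb hL hf hF ?_ ?_ ?_ hh.1 hwin
  · exact (abs_add_le _ _).trans (by linarith [abs_coord_le θ 0, abs_coord_le ν 0])
  · exact (abs_add_le _ _).trans (by linarith [abs_coord_le θ 1, abs_coord_le ν 1])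
  · rw [pairScale, abs_of_nonneg hθν]
    have h0 : (2 * (1 + (inner ℝ ν.1 θ.1 : ℝ))) ≠ 0 := by positivity
    have h1 : (θ.1 0 + ν.1 0) ^ 2 + (θ.1 1 + ν.1 1) ^ 2 = 2 * (1 + (inner ℝ ν.1 θ.1 : ℝ)) := by
      rw [inner_eq_coord]
      linear_combination sph_sq_add_sq θ + sph_sq_add_sq ν
    rw [h1, one_div, inv_mul_cancel₀ h0]

/-- If one direction is the index, the component of `θ + ν` orthogonal to the index is that of the
other direction. So the pair estimator has nearly the mean of the estimator in that direction. -/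
theorem abs_pairEst_index_left_sub_le (ν : Sph 2) :
    |pairEst (meanPair K x F) h θ₀ ν - indexSmooth K f x θ₀ ν| ≤ l1Norm K ^ 2 * (L * h ^ β) := by
  have e0 : (-θ₀).1 0 = -θ₀.1 0 := rfl
  have e1 : (-θ₀).1 1 = -θ₀.1 1 := rfl
  rw [pairEst, indexSmooth]
  split_ifs with hi
  · convert abs_meanPair_sub_le hK hm hβ hβb hL hf hF hx hh hi using 4
    ring
  · have hi' : 0 ≤ (inner ℝ ν.1 (-θ₀).1 : ℝ) := by
      rw [show (-θ₀).1 = -θ₀.1 from rfl, inner_neg_right]; linarith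
    convert abs_meanPair_sub_le hK hm hβ hβb hL hf hF hx hh hi' using 4
    rw [e0, e1]
    ring

/-- The change of the sign of `θ` in the pair estimator is harmless because the kernel is even. -/
theorem abs_pairEst_index_right_sub_le (θ : Sph 2) :
    |pairEst (meanPair K x F) h θ θ₀ - indexSmooth K f x θ₀ θ| ≤ l1Norm K ^ 2 * (L * h ^ β) := by
  have e0 : (-θ).1 0 = -θ.1 0 := rfl
  have e1 : (-θ).1 1 = -θ.1 1 := rfl
  rw [pairEst, indexSmooth]
  split_ifs with hi
  · convert abs_meanPair_sub_le hK hm hβ hβb hL hf hF hx hh hi using 4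
    ring
  · have hi' : 0 ≤ (inner ℝ θ₀.1 (-θ).1 : ℝ) := by
      rw [show (-θ).1 = -θ.1 from rfl, inner_neg_right]; linarith
    have := abs_meanPair_sub_le hK hm hβ hβb hL hf hF hx hh hi'
    rw [← hK.crossSmooth_neg]
    convert this using 4
    rw [e0, e1]
    ring

end Means

/-! ### The bandwidth grid and the pathwise oracle inequality -/

theorem grid_pos {ε h : ℝ} (hh : h ∈ grid ε) : 0 < h := by
  obtain ⟨⟨k, rfl⟩, -⟩ := hh
  positivity

theorem grid_le_one {ε h : ℝ} (hh : h ∈ grid ε) : h ≤ 1 := hh.2.2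

theorem grid_mem_Ioc {ε h : ℝ} (hh : h ∈ grid ε) : h ∈ Ioc (0 : ℝ) 1 :=
  ⟨grid_pos hh, grid_le_one hh⟩

theorem one_mem_grid {ε : ℝ} (hε : 0 < ε) (hε1 : ε < 1) : 1 ∈ grid ε :=
  ⟨⟨0, by simp⟩, by nlinarith, le_rfl⟩

theorem finite_grid {ε : ℝ} (hε : 0 < ε) : (grid ε).Finite := by
  obtain ⟨N, hN⟩ := exists_pow_lt_of_lt_one (pow_pos hε 2) (show (2 : ℝ)⁻¹ < 1 by norm_num)
  refine ((Finset.range N).finite_toSet.image fun k : ℕ => (2 : ℝ)⁻¹ ^ k).subset ?_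
  rintro h ⟨⟨k, rfl⟩, h1, -⟩
  refine ⟨k, ?_, rfl⟩
  rw [Finset.mem_coe, Finset.mem_range]
  by_contra! hk
  have := pow_le_pow_of_le_one (by norm_num) (show (2 : ℝ)⁻¹ ≤ 1 by norm_num) hk
  linarith

theorem threshold_nonneg {C ε h : ℝ} (hC : 0 ≤ C) (hε : 0 < ε) : 0 ≤ threshold C ε h := by
  unfold threshold; positivity

theorem threshold_anti {C ε h η : ℝ} (hC : 0 ≤ C) (hε : 0 < ε) (hε1 : ε < 1) (hη : 0 < η)
    (hle : η ≤ h) : threshold C ε h ≤ threshold C ε η := by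
  have : 0 ≤ Real.log (1 / ε) := Real.log_nonneg (by rw [le_div_iff₀ hε]; linarith)
  unfold threshold
  gcongr

section Oracle

variable {X : ℝ → Sph 2 → ℝ} {V : ℝ → Sph 2 × Sph 2 → ℝ} {C ε : ℝ} {θ : Sph 2}

theorem selBandwidth_mem (hε : 0 < ε) (hε1 : ε < 1) (hC : 0 ≤ C) (X : ℝ → Sph 2 → ℝ) (θ : Sph 2) :
    selBandwidth X C ε θ ∈
      {h | h ∈ grid ε ∧ ∀ η ∈ grid ε, η ≤ h → |X h θ - X η θ| ≤ threshold C ε η} := by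
  refine Set.Nonempty.csSup_mem ?_ ((finite_grid hε).subset fun h hh => hh.1)
  obtain ⟨h, hh, hmin⟩ := (finite_grid hε).exists_minimalFor id _ ⟨1, one_mem_grid hε hε1⟩
  refine ⟨h, hh, fun η hη hle => ?_⟩
  rw [le_antisymm hle (hmin hη hle), sub_self, abs_zero]
  exact threshold_nonneg hC hε

theorem le_selBandwidth (hε : 0 < ε) {h : ℝ} (hh : h ∈ grid ε)
    (hX : ∀ η ∈ grid ε, η ≤ h → |X h θ - X η θ| ≤ threshold C ε η) :
    h ≤ selBandwidth X C ε θ :=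
  le_csSup ((finite_grid hε).subset fun _ hh => hh.1).bddAbove ⟨hh, hX⟩

theorem selStat_le_zero_iff (hε : 0 < ε) {h : ℝ} (hh : h ∈ grid ε) :
    selStat X V C ε θ h ≤ 0 ↔
      ∀ η ∈ grid ε, η ≤ h → (⨆ ν : Sph 2, |pairEst V η θ ν - X η ν|) ≤ threshold C ε η := by
  have hfin : ((fun η => (⨆ ν : Sph 2, |pairEst V η θ ν - X η ν|) - threshold C ε η) ''
      {η | η ∈ grid ε ∧ η ≤ h}).Finite := ((finite_grid hε).subset fun η hη => hη.1).image _
  rw [selStat, csSup_le_iff hfin.bddAbove ⟨_, h, ⟨hh, le_rfl⟩, rfl⟩]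
  constructor
  · intro H η h1 h2
    linarith [H _ ⟨η, ⟨h1, h2⟩, rfl⟩]
  · rintro H _ ⟨η, ⟨h1, h2⟩, rfl⟩
    linarith [H η h1 h2]

/-- The pathwise oracle inequality. If, up to a bandwidth `h₀`, all estimators are within half a
threshold of their idealized means, the pair estimators that involve the true index being compared
with the mean of the other direction, then the loss of the selected estimator is of the order of
the threshold at `h₀`. The second selection step never rejects `h₀`, whatever the direction,
because the idealized means do not depend on the bandwidth. -/
theorem abs_selected_sub_le (hε : 0 < ε) (hε1 : ε < 1) (hC : 0 ≤ C) {h₀ : ℝ} (hh₀ : h₀ ∈ grid ε)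
    {S : Sph 2 → ℝ} {θ₀ : Sph 2}
    (hX : ∀ h ∈ grid ε, h ≤ h₀ → ∀ ν, |X h ν - S ν| ≤ threshold C ε h / 2)
    (hV₁ : ∀ h ∈ grid ε, h ≤ h₀ → ∀ ν, |pairEst V h θ₀ ν - S ν| ≤ threshold C ε h / 2)
    (hV₂ : ∀ h ∈ grid ε, h ≤ h₀ → ∀ ν, |pairEst V h ν θ₀ - S ν| ≤ threshold C ε h / 2)
    (hbdd : ∀ h ∈ grid ε, ∀ ν, BddAbove (range fun ν' : Sph 2 => |pairEst V h ν ν' - X h ν'|))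
    (hsel : IsSelectedIndex X V C ε θ) :
    |X (selBandwidth X C ε θ) θ - S θ₀| ≤ 4 * threshold C ε h₀ := by
  have hne : (Sph 2).Nonempty := ⟨_, θ.2⟩
  have : Nonempty (Sph 2) := hne.to_subtype
  have hmem : (θ₀, h₀) ∈ selSet X V C ε := by
    refine ⟨hh₀, (selStat_le_zero_iff hε hh₀).2 fun η hη hle => ciSup_le fun ν => ?_⟩
    have h1 := hV₁ η hη hle ν
    have h2 := hX η hη hle ν
    rw [abs_sub_comm] at h2
    linarith [abs_sub_le (pairEst V η θ₀ ν) (S ν) (X η ν)]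
  obtain ⟨h, hθ, hmax⟩ := hsel.1 ⟨_, hmem⟩
  have hle : h₀ ≤ h := hmax _ hmem
  have hst := (selStat_le_zero_iff hε hθ.1).1 hθ.2 h₀ hh₀ hle
  have h1 : |pairEst V h₀ θ θ₀ - X h₀ θ₀| ≤ threshold C ε h₀ :=
    (le_ciSup (hbdd h₀ hh₀ θ) θ₀).trans hst
  have h2 := hV₂ h₀ hh₀ le_rfl θ
  rw [abs_sub_comm] at h2
  have h3 := hX h₀ hh₀ le_rfl θ₀
  have h4 := hX h₀ hh₀ le_rfl θ
  have hband : h₀ ≤ selBandwidth X C ε θ := by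
    refine le_selBandwidth hε hh₀ fun η hη hle => ?_
    have a1 := hX η hη hle θ
    rw [abs_sub_comm] at a1
    have a2 := threshold_anti hC hε hε1 (grid_pos hη) hle
    linarith [abs_sub_le (X h₀ θ) (S θ) (X η θ)]
  have h5 := (selBandwidth_mem hε hε1 hC X θ).2 h₀ hh₀ hband
  have t1 := abs_sub_le (X (selBandwidth X C ε θ) θ) (X h₀ θ) (S θ₀)
  have t2 := abs_sub_le (X h₀ θ) (S θ) (S θ₀)
  have t3 := abs_sub_le (S θ) (pairEst V h₀ θ θ₀) (S θ₀)
  have t4 := abs_sub_le (pairEst V h₀ θ θ₀) (X h₀ θ₀) (S θ₀)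
  have := threshold_nonneg (h := h₀) hC hε
  linarith

/-- The oracle bandwidth: the largest bandwidth of the grid at which the bias does not exceed the
stochastic error, which is then of the order of the rate. -/
theorem exists_oracle_bandwidth (hε : 0 < ε) (hε1 : ε < 1) {β L c : ℝ} (hβ : 0 < β) (hL : 0 < L)
    (hc : 0 < c) (hcond : 2 * L * c ≤ √(Real.log (1 / ε))) :
    ∃ h₀ ∈ grid ε, c * L * h₀ ^ β ≤ threshold 1 ε h₀ ∧
      threshold 1 ε h₀ ≤ 2 * max 1 c * rate ε β L + ε * √(Real.log (1 / ε)) := by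
  set l := Real.log (1 / ε) with hl
  have hl0 : 0 < l := Real.log_pos (by rw [lt_div_iff₀ hε]; linarith)
  have hD : 0 < ε * √l := by positivity
  have hthr : ∀ h, 0 < h → threshold 1 ε h = ε * √l / √h := fun h hh => by
    rw [threshold, ← hl, Real.sqrt_mul (by positivity), Real.sqrt_inv]
    field_simp
  set s := {h | h ∈ grid ε ∧ c * L * h ^ β ≤ threshold 1 ε h} with hs
  have hfin : s.Finite := (finite_grid hε).subset fun h hh => hh.1
  have hne : s.Nonempty := by
    obtain ⟨h, hh, hmin⟩ := (finite_grid hε).exists_minimalFor id _ ⟨1, one_mem_grid hε hε1⟩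
    have h2 : h < 2 * ε ^ 2 := by
      by_contra! h2
      obtain ⟨⟨k, rfl⟩, h3, h4⟩ := hh
      have hp : (0 : ℝ) < 2⁻¹ ^ k := by positivity
      have hm : (2 : ℝ)⁻¹ ^ (k + 1) ∈ grid ε :=
        ⟨⟨k + 1, rfl⟩, by rw [pow_succ (2 : ℝ)⁻¹]; linarith, by rw [pow_succ (2 : ℝ)⁻¹]; linarith⟩
      have h5 : (2 : ℝ)⁻¹ ^ (k + 1) ≤ 2⁻¹ ^ k := by rw [pow_succ]; linarith
      have h6 := hmin hm h5
      simp only [id] at h6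
      rw [pow_succ] at h6
      linarith
    have hp := grid_pos hh
    refine ⟨h, hh, ?_⟩
    rw [hthr h hp, le_div_iff₀ (Real.sqrt_pos.2 hp)]
    have h5 : √h ≤ 2 * ε := by
      rw [Real.sqrt_le_left (by positivity)]; nlinarith
    have h6 : h ^ β ≤ 1 := Real.rpow_le_one hp.le (grid_le_one hh) hβ.le
    calc c * L * h ^ β * √h ≤ c * L * 1 * (2 * ε) := by gcongr
      _ = ε * (2 * L * c) := by ring
      _ ≤ _ := by gcongr
  obtain ⟨h₀, ⟨hg, hb⟩, hmax⟩ := hfin.exists_maximalFor id _ hne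
  have hp := grid_pos hg
  have hrate : 0 ≤ rate ε β L := by unfold rate; positivity
  refine ⟨h₀, hg, hb, ?_⟩
  by_cases h1 : h₀ = 1
  · rw [hthr h₀ hp, h1, Real.sqrt_one, div_one]
    have : 0 ≤ 2 * max 1 c * rate ε β L := by positivity
    linarith
  · set H := 2 * h₀ with hH
    have hHp : 0 < H := by positivity
    have hHg : H ∈ grid ε := by
      obtain ⟨⟨k, rfl⟩, h3, h4⟩ := hg
      obtain _ | k := k
      · simp at h1
      · have e : H = 2⁻¹ ^ k := by rw [hH, pow_succ]; ring
        refine ⟨⟨k, e⟩, by linarith, ?_⟩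
        rw [e]; exact pow_le_one₀ (by norm_num) (by norm_num)
    have hlt : ε * √l / √H < c * L * H ^ β := by
      by_contra! h
      have := hmax (j := H) ⟨hHg, by rwa [hthr H hHp]⟩ (by simp only [id]; linarith)
      simp only [id] at this
      linarith
    have hsH : 0 < √H := Real.sqrt_pos.2 hHp
    set D := ε * √l with hDdef
    set q := 2 * β + 1 with hq
    have hq0 : 0 < q := by positivity
    -- the violated inequality at `2 h₀`, solved for the bandwidth
    have h2 : (D / (c * L)) ^ (1 / q) ≤ √H := by
      have h3 : D / (c * L) ≤ √H ^ q := by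
        rw [div_le_iff₀ (by positivity)]
        rw [div_lt_iff₀ hsH] at hlt
        have e : √H ^ q = H ^ β * √H := by
          rw [Real.sqrt_eq_rpow, ← Real.rpow_mul hHp.le, ← Real.rpow_add hHp]
          congr 1; rw [hq]; ring
        rw [e]; linarith
      calc (D / (c * L)) ^ (1 / q) ≤ (√H ^ q) ^ (1 / q) := by gcongr
        _ = √H := by
          rw [← Real.rpow_mul hsH.le, mul_one_div_cancel hq0.ne', Real.rpow_one]
    have h4 : D / √H ≤ c ^ (1 / q) * rate ε β L := by
      rw [div_le_iff₀ hsH]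
      have hcl : 0 < c * L := by positivity
      calc D = c ^ (1 / q) * (L ^ (1 / q) * D ^ (2 * β / q)) * (D / (c * L)) ^ (1 / q) := by
            rw [Real.div_rpow hD.le hcl.le, Real.mul_rpow hc.le hL.le]
            have e : D ^ (2 * β / q) * D ^ (1 / q) = D := by
              rw [← Real.rpow_add hD, ← add_div, div_self hq0.ne', Real.rpow_one]
            have c0 : c ^ (1 / q) ≠ 0 := (Real.rpow_pos_of_pos hc _).ne'
            have l0 : L ^ (1 / q) ≠ 0 := (Real.rpow_pos_of_pos hL _).ne'
            field_simp
            exact e.symm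
        _ ≤ _ := by
            rw [rate]
            gcongr
    have h5 : c ^ (1 / q) ≤ max 1 c := by
      calc c ^ (1 / q) ≤ (max 1 c) ^ (1 / q) := by gcongr; exact le_max_right _ _
        _ ≤ (max 1 c) ^ (1 : ℝ) := by
            refine Real.rpow_le_rpow_of_exponent_le (le_max_left _ _) ?_
            rw [div_le_one hq0]; linarith
        _ = _ := Real.rpow_one _
    rw [hthr h₀ hp]
    have h6 : √H ≤ 2 * √h₀ := by
      rw [hH, Real.sqrt_mul (by norm_num)]
      gcongr
      rw [Real.sqrt_le_left (by norm_num)]; norm_num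
    have h7 : D / √h₀ ≤ 2 * (D / √H) := by
      have hs0 : 0 < √h₀ := Real.sqrt_pos.2 hp
      rw [← mul_div_assoc, div_le_div_iff₀ hs0 hsH]
      nlinarith
    have h8 : c ^ (1 / q) * rate ε β L ≤ max 1 c * rate ε β L := by gcongr
    linarith

end Oracle

/-! ### The noise of the kernel estimators -/

section Observation

variable {d : ℕ} {Ω : Type*} {W : L2 d → Ω → ℝ}

theorem inner_toL2 {F : E d → ℝ} (hF : MemLp F 2 (domMeasure d)) (φ : L2 d) :
    (inner ℝ φ (toL2 F) : ℝ) = ∫ t, φ t * F t ∂(domMeasure d) := by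
  rw [L2.inner_def]
  refine integral_congr_ae ?_
  filter_upwards [toL2_ae_eq hF] with t ht
  rw [ht]
  simp [mul_comm]

theorem obs_eq_inner {F : E d → ℝ} (hF : MemLp F 2 (domMeasure d)) (ε : ℝ) (φ : L2 d) (ω : Ω) :
    obs ε W F φ ω = inner ℝ φ (toL2 F) + ε * W φ ω := by
  rw [obs, inner_toL2 hF]

variable [MeasurableSpace Ω] {P : Measure Ω}

theorem IsWhiteNoise.measurable_obs (hW : IsWhiteNoise P W) (ε : ℝ) (F : E d → ℝ) :
    Measurable fun ω (φ : L2 d) => obs ε W F φ ω :=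
  measurable_pi_lambda _ fun φ => ((hW.measurable φ).const_mul ε).const_add _

theorem abs_inner_sub_le {φ ψ G : L2 d} : |(inner ℝ φ G : ℝ) - inner ℝ ψ G| ≤ ‖G‖ * ‖φ - ψ‖ := by
  rw [← inner_sub_left, mul_comm]
  exact abs_real_inner_le_norm _ _

/-- Two continuous versions of a process agree. -/
theorem ae_forall_eq_of_continuous {T : Type*} [TopologicalSpace T]
    [TopologicalSpace.SeparableSpace T] {X Y : T → Ω → ℝ} (hX : ∀ᵐ ω ∂P, Continuous fun t => X t ω)
    (hY : ∀ᵐ ω ∂P, Continuous fun t => Y t ω) (h : ∀ t, X t =ᵐ[P] Y t) :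
    ∀ᵐ ω ∂P, ∀ t, X t ω = Y t ω := by
  obtain ⟨D, hDc, hD⟩ := TopologicalSpace.exists_countable_dense T
  have hDae : ∀ᵐ ω ∂P, ∀ t ∈ D, X t ω = Y t ω := (ae_ball_iff hDc).2 fun t _ => h t
  filter_upwards [hX, hY, hDae] with ω h1 h2 h3 t
  exact congrFun (h1.ext_on hD h2 h3) t

end Observation

section Noise

variable {K : ℝ → ℝ}

/-- The weights of the estimators `F̂_{(θ,h)}(x)`. -/
def wEst (K : ℝ → ℝ) (x : E 2) (h : ℝ) (θ : Sph 2) : L2 2 := toL2 (weight K (mat θ h) x)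

/-- The weights of the estimators with the matrices `Ē_{(θ,h)(ν,h)}`. -/
def wPair (K : ℝ → ℝ) (x : E 2) (h : ℝ) (p : Sph 2 × Sph 2) : L2 2 :=
  toL2 (weight K (matBar p.1 p.2 h) x)

theorem IsKernel.exists_weight_bounds (hK : IsKernel K) :
    ∃ σ Λ : ℝ, 0 < σ ∧ 0 < Λ ∧ ∀ x ∈ innerCube 2, ∀ h ∈ Ioc (0 : ℝ) 1,
      (∀ θ, ‖wEst K x h θ‖ ≤ σ * √(h⁻¹)) ∧
      (∀ θ θ', ‖wEst K x h θ - wEst K x h θ'‖ ≤ Λ * (h⁻¹) ^ 2 * dist θ θ') ∧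
      (∀ p, ‖wPair K x h p‖ ≤ σ * √(h⁻¹)) ∧
      (∀ p p', ‖wPair K x h p - wPair K x h p'‖ ≤ Λ * (h⁻¹) ^ 2 * dist p p') := by
  obtain ⟨σ, hσ, H1⟩ := hK.exists_norm_weight_le
  obtain ⟨Λ, hΛ, H2⟩ := hK.exists_norm_weight_sub_le
  refine ⟨σ, 3 * Λ, hσ, by positivity, fun x hx h hh => ⟨fun θ => ?_, fun θ θ' => ?_, fun p => ?_,
    fun p p' => ?_⟩⟩
  · rw [wEst, mat_eq_dirMat]
    exact H1 x _ _ h (abs_coord_le θ 0) (abs_coord_le θ 1) hh.1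
  · rw [wEst, wEst, mat_eq_dirMat, mat_eq_dirMat]
    refine (H2 x hx _ _ _ _ h (dist θ θ') (abs_coord_le θ 0) (abs_coord_le θ 1)
      (abs_coord_le θ' 0) (abs_coord_le θ' 1) hh.1 hh.2 (abs_coord_sub_le θ θ' 0)
      (abs_coord_sub_le θ θ' 1)).trans ?_
    have : 0 ≤ Λ * (h⁻¹) ^ 2 * dist θ θ' := by positivity
    linarith
  · rw [wPair, matBar_eq_dirMat]
    exact H1 x _ _ h (abs_pairCoord_le _ _ 0) (abs_pairCoord_le _ _ 1) hh.1
  · rw [wPair, wPair, matBar_eq_dirMat, matBar_eq_dirMat]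
    refine (H2 x hx _ _ _ _ h (3 * dist p p') (abs_pairCoord_le _ _ 0) (abs_pairCoord_le _ _ 1)
      (abs_pairCoord_le _ _ 0) (abs_pairCoord_le _ _ 1) hh.1 hh.2
      (abs_pairCoord_sub_le p.1 p.2 p'.1 p'.2 0)
      (abs_pairCoord_sub_le p.1 p.2 p'.1 p'.2 1)).trans_eq ?_
    ring

theorem card_grid_le {ε : ℝ} (hε : 0 < ε) (hε1 : ε < 1) :
    ((finite_grid hε).toFinset.card : ℝ) ≤ (ε⁻¹) ^ 2 := by
  have h1 : 1 ≤ (ε⁻¹) ^ 2 := one_le_pow₀ ((one_le_inv₀ hε).2 hε1.le)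
  obtain ⟨N, hN1, hN2⟩ := exists_nat_pow_near h1 (show (1 : ℝ) < 2 by norm_num)
  have hsub : (finite_grid hε).toFinset ⊆
      (Finset.range (N + 1)).image fun k : ℕ => (2 : ℝ)⁻¹ ^ k := by
    intro h hh
    rw [Set.Finite.mem_toFinset] at hh
    obtain ⟨⟨k, rfl⟩, h3, h4⟩ := hh
    refine Finset.mem_image.2 ⟨k, ?_, rfl⟩
    rw [Finset.mem_range]
    by_contra! hk
    have h5 : (2 : ℝ) ^ (N + 1) ≤ 2 ^ k := pow_le_pow_right₀ (by norm_num) hk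
    have h6 : (2 : ℝ) ^ k ≤ (ε⁻¹) ^ 2 := by
      rw [inv_pow] at h3 ⊢
      exact (le_inv_comm₀ (by positivity) (by positivity)).1 h3
    linarith
  calc ((finite_grid hε).toFinset.card : ℝ) ≤ ((N + 1 : ℕ) : ℝ) := by
        exact_mod_cast (Finset.card_le_card hsub).trans
          (Finset.card_image_le.trans (Finset.card_range _).le)
    _ ≤ ((2 ^ N : ℕ) : ℝ) := by exact_mod_cast Nat.lt_two_pow_self
    _ ≤ _ := by push_cast; exact hN1

/-- All noise terms, measured in units of the threshold, are bounded by one random variable whose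
moment of an order proportional to `log (1 / ε)` is bounded independently of `ε`. -/
theorem IsKernel.exists_noise_bound (hK : IsKernel K) {r : ℝ} (hr : 1 ≤ r) :
    ∃ M : ℝ, 0 < M ∧ ∀ ε : ℝ, 0 < ε → 1 ≤ Real.log (1 / ε) → ∀ x ∈ innerCube 2,
      ∀ (Ω : Type*) [MeasurableSpace Ω] (P : Measure Ω) (W : L2 2 → Ω → ℝ), IsWhiteNoise P W →
      ∃ Z : Ω → ℝ≥0∞, Measurable Z ∧
        ∫⁻ ω, Z ω ^ (16 * r * Real.log (1 / ε)) ∂P ≤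
          ENNReal.ofReal M ^ (16 * r * Real.log (1 / ε)) ∧
        ∀ᵐ ω ∂P, ∀ h ∈ grid ε,
          (∀ θ, ENNReal.ofReal (ε * |circleNet.ext (fun θ => W (wEst K x h θ) ω) θ|) ≤
            Z ω * ENNReal.ofReal (threshold 1 ε h)) ∧
          (∀ p, ENNReal.ofReal (ε * |torusNet.ext (fun p => W (wPair K x h p) ω) p|) ≤
            Z ω * ENNReal.ofReal (threshold 1 ε h)) := by
  obtain ⟨σ, Λ, hσ, hΛ, Hw⟩ := hK.exists_weight_bounds
  set A : ℝ := 2 * (1 + 4 * Λ / σ) with hA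
  have hA1 : 1 ≤ A := by
    have : 0 ≤ 4 * Λ / σ := by positivity
    linarith
  set B : ℝ := 2 ^ 17 * A ^ 4 with hB
  have hB1 : 1 ≤ B := by
    have : 1 ≤ A ^ 4 := one_le_pow₀ hA1
    linarith
  set M₀ : ℝ := 64 * σ * √r with hM₀
  have hr0 : 0 < r := by linarith
  have hM₀p : 0 < M₀ := by positivity
  refine ⟨B * Real.exp 2 * M₀, by positivity, ?_⟩
  intro ε hε hl x hx Ω _ P W hW
  set l := Real.log (1 / ε) with hldef
  have hl0 : 0 < l := by linarith
  have hε1 : ε < 1 := by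
    by_contra! h
    have : l ≤ 0 := Real.log_nonpos (by positivity) (by rw [div_le_one hε]; exact h)
    linarith
  set p := 16 * r * l with hp
  have hp16 : 16 ≤ p := by nlinarith
  have hp0 : 0 < p := by linarith
  have hεi : 1 ≤ ε⁻¹ := (one_le_inv₀ hε).2 hε1.le
  have hεexp : Real.exp l = ε⁻¹ := by
    rw [hldef, Real.exp_log (by positivity), one_div]
  -- the level from which on the increments are negligible
  obtain ⟨n, hn1, hn2⟩ := exists_nat_pow_near
    (show 1 ≤ (1 + 4 * Λ / σ) * (ε⁻¹) ^ 4 from one_le_mul_of_one_le_of_one_le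
      (by have : 0 ≤ 4 * Λ / σ := by positivity
          linarith) (one_le_pow₀ hεi)) (show (1 : ℝ) < 2 by norm_num)
  set n₀ := n + 1 with hn₀
  have hlev : ∀ h ∈ grid ε, Λ * (h⁻¹) ^ 2 * (4 * (1 / 2) ^ n₀) ≤ σ * √(h⁻¹) := by
    intro h hh
    have hh0 := grid_pos hh
    have hhi : 1 ≤ h⁻¹ := (one_le_inv₀ hh0).2 (grid_le_one hh)
    have h1 : h⁻¹ ≤ (ε⁻¹) ^ 2 := by
      rw [inv_pow]; exact inv_anti₀ (by positivity) hh.2.1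
    have h2 : (h⁻¹) ^ 2 ≤ (ε⁻¹) ^ 4 := by
      calc (h⁻¹) ^ 2 ≤ ((ε⁻¹) ^ 2) ^ 2 := by gcongr
        _ = _ := by rw [← pow_mul]
    have h3 : 4 * Λ * (ε⁻¹) ^ 4 ≤ σ * 2 ^ n₀ := by
      have h4 : σ * ((1 + 4 * Λ / σ) * (ε⁻¹) ^ 4) = (σ + 4 * Λ) * (ε⁻¹) ^ 4 := by
        field_simp
      have h5 : σ * ((1 + 4 * Λ / σ) * (ε⁻¹) ^ 4) ≤ σ * 2 ^ n₀ := by gcongr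
      rw [h4] at h5
      have : 0 ≤ σ * (ε⁻¹) ^ 4 := by positivity
      linarith
    calc Λ * (h⁻¹) ^ 2 * (4 * (1 / 2) ^ n₀) ≤ Λ * (ε⁻¹) ^ 4 * (4 * (1 / 2) ^ n₀) := by gcongr
      _ = 4 * Λ * (ε⁻¹) ^ 4 * (1 / 2) ^ n₀ := by ring
      _ ≤ σ * 2 ^ n₀ * (1 / 2) ^ n₀ := by gcongr
      _ = σ * 1 := by rw [mul_assoc, ← mul_pow]; norm_num
      _ ≤ _ := by
        gcongr
        rw [Real.le_sqrt' one_pos]; simpa using hhi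
  have h16 : (16 : ℝ) ^ n₀ ≤ A ^ 4 * (ε⁻¹) ^ 16 := by
    have h2 : (2 : ℝ) ^ n₀ ≤ A * (ε⁻¹) ^ 4 := by
      rw [hn₀, pow_succ, hA]; linarith
    calc (16 : ℝ) ^ n₀ = (2 ^ n₀) ^ 4 := by rw [← pow_mul, mul_comm, pow_mul]; norm_num
      _ ≤ (A * (ε⁻¹) ^ 4) ^ 4 := by gcongr
      _ = _ := by ring
  set G := (finite_grid hε).toFinset with hG
  have hGmem : ∀ h, h ∈ G ↔ h ∈ grid ε := fun h => Set.Finite.mem_toFinset _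
  set U₁ : ℝ → Ω → ℝ≥0∞ := fun h ω => circleNet.majorant p n₀ fun θ => W (wEst K x h θ) ω
  set U₂ : ℝ → Ω → ℝ≥0∞ := fun h ω => torusNet.majorant p n₀ fun q => W (wPair K x h q) ω
  have hU₁m : ∀ h, Measurable (U₁ h) := fun h =>
    circleNet.measurable_majorant (fun θ => hW.measurable _) p n₀
  have hU₂m : ∀ h, Measurable (U₂ h) := fun h =>
    torusNet.measurable_majorant (fun q => hW.measurable _) p n₀
  set a : ℝ → ℝ≥0∞ := fun h => ENNReal.ofReal (4 * ε / threshold 1 ε h) with ha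
  have hthr : ∀ h ∈ grid ε, 0 < threshold 1 ε h := fun h hh => by
    have := grid_pos hh
    unfold threshold; positivity
  set S : Ω → ℝ≥0∞ := fun ω => ∑ h ∈ G, ((a h * U₁ h ω) ^ p + (a h * U₂ h ω) ^ p) with hS
  have hmt : ∀ h, Measurable fun ω => (a h * U₁ h ω) ^ p + (a h * U₂ h ω) ^ p := fun h =>
    (((hU₁m h).const_mul _).pow_const _).add (((hU₂m h).const_mul _).pow_const _)
  have hSm : Measurable S := Finset.measurable_sum _ fun h _ => hmt h
  refine ⟨fun ω => S ω ^ (1 / p), hSm.pow_const _, ?_, ?_⟩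
  · have e0 : ∀ ω, (S ω ^ (1 / p)) ^ p = S ω := fun ω => by
      rw [← ENNReal.rpow_mul, one_div_mul_cancel hp0.ne', ENNReal.rpow_one]
    simp_rw [e0]
    have hterm : ∀ h ∈ G, ∀ U : Ω → ℝ≥0∞, Measurable U →
        ∫⁻ ω, U ω ^ p ∂P ≤ 2 ^ 16 * 16 ^ n₀ * ENNReal.ofReal (4 * (σ * √(h⁻¹)) * √p) ^ p →
        ∫⁻ ω, (a h * U ω) ^ p ∂P ≤ 2 ^ 16 * 16 ^ n₀ * ENNReal.ofReal M₀ ^ p := by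
      intro h hh U hUm hU
      have hh' := (hGmem h).1 hh
      simp_rw [ENNReal.mul_rpow_of_nonneg _ _ hp0.le]
      rw [lintegral_const_mul _ (hUm.pow_const p)]
      calc _ ≤ a h ^ p * (2 ^ 16 * 16 ^ n₀ * ENNReal.ofReal (4 * (σ * √(h⁻¹)) * √p) ^ p) := by
            gcongr
        _ = 2 ^ 16 * 16 ^ n₀ * (a h ^ p * ENNReal.ofReal (4 * (σ * √(h⁻¹)) * √p) ^ p) := by ring
        _ = _ := by
            rw [← ENNReal.mul_rpow_of_nonneg _ _ hp0.le, ha,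
              ← ENNReal.ofReal_mul (by have := hthr h hh'; positivity)]
            congr 3
            have hhp := grid_pos hh'
            have hs1 : √(h⁻¹) ≠ 0 := (Real.sqrt_pos.2 (by positivity)).ne'
            have hs2 : √l ≠ 0 := (Real.sqrt_pos.2 hl0).ne'
            have e1 : √p = 4 * √r * √l := by
              rw [hp, Real.sqrt_mul (by positivity), Real.sqrt_mul (by norm_num)]
              congr 2
              rw [show (16 : ℝ) = 4 ^ 2 by norm_num]
              exact Real.sqrt_sq (by norm_num)
            rw [threshold, ← hldef, Real.sqrt_mul (by positivity), e1, hM₀]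
            field_simp
            ring
    rw [hS]
    simp only
    rw [lintegral_finsetSum _ fun h _ => hmt h]
    calc _ ≤ ∑ h ∈ G, 2 ^ 17 * 16 ^ n₀ * ENNReal.ofReal M₀ ^ p := by
          refine Finset.sum_le_sum fun h hh => ?_
          rw [lintegral_add_left (((hU₁m h).const_mul _).pow_const _)]
          have hh' := (hGmem h).1 hh
          obtain ⟨b1, b2, b3, b4⟩ := Hw x hx h (grid_mem_Ioc hh')
          have t1 := hterm h hh (U₁ h) (hU₁m h)
            (hW.lintegral_majorant_le circleNet (by positivity) b1 b2 hp16 (hlev h hh'))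
          have t2 := hterm h hh (U₂ h) (hU₂m h)
            (hW.lintegral_majorant_le torusNet (by positivity) b3 b4 hp16 (hlev h hh'))
          refine (add_le_add t1 t2).trans_eq ?_
          ring
      _ = ENNReal.ofReal (G.card * (2 ^ 17 * 16 ^ n₀) * M₀ ^ p) := by
          have e : (2 ^ 17 * 16 ^ n₀ : ℝ≥0∞) = ENNReal.ofReal (2 ^ 17 * 16 ^ n₀) := by
            rw [ENNReal.ofReal_mul (by positivity), ENNReal.ofReal_pow (by norm_num),
              ENNReal.ofReal_pow (by norm_num)]
            simp only [ENNReal.ofReal_ofNat]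
          rw [Finset.sum_const, nsmul_eq_mul, e, ENNReal.ofReal_rpow_of_pos hM₀p,
            ← ENNReal.ofReal_mul (by positivity), ← ENNReal.ofReal_natCast,
            ← ENNReal.ofReal_mul (by positivity)]
          congr 1; ring
      _ ≤ ENNReal.ofReal ((B * Real.exp 2 * M₀) ^ p) := by
          apply ENNReal.ofReal_le_ofReal
          rw [Real.mul_rpow (x := B * Real.exp 2) (by positivity) hM₀p.le,
            Real.mul_rpow (x := B) (by positivity) (by positivity)]
          refine mul_le_mul_of_nonneg_right ?_ (by positivity)
          have c1 := card_grid_le hε hε1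
          calc (G.card : ℝ) * (2 ^ 17 * 16 ^ n₀) ≤ (ε⁻¹) ^ 2 * (2 ^ 17 * (A ^ 4 * (ε⁻¹) ^ 16)) := by
                gcongr
            _ = B * (ε⁻¹) ^ 18 := by rw [hB]; ring
            _ ≤ B ^ p * Real.exp 2 ^ p := by
                gcongr
                · simpa using Real.rpow_le_rpow_of_exponent_le hB1 (show 1 ≤ p by linarith)
                · rw [← hεexp, ← Real.exp_nat_mul, ← Real.exp_mul]
                  apply Real.exp_le_exp.2
                  push_cast
                  nlinarith
      _ = _ := by rw [ENNReal.ofReal_rpow_of_pos (by positivity)]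
  · have hreg : ∀ᵐ ω ∂P, ∀ h ∈ G, circleNet.Regular (fun θ => W (wEst K x h θ) ω) ∧
        torusNet.Regular (fun q => W (wPair K x h q) ω) := by
      rw [Finset.eventually_all]
      intro h hh
      obtain ⟨b1, b2, b3, b4⟩ := Hw x hx h (grid_mem_Ioc ((hGmem h).1 hh))
      exact (hW.ae_regular circleNet (by positivity) b1 b2).and
        (hW.ae_regular torusNet (by positivity) b3 b4)
    filter_upwards [hreg] with ω hω h hh
    obtain ⟨r1, r2⟩ := hω h ((hGmem h).2 hh)
    have ht := hthr h hh
    have fin : ∀ (y : ℝ) (U : ℝ≥0∞), ENNReal.ofReal |y| ≤ 4 * U → a h * U ≤ S ω ^ (1 / p) →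
        ENNReal.ofReal (ε * |y|) ≤ S ω ^ (1 / p) * ENNReal.ofReal (threshold 1 ε h) := by
      intro y U h1 h2
      calc ENNReal.ofReal (ε * |y|) ≤ ENNReal.ofReal ε * (4 * U) := by
            rw [ENNReal.ofReal_mul hε.le]; gcongr
        _ = a h * U * ENNReal.ofReal (threshold 1 ε h) := by
            rw [mul_right_comm, ha, ← ENNReal.ofReal_mul (by positivity),
              div_mul_cancel₀ _ ht.ne', ENNReal.ofReal_mul (by norm_num)]
            simp only [ENNReal.ofReal_ofNat]
            ring
        _ ≤ _ := by gcongr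
    have hsum : (a h * U₁ h ω) ^ p + (a h * U₂ h ω) ^ p ≤ S ω :=
      Finset.single_le_sum (f := fun h => (a h * U₁ h ω) ^ p + (a h * U₂ h ω) ^ p)
        (fun _ _ => zero_le) ((hGmem h).2 hh)
    refine ⟨fun θ => fin _ _ (circleNet.abs_ext_le hp0 n₀ r1 θ) ?_,
      fun q => fin _ _ (torusNet.abs_ext_le hp0 n₀ r2 q) ?_⟩
    · rw [one_div, ENNReal.le_rpow_inv_iff hp0]
      exact le_self_add.trans hsum
    · rw [one_div, ENNReal.le_rpow_inv_iff hp0]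
      exact le_add_self.trans hsum

end Noise

/-! ### The risk of the selected estimator -/

/-- A loss bounded by `a` except on the event `Z > t`, where it is at most `b Z`, has risk
little more than `a` if a high moment of `Z` is bounded below the level `t`. -/
theorem risk_le_of_dichotomy {Ω : Type*} [MeasurableSpace Ω] {P : Measure Ω}
    [IsProbabilityMeasure P] {D : Ω → ℝ} (hD : Measurable D) {Z : Ω → ℝ≥0∞} (hZ : Measurable Z)
    {r q p t a b M : ℝ} (hr : 0 < r) (hrq : r ≤ q) (hq : 1 ≤ q) (hqp : q ≤ p) (ht : 0 < t)
    (hle : ∀ᵐ ω ∂P, ENNReal.ofReal |D ω| ≤ ENNReal.ofReal a +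
      {ω | ENNReal.ofReal t < Z ω}.indicator (fun ω => ENNReal.ofReal b * Z ω) ω)
    (hM : ∫⁻ ω, Z ω ^ p ∂P ≤ ENNReal.ofReal M ^ p) :
    (∫⁻ ω, ENNReal.ofReal |D ω| ^ r ∂P) ^ (1 / r) ≤ ENNReal.ofReal a +
      ENNReal.ofReal b * ENNReal.ofReal t * ENNReal.ofReal (M / t) ^ (p / q) := by
  have hq0 : 0 < q := by linarith
  have hp0 : 0 < p := by linarith
  have ht0 : ENNReal.ofReal t ≠ 0 := by simpa using ht
  have h1 : (∫⁻ ω, ENNReal.ofReal |D ω| ^ r ∂P) ^ (1 / r) ≤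
      (∫⁻ ω, ENNReal.ofReal |D ω| ^ q ∂P) ^ (1 / q) := by
    have := eLpNorm'_le_eLpNorm'_of_exponent_le hr hrq P hD.aestronglyMeasurable
    simpa [eLpNorm', Real.enorm_eq_ofReal_abs] using this
  set I : Ω → ℝ≥0∞ := {ω | ENNReal.ofReal t < Z ω}.indicator fun ω => ENNReal.ofReal b * Z ω
    with hI
  have hIm : Measurable I :=
    (hZ.const_mul _).indicator (measurableSet_lt measurable_const hZ)
  have h2 : (∫⁻ ω, ENNReal.ofReal |D ω| ^ q ∂P) ^ (1 / q) ≤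
      (∫⁻ ω, (ENNReal.ofReal a + I ω) ^ q ∂P) ^ (1 / q) := by
    refine ENNReal.rpow_le_rpow (lintegral_mono_ae ?_) (by positivity)
    filter_upwards [hle] with ω hω
    gcongr
  have h3 : (∫⁻ ω, (ENNReal.ofReal a + I ω) ^ q ∂P) ^ (1 / q) ≤
      (∫⁻ _, ENNReal.ofReal a ^ q ∂P) ^ (1 / q) + (∫⁻ ω, I ω ^ q ∂P) ^ (1 / q) :=
    ENNReal.lintegral_Lp_add_le aemeasurable_const hIm.aemeasurable hq
  have h4 : (∫⁻ _, ENNReal.ofReal a ^ q ∂P) ^ (1 / q) = ENNReal.ofReal a := by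
    rw [lintegral_const, measure_univ, mul_one, ← ENNReal.rpow_mul, mul_one_div_cancel hq0.ne',
      ENNReal.rpow_one]
  have h5 : ∫⁻ ω, I ω ^ q ∂P ≤ (ENNReal.ofReal b * ENNReal.ofReal t) ^ q *
      ENNReal.ofReal (M / t) ^ p := by
    have hpt : ∀ ω, I ω ^ q ≤ (ENNReal.ofReal b * ENNReal.ofReal t) ^ q *
        ((ENNReal.ofReal t)⁻¹ ^ p * Z ω ^ p) := by
      intro ω
      by_cases hω : ENNReal.ofReal t < Z ω
      · have e : I ω = ENNReal.ofReal b * ENNReal.ofReal t * ((ENNReal.ofReal t)⁻¹ * Z ω) := by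
          rw [hI, Set.indicator_of_mem (show ω ∈ {ω | ENNReal.ofReal t < Z ω} from hω), mul_assoc,
            ENNReal.mul_inv_cancel_left ht0 ENNReal.ofReal_ne_top]
        rw [e, ENNReal.mul_rpow_of_nonneg _ _ hq0.le, ← ENNReal.mul_rpow_of_nonneg _ _ hp0.le]
        gcongr
        rw [mul_comm, ← div_eq_mul_inv, ENNReal.le_div_iff_mul_le (Or.inl ht0)
          (Or.inl ENNReal.ofReal_ne_top), one_mul]
        exact hω.le
      · rw [hI, Set.indicator_of_notMem (show ω ∉ {ω | ENNReal.ofReal t < Z ω} from hω),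
          ENNReal.zero_rpow_of_pos hq0]
        exact zero_le
    refine (lintegral_mono hpt).trans ?_
    rw [lintegral_const_mul _ ((hZ.pow_const p).const_mul _),
      lintegral_const_mul _ (hZ.pow_const p)]
    gcongr
    calc (ENNReal.ofReal t)⁻¹ ^ p * ∫⁻ ω, Z ω ^ p ∂P ≤
          (ENNReal.ofReal t)⁻¹ ^ p * ENNReal.ofReal M ^ p := by gcongr
      _ = ENNReal.ofReal (M / t) ^ p := by
          rw [← ENNReal.mul_rpow_of_nonneg _ _ hp0.le, ENNReal.ofReal_div_of_pos ht,
            div_eq_mul_inv, mul_comm]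
  have h6 : (∫⁻ ω, I ω ^ q ∂P) ^ (1 / q) ≤
      ENNReal.ofReal b * ENNReal.ofReal t * ENNReal.ofReal (M / t) ^ (p / q) := by
    refine (ENNReal.rpow_le_rpow h5 (by positivity)).trans_eq ?_
    rw [ENNReal.mul_rpow_of_nonneg _ _ (by positivity), ← ENNReal.rpow_mul,
      mul_one_div_cancel hq0.ne', ENNReal.rpow_one, ← ENNReal.rpow_mul, mul_one_div]
  calc _ ≤ _ := h1
    _ ≤ _ := h2
    _ ≤ _ := h3
    _ ≤ _ := by rw [h4]; gcongr

/-- Any continuous version of the estimators is the sum of the means and of the continuous version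
of the noise. -/
theorem IsWhiteNoise.ae_version_eq {d : ℕ} {Ω : Type*} [MeasurableSpace Ω] {P : Measure Ω}
    {W : L2 d → Ω → ℝ} (hW : IsWhiteNoise P W) {F : E d → ℝ} (hF : MemLp F 2 (domMeasure d))
    {T : Type*} [MetricSpace T] [TopologicalSpace.SeparableSpace T] (N : NetSeq T) {Φ : T → L2 d}
    {σ Λ ε : ℝ} (hΛ : 0 ≤ Λ) (hval : ∀ t, ‖Φ t‖ ≤ σ) (hinc : ∀ s t, ‖Φ s - Φ t‖ ≤ Λ * dist s t)
    {X : T → Ω → ℝ} (hX : ∀ t, X t =ᵐ[P] obs ε W F (Φ t))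
    (hc : ∀ᵐ ω ∂P, Continuous fun t => X t ω) :
    ∀ᵐ ω ∂P, ∀ t, X t ω = ∫ u, Φ t u * F u ∂(domMeasure d) +
      ε * N.ext (fun s => W (Φ s) ω) t := by
  have hΦ : Continuous Φ := by
    have : LipschitzWith ⟨Λ, hΛ⟩ Φ := LipschitzWith.of_dist_le_mul fun s t => by
      rw [dist_eq_norm]; exact hinc s t
    exact this.continuous
  refine ae_forall_eq_of_continuous hc (ae_of_all _ fun ω => ?_) fun t => ?_
  · simp_rw [← inner_toL2 hF]
    have := N.continuous_ext fun s => W (Φ s) ω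
    fun_prop
  · have h1 := N.ext_ae_eq (y := fun t => W (Φ t)) (fun t => hW.measurable _)
      (hW.ae_regular N hΛ hval hinc) ENNReal.ofReal_ne_top (hW.lintegral_abs_sub_le hinc) t
    filter_upwards [hX t, h1] with ω h2 h3
    rw [h2, h3]
    rfl

theorem memLp_of_mem_singleIndexClass {d : ℕ} {β L : ℝ} {F : E d → ℝ}
    (hF : F ∈ singleIndexClass d β L) : MemLp F 2 (domMeasure d) := by
  obtain ⟨f, hf, θ, -, hFf⟩ := hF
  have hc := continuous_of_mem_holderClass hf
  have e : F = fun z => f (inner ℝ z θ) := funext hFf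
  rw [e]
  exact memLp_of_continuous_of_bound (by fun_prop) fun z => abs_le_of_mem_holderClass hf _

instance : CompactSpace (Sph 2) := isCompact_iff_compactSpace.1 (isCompact_sphere _ _)

/-- The statistic `sup_ν |F̂_{(θ,h)(ν,h)} - F̂_{(ν,h)}|` is a supremum over a bounded set. -/
theorem bddAbove_range_pairEst {X : ℝ → Sph 2 → ℝ} {V : ℝ → Sph 2 × Sph 2 → ℝ} {h : ℝ}
    (hX : Continuous (X h)) (hV : Continuous (V h)) (θ : Sph 2) :
    BddAbove (range fun ν : Sph 2 => |pairEst V h θ ν - X h ν|) := by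
  obtain ⟨A, hA⟩ := (isCompact_range hX.abs).bddAbove
  obtain ⟨B, hB⟩ := (isCompact_range hV.abs).bddAbove
  refine ⟨B + A, ?_⟩
  rintro _ ⟨ν, rfl⟩
  refine (abs_sub _ _).trans (add_le_add ?_ (hA ⟨ν, rfl⟩))
  rw [pairEst]
  split_ifs
  · exact hB ⟨_, rfl⟩
  · exact hB ⟨_, rfl⟩

section Risk

variable {K : ℝ → ℝ}

set_option maxHeartbeats 1000000 in
/-- The upper bound for the risk: the constants depend only on the kernel and on the order `r`.
On the event that the noise is below the level `t`, the pathwise oracle inequality applies; off it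
the loss is bounded by the noise itself, and the moments of order `log (1 / ε)` make the contribution
of this event smaller than `ε`. -/
theorem IsKernel.exists_risk_bound (hK : IsKernel K) {r : ℝ} (hr : 0 < r) :
    ∃ (C C₁ : ℝ) (C₂ : ℝ → ℝ), 0 ≤ C ∧
      ∀ b : ℝ, VanishingMoments K b → ∀ ε : ℝ, 0 < ε → ε < 1 → ∀ x ∈ innerCube 2,
      ∀ (Ω : Type*) [MeasurableSpace Ω] (P : Measure Ω) [IsProbabilityMeasure P]
        (W : L2 2 → Ω → ℝ), IsWhiteNoise P W →
      ∀ T : (L2 2 → ℝ) → ℝ, Measurable T → ∀ β L : ℝ, 0 < β → β ≤ b → 0 < L →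
      ε ≤ Real.exp (-max 1 ((2 * L * l1Norm K * (supNorm K)⁻¹) ^ 2)) →
      ∀ F ∈ singleIndexClass 2 β L,
        IsSelectedEstimator P K C ε x (obs ε W F) (fun ω => T (fun φ => obs ε W F φ ω)) →
        pointwiseRisk P W ε r x T F ≤ ENNReal.ofReal (supNorm K ^ 2 *
          (C₁ * rate ε β L + C₂ L * (ε * √(Real.log (1 / ε))))) := by
  set q := max r 1 with hq
  have hq1 : 1 ≤ q := le_max_right _ _
  obtain ⟨M, hM, HM⟩ := hK.exists_noise_bound hq1
  obtain ⟨σ, Λ, hσ, hΛ, Hw⟩ := hK.exists_weight_bounds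
  set κ := supNorm K with hκ
  have hκ0 : 0 < κ := hK.supNorm_pos
  set m := l1Norm K with hm
  have hm1 : 1 ≤ m := hK.one_le_l1Norm
  set t := Real.exp 1 * M with ht
  have ht0 : 0 < t := by positivity
  -- half of the threshold has to dominate the noise at the level `t`, and the bias
  set C := 2 * (t + m * κ) with hC
  have hC0 : 0 < C := by positivity
  set c := m / κ with hc
  have hc0 : 0 < c := by positivity
  refine ⟨C, 8 * C * max 1 c / κ ^ 2, fun L => (4 * C + t + 3 * m ^ 2 * L) / κ ^ 2, hC0.le, ?_⟩
  intro b hmom ε hε hε1 x hx Ω _ P _ W hW T hT β L hβ hβb hL hcond F hF hsel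
  set l := Real.log (1 / ε) with hl
  have hlmax : max 1 ((2 * L * m * κ⁻¹) ^ 2) ≤ l := by
    have := Real.log_le_log hε hcond
    rw [Real.log_exp] at this
    rw [hl, one_div, Real.log_inv]; linarith
  have hl1 : 1 ≤ l := (le_max_left _ _).trans hlmax
  have hl0 : 0 < l := by linarith
  have hsl1 : 1 ≤ √l := by rw [Real.le_sqrt' one_pos]; simpa using hl1
  have hcl : 2 * L * c ≤ √l := by
    rw [Real.le_sqrt' (by positivity)]
    refine le_trans (le_of_eq ?_) ((le_max_right _ _).trans hlmax)
    rw [hc, div_eq_mul_inv]; ring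
  obtain ⟨Z, hZm, hZp, hZ⟩ := HM ε hε hl1 x hx Ω P W hW
  obtain ⟨h₀, hh₀, hbias, hrate⟩ := exists_oracle_bandwidth hε hε1 hβ hL hc0 hcl
  have hFm := memLp_of_mem_singleIndexClass hF
  obtain ⟨f, hf, θ₁, hθ₁, hFf⟩ := id hF
  set θ₀ : Sph 2 := ⟨θ₁, hθ₁⟩ with hθ₀
  replace hFf : ∀ z, F z = f (inner ℝ z θ₀.1) := hFf
  obtain ⟨X, V, θhat, hX, hXc, hV, hVc, -, hidx, hTX⟩ := hsel
  have hXv : ∀ᵐ ω ∂P, ∀ h ∈ grid ε, ∀ θ, X h θ ω = meanEst K x F h θ +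
      ε * circleNet.ext (fun θ => W (wEst K x h θ) ω) θ := by
    refine (ae_ball_iff (finite_grid hε).countable).2 fun h hh => ?_
    obtain ⟨b1, b2, b3, b4⟩ := Hw x hx h (grid_mem_Ioc hh)
    exact hW.ae_version_eq hFm circleNet (by positivity) b1 b2 (hX h hh) (hXc h hh)
  have hVv : ∀ᵐ ω ∂P, ∀ h ∈ grid ε, ∀ p, V h p ω = meanPair K x F h p +
      ε * torusNet.ext (fun p => W (wPair K x h p) ω) p := by
    refine (ae_ball_iff (finite_grid hε).countable).2 fun h hh => ?_
    obtain ⟨b1, b2, b3, b4⟩ := Hw x hx h (grid_mem_Ioc hh)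
    exact hW.ae_version_eq hFm torusNet (by positivity) b3 b4 (hV h hh) (hVc h hh)
  have hXc' : ∀ᵐ ω ∂P, ∀ h ∈ grid ε, Continuous fun θ => X h θ ω :=
    (ae_ball_iff (finite_grid hε).countable).2 hXc
  have hVc' : ∀ᵐ ω ∂P, ∀ h ∈ grid ε, Continuous fun p => V h p ω :=
    (ae_ball_iff (finite_grid hε).countable).2 hVc
  have hthr : ∀ h, threshold C ε h = C * threshold 1 ε h := fun h => by
    rw [threshold, threshold, one_mul, mul_assoc]
  have hthr0 : ∀ h, 0 ≤ threshold 1 ε h := fun h => threshold_nonneg zero_le_one hε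
  have hS₀ : indexSmooth K f x θ₀ θ₀ = F x := by rw [hK.indexSmooth_self, hFf]
  set β₁ := √l + 3 * m ^ 2 * L / t with hβ₁
  have hβ₁0 : 0 ≤ β₁ := by positivity
  have hmain : ∀ᵐ ω ∂P, ENNReal.ofReal |T (fun φ => obs ε W F φ ω) - F x| ≤
      ENNReal.ofReal (4 * threshold C ε h₀) +
      {ω | ENNReal.ofReal t < Z ω}.indicator (fun ω => ENNReal.ofReal β₁ * Z ω) ω := by
    filter_upwards [hZ, hXv, hVv, hXc', hVc', hidx, hTX] with ω h1 h2 h3 h4 h5 h6 h7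
    have h8 : T (fun φ => obs ε W F φ ω) =
      X (selBandwidth (fun h θ => X h θ ω) C ε (θhat ω)) (θhat ω) ω := h7
    rw [h8]
    set θ := θhat ω
    by_cases hω : ENNReal.ofReal t < Z ω
    · rw [Set.indicator_of_mem (show ω ∈ {ω | ENNReal.ofReal t < Z ω} from hω)]
      refine le_add_left ?_
      by_cases hZtop : Z ω = ∞
      · rw [hZtop, ENNReal.mul_top]
        · exact le_top
        · have : 0 < β₁ := by positivity
          simpa using this
      set z := (Z ω).toReal with hz
      have hzeq : Z ω = ENNReal.ofReal z := (ENNReal.ofReal_toReal hZtop).symm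
      have hz0 : 0 ≤ z := ENNReal.toReal_nonneg
      have htz : t < z := by
        rw [hzeq] at hω
        exact (ENNReal.ofReal_lt_ofReal_iff_of_nonneg ht0.le).1 hω
      have hsb := (selBandwidth_mem hε hε1 hC0.le (fun h θ => X h θ ω) θ).1
      set h := selBandwidth (fun h θ => X h θ ω) C ε θ with hh
      have hhI := grid_mem_Ioc hsb
      have n1 : ε * |circleNet.ext (fun θ => W (wEst K x h θ) ω) θ| ≤ z * threshold 1 ε h := by
        have := (h1 h hsb).1 θ
        rw [hzeq, ← ENNReal.ofReal_mul hz0] at this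
        exact (ENNReal.ofReal_le_ofReal_iff (mul_nonneg hz0 (hthr0 h))).1 this
      have n2 : threshold 1 ε h ≤ √l := by
        rw [threshold, ← hl, one_mul, Real.sqrt_mul (inv_nonneg.2 hhI.1.le), ← mul_assoc]
        refine mul_le_of_le_one_left (Real.sqrt_nonneg _) ?_
        have : √(h⁻¹) ≤ ε⁻¹ := by
          rw [Real.sqrt_le_left (by positivity), inv_pow]
          exact inv_anti₀ (by positivity) hsb.2.1
        calc ε * √(h⁻¹) ≤ ε * ε⁻¹ := by gcongr
          _ = 1 := mul_inv_cancel₀ hε.ne'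
      have n3 := abs_meanEst_sub_le hK hmom hβ hβb hL hf hFf hx hhI θ
      have n4 : L * h ^ β ≤ L :=
        mul_le_of_le_one_right hL.le (Real.rpow_le_one hhI.1.le hhI.2 hβ.le)
      have n5 : |indexSmooth K f x θ₀ θ| ≤ m * L := hK.abs_crossSmooth_le hf _ _
      have n6 : |F x| ≤ L := by rw [hFf]; exact abs_le_of_mem_holderClass hf _
      rw [hzeq, ← ENNReal.ofReal_mul hβ₁0]
      apply ENNReal.ofReal_le_ofReal
      rw [h2 h hsb θ]
      set ξ := circleNet.ext (fun θ => W (wEst K x h θ) ω) θ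
      have e : meanEst K x F h θ + ε * ξ - F x = (meanEst K x F h θ - indexSmooth K f x θ₀ θ) +
        (ε * ξ + (indexSmooth K f x θ₀ θ - F x)) := by ring
      have s1 : |meanEst K x F h θ + ε * ξ - F x| ≤ m ^ 2 * L + (z * √l + (m * L + L)) := by
        rw [e]
        refine (abs_add_le _ _).trans (add_le_add (n3.trans (by gcongr)) ?_)
        refine (abs_add_le _ _).trans (add_le_add ?_ ((abs_sub _ _).trans (add_le_add n5 n6)))
        rw [abs_mul, abs_of_pos hε]
        exact n1.trans (by gcongr)
      have s2 : m ^ 2 * L + (m * L + L) ≤ 3 * m ^ 2 * L := by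
        have : m ≤ m ^ 2 := by nlinarith
        have : m * L ≤ m ^ 2 * L := by gcongr
        have : 1 * L ≤ m ^ 2 * L := by gcongr; nlinarith
        linarith
      have s3 : 3 * m ^ 2 * L ≤ 3 * m ^ 2 * L / t * z := by
        rw [div_mul_eq_mul_div, le_div_iff₀ ht0]
        gcongr
      rw [hβ₁, add_mul]
      linarith [mul_comm z √l]
    · refine le_add_right (ENNReal.ofReal_le_ofReal ?_)
      have hzt : ∀ y h, ENNReal.ofReal (ε * |y|) ≤ Z ω * ENNReal.ofReal (threshold 1 ε h) →
          |ε * y| ≤ t * threshold 1 ε h := by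
        intro y h hy
        have : ENNReal.ofReal (ε * |y|) ≤ ENNReal.ofReal (t * threshold 1 ε h) := by
          rw [ENNReal.ofReal_mul ht0.le]
          exact hy.trans (by gcongr; exact not_lt.1 hω)
        rw [abs_mul, abs_of_pos hε]
        exact (ENNReal.ofReal_le_ofReal_iff (mul_nonneg ht0.le (hthr0 h))).1 this
      have hB : ∀ h ∈ grid ε, h ≤ h₀ → m ^ 2 * (L * h ^ β) ≤ m * κ * threshold 1 ε h := by
        intro h hh hle
        have p0 := grid_pos hh
        have a1 : c * L * h ^ β ≤ threshold 1 ε h :=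
          calc c * L * h ^ β ≤ c * L * h₀ ^ β := by gcongr
            _ ≤ threshold 1 ε h₀ := hbias
            _ ≤ _ := threshold_anti zero_le_one hε hε1 p0 hle
        calc m ^ 2 * (L * h ^ β) = m * κ * (c * L * h ^ β) := by rw [hc]; field_simp
          _ ≤ _ := by gcongr
      have hhalf : ∀ h, threshold C ε h / 2 = (t + m * κ) * threshold 1 ε h := fun h => by
        rw [hthr, hC]; ring
      have comb : ∀ {h u s n : ℝ}, h ∈ grid ε → h ≤ h₀ → |u - s| ≤ m ^ 2 * (L * h ^ β) →
          |ε * n| ≤ t * threshold 1 ε h → |u + ε * n - s| ≤ threshold C ε h / 2 := by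
        intro h u s n hh hle a1 a2
        have e : u + ε * n - s = ε * n + (u - s) := by ring
        rw [e, hhalf, add_mul]
        exact (abs_add_le _ _).trans (add_le_add a2 (a1.trans (hB h hh hle)))
      have pe : ∀ h ∈ grid ε, ∀ θ ν : Sph 2, ∃ p, pairEst (fun h p => V h p ω) h θ ν =
          pairEst (meanPair K x F) h θ ν +
            ε * torusNet.ext (fun p => W (wPair K x h p) ω) p := by
        intro h hh θ ν
        rw [pairEst, pairEst]
        split_ifs
        · exact ⟨_, h3 h hh _⟩
        · exact ⟨_, h3 h hh _⟩
      have key := abs_selected_sub_le (X := fun h θ => X h θ ω) (V := fun h p => V h p ω) hε hε1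
        hC0.le hh₀ (S := indexSmooth K f x θ₀) (θ₀ := θ₀) (θ := θ) ?_ ?_ ?_ ?_ h6
      · rwa [hS₀] at key
      · intro h hh hle ν
        show |X h ν ω - indexSmooth K f x θ₀ ν| ≤ _
        rw [h2 h hh ν]
        exact comb hh hle (abs_meanEst_sub_le hK hmom hβ hβb hL hf hFf hx (grid_mem_Ioc hh) ν)
          (hzt _ _ ((h1 h hh).1 ν))
      · intro h hh hle ν
        obtain ⟨p, hp⟩ := pe h hh θ₀ ν
        rw [hp]
        exact comb hh hle
          (abs_pairEst_index_left_sub_le hK hmom hβ hβb hL hf hFf hx (grid_mem_Ioc hh) ν)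
          (hzt _ _ ((h1 h hh).2 p))
      · intro h hh hle ν
        obtain ⟨p, hp⟩ := pe h hh ν θ₀
        rw [hp]
        exact comb hh hle
          (abs_pairEst_index_right_sub_le hK hmom hβ hβb hL hf hFf hx (grid_mem_Ioc hh) ν)
          (hzt _ _ ((h1 h hh).2 p))
      · intro h hh ν
        exact bddAbove_range_pairEst (X := fun h θ => X h θ ω) (V := fun h p => V h p ω)
          (h4 h hh) (h5 h hh) ν
  have hDm : Measurable fun ω => T (fun φ => obs ε W F φ ω) - F x :=
    (hT.comp (hW.measurable_obs ε F)).sub_const _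
  have hfinal := risk_le_of_dichotomy hDm hZm (p := 16 * q * l) hr (le_max_left _ _) hq1
    (by nlinarith) ht0 hmain hZp
  rw [pointwiseRisk]
  refine hfinal.trans ?_
  have hMt : ENNReal.ofReal (M / t) ^ (16 * q * l / q) ≤ ENNReal.ofReal ε := by
    have e1 : M / t = Real.exp (-1) := by
      rw [ht, Real.exp_neg]; field_simp
    rw [e1, ENNReal.ofReal_rpow_of_pos (Real.exp_pos _), ← Real.exp_mul]
    apply ENNReal.ofReal_le_ofReal
    have e2 : ε = Real.exp (-l) := by
      rw [hl, one_div, Real.log_inv, neg_neg, Real.exp_log hε]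
    conv_rhs => rw [e2]
    apply Real.exp_le_exp.2
    have : 16 * q * l / q = 16 * l := by
      have : q ≠ 0 := by positivity
      field_simp
    rw [this]; linarith
  calc _ ≤ ENNReal.ofReal (4 * threshold C ε h₀) +
        ENNReal.ofReal β₁ * ENNReal.ofReal t * ENNReal.ofReal ε := by gcongr
    _ = ENNReal.ofReal (4 * threshold C ε h₀ + β₁ * t * ε) := by
        rw [← ENNReal.ofReal_mul hβ₁0, ← ENNReal.ofReal_mul (by positivity),
          ← ENNReal.ofReal_add (by have := threshold_nonneg (h := h₀) hC0.le hε; positivity)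
            (by positivity)]
    _ ≤ _ := by
        apply ENNReal.ofReal_le_ofReal
        have e1 : β₁ * t * ε = t * (ε * √l) + 3 * m ^ 2 * L * ε := by
          rw [hβ₁]; field_simp
        have e2 : 3 * m ^ 2 * L * ε ≤ 3 * m ^ 2 * L * (ε * √l) := by
          gcongr
          exact le_mul_of_one_le_right hε.le hsl1
        have e3 : 4 * threshold C ε h₀ ≤
            4 * C * (2 * max 1 c * rate ε β L + ε * √l) := by
          rw [hthr, ← mul_assoc]
          gcongr
        calc _ ≤ 4 * C * (2 * max 1 c * rate ε β L + ε * √l) +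
              (t * (ε * √l) + 3 * m ^ 2 * L * (ε * √l)) := by rw [e1]; gcongr
          _ = _ := by field_simp; ring

end Risk

/-! ### Measurable selection and existence of the estimator -/

section Selection

variable {Ω : Type*} [MeasurableSpace Ω] {g : Ω → ℝ → ℝ} {I : Set ℝ}

/-- By continuity, the supremum is one over a countable dense set. -/
theorem measurable_sSup_image (hI : IsCompact I) (hne : I.Nonempty) (hc : ∀ ω, Continuous (g ω))
    (hm : ∀ a, Measurable fun ω => g ω a) : Measurable fun ω => sSup (g ω '' I) := by
  obtain ⟨D, hDI, hDc, hID⟩ :=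
    (TopologicalSpace.IsSeparable.of_separableSpace I).exists_countable_dense_subset
  refine measurable_of_Iic fun c => ?_
  have e : (fun ω => sSup (g ω '' I)) ⁻¹' Iic c = ⋂ a ∈ D, {ω | g ω a ≤ c} := by
    ext ω
    simp only [mem_preimage, mem_Iic, mem_iInter, mem_ofPred_eq]
    rw [csSup_le_iff (hI.image (hc ω)).bddAbove (hne.image _)]
    constructor
    · intro h a ha
      exact h _ ⟨a, hDI ha, rfl⟩
    · rintro h _ ⟨a, ha, rfl⟩
      have hcl : IsClosed {a | g ω a ≤ c} := isClosed_le (hc ω) continuous_const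
      exact closure_minimal h hcl (hID ha)
  rw [e]
  exact MeasurableSet.biInter hDc fun a _ => measurableSet_le (hm a) measurable_const

theorem measurableSet_exists_le (hI : IsCompact I) (hc : ∀ ω, Continuous (g ω))
    (hm : ∀ a, Measurable fun ω => g ω a) (c : ℝ) : MeasurableSet {ω | ∃ a ∈ I, g ω a ≤ c} := by
  rcases I.eq_empty_or_nonempty with rfl | hne
  · simp
  have e : {ω | ∃ a ∈ I, g ω a ≤ c} = {ω | -c ≤ sSup ((fun a => -g ω a) '' I)} := by
    ext ω
    constructor
    · rintro ⟨a, ha, h⟩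
      exact le_csSup_of_le (hI.image (hc ω).neg).bddAbove ⟨a, ha, rfl⟩ (neg_le_neg h)
    · intro h
      obtain ⟨a, ha, hs⟩ := (hI.image (hc ω).neg).sSup_mem (hne.image _)
      refine ⟨a, ha, ?_⟩
      have h' : -c ≤ -g ω a := le_of_le_of_eq h hs.symm
      exact neg_le_neg_iff.1 h'
  rw [e]
  exact measurableSet_le measurable_const
    (measurable_sSup_image hI hne (fun ω => (hc ω).neg) fun a => (hm a).neg)

/-- The least point of `[a, b]` at which `g ≤ 0` depends measurably on the parameter. -/
theorem exists_measurable_selection (a b : ℝ) (hc : ∀ ω, Continuous (g ω))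
    (hm : ∀ t, Measurable fun ω => g ω t) :
    ∃ s : Ω → ℝ, Measurable s ∧
      ∀ ω, (∃ t ∈ Icc a b, g ω t ≤ 0) → s ω ∈ Icc a b ∧ g ω (s ω) ≤ 0 := by
  set S : Ω → Set ℝ := fun ω => {t | t ∈ Icc a b ∧ g ω t ≤ 0} with hS
  have hScl : ∀ ω, IsClosed (S ω) := fun ω =>
    isClosed_Icc.inter (isClosed_le (hc ω) continuous_const)
  have hSbdd : ∀ ω, BddBelow (S ω) := fun ω => ⟨a, fun t ht => ht.1.1⟩
  -- inserting `b` makes the set nonempty and does not change the least element otherwise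
  have hbdd : ∀ ω, BddBelow (insert b (S ω)) := fun ω => (hSbdd ω).insert b
  refine ⟨fun ω => sInf (insert b (S ω)), measurable_of_Iic fun c => ?_, ?_⟩
  · by_cases hbc : b ≤ c
    · convert MeasurableSet.univ
      refine eq_univ_of_forall fun ω => ?_
      exact (csInf_le (hbdd ω) (mem_insert _ _)).trans hbc
    · have e : (fun ω => sInf (insert b (S ω))) ⁻¹' Iic c = {ω | ∃ t ∈ Icc a c, g ω t ≤ 0} := by
        push Not at hbc
        ext ω
        constructor
        · intro h
          have hmem := (isClosed_singleton.union (hScl ω)).csInf_mem (s := insert b (S ω))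
            (insert_nonempty _ _) (hbdd ω)
          have h' : sInf (insert b (S ω)) ≤ c := h
          rcases hmem with hmem | hmem
          · rw [hmem] at h'; linarith
          · exact ⟨_, ⟨hmem.1.1, h'⟩, hmem.2⟩
        · rintro ⟨t, ht, htg⟩
          exact (csInf_le (hbdd ω)
            (mem_insert_of_mem _ ⟨⟨ht.1, ht.2.trans hbc.le⟩, htg⟩)).trans ht.2
      rw [e]
      exact measurableSet_exists_le isCompact_Icc hc hm 0
  · rintro ω ⟨t, ht, htg⟩
    have hne : (S ω).Nonempty := ⟨t, ht, htg⟩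
    have hmem := (hScl ω).csInf_mem hne (hSbdd ω)
    have : sInf (insert b (S ω)) = sInf (S ω) := by
      rw [csInf_insert (hSbdd ω) hne]
      exact min_eq_right hmem.1.2
    simp only [this]
    exact hmem

end Selection

section Angles

theorem exists_circ_add_eq {θ ν : Sph 2} {φ : ℝ} (hθ : circ φ = θ)
    (h : 0 ≤ (inner ℝ ν.1 θ.1 : ℝ)) :
    ∃ a ∈ Icc (-(Real.pi / 2)) (Real.pi / 2), circ (φ + a) = ν := by
  obtain ⟨ψ, -, rfl⟩ := exists_circ_eq ν
  obtain ⟨a, ha, hae⟩ := exists_circ_eq (circ (ψ - φ))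
  have h0 := congrArg (fun p : Sph 2 => p.1 0) hae
  have h1 := congrArg (fun p : Sph 2 => p.1 1) hae
  simp only [circ_zero, circ_one] at h0 h1
  have hin : 0 ≤ Real.cos a := by
    rw [h0, Real.cos_sub]
    rw [← hθ, inner_eq_coord] at h
    simpa using h
  refine ⟨a, ⟨?_, ?_⟩, ?_⟩
  · by_contra! hlt
    have := Real.cos_neg_of_pi_div_two_lt_of_lt (x := -a) (by linarith)
      (by linarith [ha.1, Real.pi_pos])
    rw [Real.cos_neg] at this
    linarith
  · by_contra! hlt
    have := Real.cos_neg_of_pi_div_two_lt_of_lt (x := a) hlt (by linarith [ha.2, Real.pi_pos])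
    linarith
  · have e : ψ = φ + (ψ - φ) := by ring
    refine sph_ext ?_ ?_
    · rw [circ_zero, circ_zero, Real.cos_add, h0, h1, ← Real.cos_add, ← e]
    · rw [circ_one, circ_one, Real.sin_add, h0, h1, ← Real.sin_add, ← e]

theorem circ_add_pi (φ : ℝ) : circ (φ + Real.pi) = -circ φ := by
  refine sph_ext ?_ ?_
  · simp
  · simp

theorem inner_circ_add (φ a : ℝ) :
    (inner ℝ (circ (φ + a)).1 (circ φ).1 : ℝ) = Real.cos a := by
  rw [inner_eq_coord]
  simp only [circ_zero, circ_one]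
  rw [← Real.cos_sub]
  congr 1; ring

variable {X : ℝ → Sph 2 → ℝ} {V : ℝ → Sph 2 × Sph 2 → ℝ}

/-- The absolute difference of the two estimators in angular coordinates: `φ` is the angle of `θ`,
and `a` the angle from `θ` to `ν`. -/
def angleDiff (X : ℝ → Sph 2 → ℝ) (V : ℝ → Sph 2 × Sph 2 → ℝ) (h φ a : ℝ) : ℝ :=
  |V h (circ φ, circ (φ + a)) - X h (circ (φ + a))|

theorem continuous_angleDiff {h : ℝ} (hX : Continuous (X h)) (hV : Continuous (V h))
    {T : Type*} [TopologicalSpace T] {u v : T → ℝ} (hu : Continuous u) (hv : Continuous v) :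
    Continuous fun p => angleDiff X V h (u p) (v p) := by
  have h1 : Continuous fun p => circ (u p + v p) := continuous_circ.comp (hu.add hv)
  have h2 : Continuous fun p => circ (u p) := continuous_circ.comp hu
  exact ((hV.comp (h2.prodMk h1)).sub (hX.comp h1)).abs

/-- The statistic in angular coordinates: the change of sign of `θ` in the definition of the pair
estimator becomes a rotation by `π`, and the discontinuity at `νᵀθ = 0` disappears. -/
theorem iSup_pairEst_le_iff {h c : ℝ} (hX : Continuous (X h)) (hV : Continuous (V h)) (φ : ℝ) :
    (⨆ ν : Sph 2, |pairEst V h (circ φ) ν - X h ν|) ≤ c ↔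
      ∀ a ∈ Icc (-(Real.pi / 2)) (Real.pi / 2),
        angleDiff X V h φ a ≤ c ∧ angleDiff X V h (φ + Real.pi) a ≤ c := by
  have hbdd := bddAbove_range_pairEst hX hV (circ φ)
  have : Nonempty (Sph 2) := ⟨circ 0⟩
  rw [ciSup_le_iff hbdd]
  constructor
  · intro H
    have h1 : ∀ a ∈ Icc (-(Real.pi / 2)) (Real.pi / 2), angleDiff X V h φ a ≤ c := by
      intro a ha
      have := H (circ (φ + a))
      rwa [pairEst, if_pos (by rw [inner_circ_add]; exact Real.cos_nonneg_of_mem_Icc ha)] at this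
    -- `ν` with `νᵀθ < 0` only gives the open half circle, and continuity gives the closed one
    have h2 : ∀ a ∈ Ioo (-(Real.pi / 2)) (Real.pi / 2), angleDiff X V h (φ + Real.pi) a ≤ c := by
      intro a ha
      have := H (circ (φ + Real.pi + a))
      have hneg : ¬ 0 ≤ (inner ℝ (circ (φ + Real.pi + a)).1 (circ φ).1 : ℝ) := by
        rw [add_assoc, inner_circ_add, add_comm, Real.cos_add_pi]
        have := Real.cos_pos_of_mem_Ioo ha
        linarith
      rwa [pairEst, if_neg hneg, ← circ_add_pi] at this
    have hpi := Real.pi_pos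
    have hcl : IsClosed {a | angleDiff X V h (φ + Real.pi) a ≤ c} :=
      isClosed_le (continuous_angleDiff hX hV continuous_const continuous_id) continuous_const
    have h3 := closure_minimal h2 hcl
    rw [closure_Ioo (by linarith)] at h3
    exact fun a ha => ⟨h1 a ha, h3 ha⟩
  · intro H ν
    rw [pairEst]
    split_ifs with hν
    · obtain ⟨a, ha, rfl⟩ := exists_circ_add_eq rfl hν
      exact (H a ha).1
    · have hν' : 0 ≤ (inner ℝ ν.1 (-circ φ).1 : ℝ) := by
        have : (-circ φ).1 = -(circ φ).1 := rfl
        rw [this, inner_neg_right]; linarith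
      obtain ⟨a, ha, rfl⟩ := exists_circ_add_eq (circ_add_pi φ) hν'
      rw [← circ_add_pi]
      exact (H a ha).2

/-- A nonnegative continuous function that vanishes exactly at the angles of the directions that pass
the test for all bandwidths in `G`. -/
def excess (X : ℝ → Sph 2 → ℝ) (V : ℝ → Sph 2 × Sph 2 → ℝ) (C ε : ℝ) (G : Finset ℝ) (φ : ℝ) : ℝ :=
  ∑ η ∈ G, sSup ((fun a => max 0 (angleDiff X V η φ a - threshold C ε η) +
    max 0 (angleDiff X V η (φ + Real.pi) a - threshold C ε η)) '' Icc (-(Real.pi / 2)) (Real.pi / 2))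

theorem excess_le_zero_iff {C ε : ℝ} {G : Finset ℝ} (hX : ∀ η ∈ G, Continuous (X η))
    (hV : ∀ η ∈ G, Continuous (V η)) (φ : ℝ) :
    excess X V C ε G φ ≤ 0 ↔
      ∀ η ∈ G, (⨆ ν : Sph 2, |pairEst V η (circ φ) ν - X η ν|) ≤ threshold C ε η := by
  have hpi := Real.pi_pos
  have h0 : (0 : ℝ) ∈ Icc (-(Real.pi / 2)) (Real.pi / 2) := ⟨by linarith, by linarith⟩
  have hb : ∀ η ∈ G, BddAbove ((fun a => max 0 (angleDiff X V η φ a - threshold C ε η) +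
      max 0 (angleDiff X V η (φ + Real.pi) a - threshold C ε η)) ''
        Icc (-(Real.pi / 2)) (Real.pi / 2)) := by
    intro η hη
    have c1 : Continuous fun a => angleDiff X V η φ a :=
      continuous_angleDiff (hX η hη) (hV η hη) continuous_const continuous_id
    have c2 : Continuous fun a => angleDiff X V η (φ + Real.pi) a :=
      continuous_angleDiff (hX η hη) (hV η hη) continuous_const continuous_id
    exact (isCompact_Icc.image (by fun_prop)).bddAbove
  have hnn : ∀ η ∈ G, 0 ≤ sSup ((fun a => max 0 (angleDiff X V η φ a - threshold C ε η) +
      max 0 (angleDiff X V η (φ + Real.pi) a - threshold C ε η)) ''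
        Icc (-(Real.pi / 2)) (Real.pi / 2)) := fun η hη =>
    le_csSup_of_le (hb η hη) ⟨0, h0, rfl⟩ (add_nonneg (le_max_left _ _) (le_max_left _ _))
  have hsum : excess X V C ε G φ ≤ 0 ↔ excess X V C ε G φ = 0 :=
    ⟨fun h => le_antisymm h (Finset.sum_nonneg hnn), fun h => h.le⟩
  rw [hsum, excess, Finset.sum_eq_zero_iff_of_nonneg hnn]
  refine forall₂_congr fun η hη => ?_
  rw [iSup_pairEst_le_iff (hX η hη) (hV η hη)]
  constructor
  · intro h a ha
    have := le_csSup (hb η hη) ⟨a, ha, rfl⟩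
    rw [h] at this
    have m1 := le_max_left 0 (angleDiff X V η φ a - threshold C ε η)
    have m2 := le_max_right 0 (angleDiff X V η φ a - threshold C ε η)
    have m3 := le_max_left 0 (angleDiff X V η (φ + Real.pi) a - threshold C ε η)
    have m4 := le_max_right 0 (angleDiff X V η (φ + Real.pi) a - threshold C ε η)
    constructor <;> linarith
  · intro h
    refine le_antisymm (csSup_le ⟨_, 0, h0, rfl⟩ ?_) (hnn η hη)
    rintro _ ⟨a, ha, rfl⟩
    obtain ⟨k1, k2⟩ := h a ha
    simp only
    rw [max_eq_left (by linarith), max_eq_left (by linarith), add_zero]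

theorem continuous_excess {C ε : ℝ} {G : Finset ℝ} (hX : ∀ η ∈ G, Continuous (X η))
    (hV : ∀ η ∈ G, Continuous (V η)) : Continuous (excess X V C ε G) := by
  refine continuous_finsetSum _ fun η hη => ?_
  refine isCompact_Icc.continuous_sSup ?_
  have c1 : Continuous fun p : ℝ × ℝ => angleDiff X V η p.1 p.2 :=
    continuous_angleDiff (hX η hη) (hV η hη) continuous_fst continuous_snd
  have c2 : Continuous fun p : ℝ × ℝ => angleDiff X V η (p.1 + Real.pi) p.2 :=
    continuous_angleDiff (hX η hη) (hV η hη) (continuous_fst.add continuous_const) continuous_snd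
  exact (by fun_prop : Continuous fun p : ℝ × ℝ =>
    max 0 (angleDiff X V η p.1 p.2 - threshold C ε η) +
      max 0 (angleDiff X V η (p.1 + Real.pi) p.2 - threshold C ε η))

end Angles

section Existence

variable {Ω : Type*} [MeasurableSpace Ω] {X : ℝ → Sph 2 → Ω → ℝ} {V : ℝ → Sph 2 × Sph 2 → Ω → ℝ}
  {C ε : ℝ}

theorem measurable_excess (hX : ∀ h ω, Continuous fun θ => X h θ ω)
    (hV : ∀ h ω, Continuous fun p => V h p ω) (hXm : ∀ h θ, Measurable (X h θ))
    (hVm : ∀ h p, Measurable (V h p)) (G : Finset ℝ) (φ : ℝ) :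
    Measurable fun ω => excess (fun h θ => X h θ ω) (fun h p => V h p ω) C ε G φ := by
  have hpi := Real.pi_pos
  refine Finset.measurable_sum _ fun η _ => ?_
  have hm : ∀ φ a, Measurable fun ω =>
      angleDiff (fun h θ => X h θ ω) (fun h p => V h p ω) η φ a := fun φ a =>
    measurable_norm.comp ((hVm η _).sub (hXm η _))
  refine measurable_sSup_image isCompact_Icc (nonempty_Icc.2 (by linarith)) (fun ω => ?_)
    fun a => ?_
  · have c1 : Continuous fun a => angleDiff (fun h θ => X h θ ω) (fun h p => V h p ω) η φ a :=
      continuous_angleDiff (hX η ω) (hV η ω) continuous_const continuous_id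
    have c2 : Continuous fun a =>
        angleDiff (fun h θ => X h θ ω) (fun h p => V h p ω) η (φ + Real.pi) a :=
      continuous_angleDiff (hX η ω) (hV η ω) continuous_const continuous_id
    exact (continuous_const.max (c1.sub continuous_const)).add
      (continuous_const.max (c2.sub continuous_const))
  · exact (measurable_const.max ((hm φ a).sub measurable_const)).add
      (measurable_const.max ((hm (φ + Real.pi) a).sub measurable_const))

/-- Measurable choice of the index: the least accepted angle at the largest bandwidth for which there
is one. -/
theorem exists_measurable_isSelectedIndex (hε : 0 < ε) (hX : ∀ h ω, Continuous fun θ => X h θ ω)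
    (hV : ∀ h ω, Continuous fun p => V h p ω) (hXm : ∀ h θ, Measurable (X h θ))
    (hVm : ∀ h p, Measurable (V h p)) :
    ∃ θhat : Ω → Sph 2, Measurable θhat ∧
      ∀ ω, IsSelectedIndex (fun h θ => X h θ ω) (fun h p => V h p ω) C ε (θhat ω) := by
  classical
  set G := (finite_grid hε).toFinset with hG
  have hGmem : ∀ h, h ∈ G ↔ h ∈ grid ε := fun h => Set.Finite.mem_toFinset _
  set f : ℝ → Ω → ℝ → ℝ := fun h ω =>
    excess (fun h θ => X h θ ω) (fun h p => V h p ω) C ε (G.filter (· ≤ h)) with hf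
  have hfc : ∀ h ω, Continuous (f h ω) := fun h ω =>
    continuous_excess (fun η _ => hX η ω) (fun η _ => hV η ω)
  have hfm : ∀ h φ, Measurable fun ω => f h ω φ := fun h φ => measurable_excess hX hV hXm hVm _ _
  have hf0 : ∀ h ∈ grid ε, ∀ ω φ, f h ω φ ≤ 0 ↔
      (circ φ, h) ∈ selSet (fun h θ => X h θ ω) (fun h p => V h p ω) C ε := by
    intro h hh ω φ
    rw [hf, excess_le_zero_iff (X := fun h θ => X h θ ω) (V := fun h p => V h p ω)
      (fun η _ => hX η ω) (fun η _ => hV η ω)]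
    show _ ↔ h ∈ grid ε ∧ selStat _ _ _ _ _ _ ≤ 0
    rw [selStat_le_zero_iff hε hh]
    simp only [Finset.mem_filter, hGmem, and_imp, hh, true_and]
  choose s hsm hs using fun h => exists_measurable_selection (-Real.pi) Real.pi (hfc h) (hfm h)
  set N : ℝ → Set Ω := fun h => {ω | ∃ φ ∈ Icc (-Real.pi) Real.pi, f h ω φ ≤ 0} with hN
  have hNm : ∀ h, MeasurableSet (N h) := fun h =>
    measurableSet_exists_le isCompact_Icc (hfc h) (hfm h) 0
  have hNmem : ∀ q ω, q ∈ selSet (fun h θ => X h θ ω) (fun h p => V h p ω) C ε → ω ∈ N q.2 := by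
    rintro ⟨θ, h⟩ ω hq
    obtain ⟨φ, hφ, rfl⟩ := exists_circ_eq θ
    exact ⟨φ, hφ, (hf0 h hq.1 ω φ).2 hq⟩
  -- on the disjoint events `A h` the largest accepted bandwidth is `h`
  set A : ℝ → Set Ω := fun h => N h ∩ ⋂ h' ∈ G.filter (h < ·), (N h')ᶜ with hA
  have hAm : ∀ h, MeasurableSet (A h) := fun h =>
    (hNm h).inter (Finset.measurableSet_biInter _ fun h' _ => (hNm h').compl)
  -- off these events the sum vanishes, and `circ 0` is the default direction `(1, 0)`
  refine ⟨fun ω => circ (∑ h ∈ G, (A h).indicator (s h) ω), ?_, fun ω => ⟨?_, ?_⟩⟩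
  · exact continuous_circ.measurable.comp
      (Finset.measurable_sum _ fun h _ => (hsm h).indicator (hAm h))
  · rintro ⟨q, hq⟩
    have hne : (G.filter fun h => ω ∈ N h).Nonempty :=
      ⟨q.2, Finset.mem_filter.2 ⟨(hGmem _).2 hq.1, hNmem q ω hq⟩⟩
    obtain ⟨h, hh, hmax⟩ := (G.filter fun h => ω ∈ N h).exists_max_image id hne
    rw [Finset.mem_filter] at hh
    have hωA : ω ∈ A h := by
      refine ⟨hh.2, mem_iInter₂.2 fun h' hh' hmem => ?_⟩
      rw [Finset.mem_filter] at hh'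
      exact absurd (hmax h' (Finset.mem_filter.2 ⟨hh'.1, hmem⟩)) (not_le.2 hh'.2)
    have hsum : ∑ h ∈ G, (A h).indicator (s h) ω = s h ω := by
      rw [Finset.sum_eq_single_of_mem h hh.1, indicator_of_mem hωA]
      intro h' hh' hne'
      refine indicator_of_notMem (fun hmem => ?_) _
      rcases lt_or_gt_of_ne hne' with hlt | hlt
      · exact (mem_iInter₂.1 hmem.2 h (Finset.mem_filter.2 ⟨hh.1, hlt⟩)) hh.2
      · exact (mem_iInter₂.1 hωA.2 h' (Finset.mem_filter.2 ⟨hh', hlt⟩)) hmem.1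
    refine ⟨h, ?_, fun q' hq' =>
      hmax q'.2 (Finset.mem_filter.2 ⟨(hGmem _).2 hq'.1, hNmem q' ω hq'⟩)⟩
    show (circ (∑ h ∈ G, (A h).indicator (s h) ω), h) ∈ _
    rw [hsum]
    exact (hf0 h ((hGmem h).1 hh.1) ω _).1 (hs h ω hh.2).2
  · intro he
    have hsum : ∑ h ∈ G, (A h).indicator (s h) ω = 0 := by
      refine Finset.sum_eq_zero fun h hh => indicator_of_notMem (fun hmem => ?_) _
      obtain ⟨φ, -, hφ⟩ := hmem.1
      have := (hf0 h ((hGmem h).1 hh) ω φ).1 hφ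
      rw [he] at this
      exact this
    simp only [hsum]
    simp

theorem measurable_selected (hε : 0 < ε) (hε1 : ε < 1) (hC : 0 ≤ C)
    (hX : ∀ h ω, Continuous fun θ => X h θ ω) (hXm : ∀ h θ, Measurable (X h θ))
    {θhat : Ω → Sph 2} (hθ : Measurable θhat) :
    Measurable fun ω => X (selBandwidth (fun h θ => X h θ ω) C ε (θhat ω)) (θhat ω) ω := by
  classical
  set G := (finite_grid hε).toFinset with hG
  have hGmem : ∀ h, h ∈ G ↔ h ∈ grid ε := fun h => Set.Finite.mem_toFinset _
  have hY : ∀ h, Measurable fun ω => X h (θhat ω) ω := fun h =>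
    (measurable_uncurry_of_continuous_of_measurable (u := X h) (hX h) (hXm h)).comp
      (hθ.prodMk measurable_id)
  set B : ℝ → Set Ω := fun h => ⋂ η ∈ G.filter (· ≤ h),
    {ω | |X h (θhat ω) ω - X η (θhat ω) ω| ≤ threshold C ε η} with hB
  have hBm : ∀ h, MeasurableSet (B h) := fun h => Finset.measurableSet_biInter _ fun η _ =>
    measurableSet_le (measurable_norm.comp ((hY h).sub (hY η))) measurable_const
  have hBmem : ∀ h ω, ω ∈ B h ↔ ∀ η ∈ grid ε, η ≤ h →
      |X h (θhat ω) ω - X η (θhat ω) ω| ≤ threshold C ε η := by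
    intro h ω
    simp only [hB, mem_iInter, Finset.mem_filter, hGmem, and_imp]
    rfl
  set sel : Ω → ℝ := fun ω => selBandwidth (fun h θ => X h θ ω) C ε (θhat ω) with hsel
  have hmem := fun ω => selBandwidth_mem hε hε1 hC (fun h θ => X h θ ω) (θhat ω)
  have hselm : Measurable sel := by
    refine measurable_of_Iic fun c => ?_
    have e : sel ⁻¹' Iic c = ⋂ h ∈ G.filter (c < ·), (B h)ᶜ := by
      ext ω
      simp only [mem_iInter, Finset.mem_filter, and_imp, mem_preimage, mem_Iic]
      constructor
      · intro h h' hG' hlt hB'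
        have : h' ≤ sel ω := by
          refine le_csSup ((finite_grid hε).subset fun h hh => hh.1).bddAbove ?_
          exact ⟨(hGmem h').1 hG', (hBmem h' ω).1 hB'⟩
        linarith
      · intro h
        by_contra! hlt
        exact h (sel ω) ((hGmem _).2 (hmem ω).1) hlt ((hBmem _ ω).2 (hmem ω).2)
    rw [e]
    exact Finset.measurableSet_biInter _ fun h _ => (hBm h).compl
  have e : (fun ω => X (sel ω) (θhat ω) ω) = fun ω => ∑ h ∈ G,
      (sel ⁻¹' {h}).indicator (fun ω => X h (θhat ω) ω) ω := by
    funext ω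
    rw [Finset.sum_eq_single_of_mem (sel ω) ((hGmem _).2 (hmem ω).1),
      indicator_of_mem (by simp)]
    intro h _ hne
    refine indicator_of_notMem (fun h' => hne ?_) _
    exact (mem_singleton_iff.1 h').symm
  rw [e]
  exact Finset.measurable_sum _ fun h _ => (hY h).indicator (hselm (measurableSet_singleton h))

end Existence

section Paths

variable {d : ℕ} {Ω : Type*} [MeasurableSpace Ω] {P : Measure Ω} [IsProbabilityMeasure P]
  {W : L2 d → Ω → ℝ}

/-- The limit of the interpolations along a net is a version of the observed process. -/
theorem IsWhiteNoise.ext_obs_ae_eq (hW : IsWhiteNoise P W) {F : E d → ℝ}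
    (hF : MemLp F 2 (domMeasure d)) {T : Type*} [MetricSpace T] (N : NetSeq T) {Φ : T → L2 d}
    {σ Λ : ℝ} (hΛ : 0 ≤ Λ) (hval : ∀ t, ‖Φ t‖ ≤ σ) (hinc : ∀ s t, ‖Φ s - Φ t‖ ≤ Λ * dist s t)
    (ε : ℝ) (t : T) :
    (fun ω => N.ext (fun s => obs ε W F (Φ s) ω) t) =ᵐ[P] obs ε W F (Φ t) := by
  have hm : ∀ s, Measurable (obs ε W F (Φ s)) := fun s =>
    (measurable_pi_apply (Φ s)).comp (hW.measurable_obs ε F)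
  have hdet : ∀ s t, |(inner ℝ (Φ s) (toL2 F) : ℝ) - inner ℝ (Φ t) (toL2 F)| ≤
      ‖toL2 F‖ * Λ * dist s t := fun s t => by
    rw [mul_assoc]
    exact abs_inner_sub_le.trans (by gcongr; exact hinc s t)
  have hreg : ∀ᵐ ω ∂P, N.Regular fun s => obs ε W F (Φ s) ω := by
    filter_upwards [hW.ae_regular N hΛ hval hinc] with ω hω
    simp_rw [obs_eq_inner hF]
    exact (N.regular_of_lipschitz hdet).add (hω.const_mul ε)
  refine N.ext_ae_eq hm hreg
    (c := ENNReal.ofReal (‖toL2 F‖ * Λ) + ENNReal.ofReal |ε| * ENNReal.ofReal (4 * Λ))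
    (by finiteness) (fun s t => ?_) t
  have hpt : ∀ ω, ENNReal.ofReal |obs ε W F (Φ s) ω - obs ε W F (Φ t) ω| ≤
      ENNReal.ofReal (‖toL2 F‖ * Λ) * ENNReal.ofReal (dist s t) +
        ENNReal.ofReal |ε| * ENNReal.ofReal |W (Φ s) ω - W (Φ t) ω| := by
    intro ω
    rw [← ENNReal.ofReal_mul (by positivity), ← ENNReal.ofReal_mul (abs_nonneg _),
      ← ENNReal.ofReal_add (by positivity) (by positivity)]
    apply ENNReal.ofReal_le_ofReal
    rw [obs_eq_inner hF, obs_eq_inner hF]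
    have e : (inner ℝ (Φ s) (toL2 F) : ℝ) + ε * W (Φ s) ω -
      (inner ℝ (Φ t) (toL2 F) + ε * W (Φ t) ω) =
      (inner ℝ (Φ s) (toL2 F) - inner ℝ (Φ t) (toL2 F)) + ε * (W (Φ s) ω - W (Φ t) ω) := by ring
    rw [e, ← abs_mul]
    exact (abs_add_le _ _).trans (add_le_add_left (hdet s t) _)
  have hmw : Measurable fun ω => ENNReal.ofReal |W (Φ s) ω - W (Φ t) ω| :=
    ENNReal.measurable_ofReal.comp (measurable_norm.comp ((hW.measurable _).sub (hW.measurable _)))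
  refine (lintegral_mono hpt).trans ?_
  rw [lintegral_add_left measurable_const, lintegral_const, measure_univ, mul_one,
    lintegral_const_mul _ hmw, add_mul, mul_assoc (ENNReal.ofReal |ε|)]
  gcongr
  exact hW.lintegral_abs_sub_le hinc s t

end Paths

/-- The estimator exists as a function of the observation alone: the continuous versions are computed
from the values of the observation at the weights with directions in the nets. -/
theorem IsKernel.exists_isSelectedEstimator {K : ℝ → ℝ} (hK : IsKernel K) {C ε : ℝ} (hε : 0 < ε)
    (hε1 : ε < 1) (hC : 0 ≤ C) {x : E 2} (hx : x ∈ innerCube 2) {Ω : Type*} [MeasurableSpace Ω]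
    {P : Measure Ω} [IsProbabilityMeasure P] {W : L2 2 → Ω → ℝ} (hW : IsWhiteNoise P W) :
    ∃ T : (L2 2 → ℝ) → ℝ, Measurable T ∧ ∀ F : E 2 → ℝ, MemLp F 2 (domMeasure 2) →
      IsSelectedEstimator P K C ε x (obs ε W F) (fun ω => T (fun φ => obs ε W F φ ω)) := by
  obtain ⟨σ, Λ, hσ, hΛ, Hw⟩ := hK.exists_weight_bounds
  set X : ℝ → Sph 2 → (L2 2 → ℝ) → ℝ := fun h θ y => circleNet.ext (fun θ => y (wEst K x h θ)) θ
  set V : ℝ → Sph 2 × Sph 2 → (L2 2 → ℝ) → ℝ := fun h p y =>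
    torusNet.ext (fun p => y (wPair K x h p)) p
  have hX : ∀ h y, Continuous fun θ => X h θ y := fun h y => circleNet.continuous_ext _
  have hV : ∀ h y, Continuous fun p => V h p y := fun h y => torusNet.continuous_ext _
  have hXm : ∀ h θ, Measurable (X h θ) := fun h θ =>
    circleNet.measurable_ext (fun θ => measurable_pi_apply (wEst K x h θ)) θ
  have hVm : ∀ h p, Measurable (V h p) := fun h p =>
    torusNet.measurable_ext (fun p => measurable_pi_apply (wPair K x h p)) p
  have hXv : ∀ F : E 2 → ℝ, MemLp F 2 (domMeasure 2) → ∀ h ∈ grid ε, ∀ θ,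
      (fun ω => X h θ fun φ => obs ε W F φ ω) =ᵐ[P] obs ε W F (wEst K x h θ) := by
    intro F hF h hh
    obtain ⟨b1, b2, b3, b4⟩ := Hw x hx h (grid_mem_Ioc hh)
    exact hW.ext_obs_ae_eq hF circleNet (by positivity) b1 b2 ε
  have hVv : ∀ F : E 2 → ℝ, MemLp F 2 (domMeasure 2) → ∀ h ∈ grid ε, ∀ p,
      (fun ω => V h p fun φ => obs ε W F φ ω) =ᵐ[P] obs ε W F (wPair K x h p) := by
    intro F hF h hh
    obtain ⟨b1, b2, b3, b4⟩ := Hw x hx h (grid_mem_Ioc hh)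
    exact hW.ext_obs_ae_eq hF torusNet (by positivity) b3 b4 ε
  -- the explicit form of the versions plays no further role
  clear_value X V
  obtain ⟨θhat, hθm, hθ⟩ := exists_measurable_isSelectedIndex (C := C) hε hX hV hXm hVm
  refine ⟨fun y => X (selBandwidth (fun h θ => X h θ y) C ε (θhat y)) (θhat y) y,
    measurable_selected hε hε1 hC hX hXm hθm, fun F hF => ?_⟩
  have hobs := hW.measurable_obs ε F
  exact ⟨fun h θ ω => X h θ fun φ => obs ε W F φ ω, fun h p ω => V h p fun φ => obs ε W F φ ω,
    fun ω => θhat fun φ => obs ε W F φ ω, hXv F hF, fun h _ => ae_of_all _ fun ω => hX h _,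
    hVv F hF, fun h _ => ae_of_all _ fun ω => hV h _, hθm.comp hobs,
    ae_of_all _ fun ω => hθ _, ae_of_all _ fun ω => rfl⟩

/-! ### Change of measure for the white noise -/

theorem lintegral_gaussianReal_add {s : NNReal} (hs : s ≠ 0) {f : ℝ → ℝ≥0∞} (hf : Measurable f) :
    ∫⁻ x, f (x + s) ∂(gaussianReal 0 s) =
      ∫⁻ x, f x * ENNReal.ofReal (Real.exp (x - s / 2)) ∂(gaussianReal 0 s) := by
  have h1 : ∫⁻ x, f (x + s) ∂(gaussianReal 0 s) = ∫⁻ x, f x ∂(gaussianReal s s) := by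
    rw [← lintegral_map hf (by fun_prop), gaussianReal_map_add_const, zero_add]
  have hs' : (s : ℝ) ≠ 0 := by simpa using hs
  have hd : ∀ x, gaussianPDF s s x = gaussianPDF 0 s x * ENNReal.ofReal (Real.exp (x - s / 2)) := by
    intro x
    rw [gaussianPDF, gaussianPDF, ← ENNReal.ofReal_mul (gaussianPDFReal_nonneg _ _ _),
      gaussianPDFReal, gaussianPDFReal, mul_assoc _ (Real.exp _), ← Real.exp_add]
    congr 3
    field_simp
    ring
  rw [h1, gaussianReal_of_var_ne_zero _ hs, gaussianReal_of_var_ne_zero _ hs,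
    lintegral_withDensity_eq_lintegral_mul _ (measurable_gaussianPDF _ _) hf,
    lintegral_withDensity_eq_lintegral_mul _ (measurable_gaussianPDF _ _) (by fun_prop)]
  refine lintegral_congr fun x => ?_
  simp only [Pi.mul_apply]
  rw [hd]; ring

section CameronMartin

variable {d : ℕ} {Ω : Type*} [MeasurableSpace Ω] {P : Measure Ω} {W : L2 d → Ω → ℝ}

/-- The likelihood ratio of the white noise shifted by `H`. -/
def likelihood (W : L2 d → Ω → ℝ) (H : L2 d) (ω : Ω) : ℝ≥0∞ :=
  ENNReal.ofReal (Real.exp (W H ω - ‖H‖ ^ 2 / 2))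

theorem IsWhiteNoise.measurable_likelihood (hW : IsWhiteNoise P W) (H : L2 d) :
    Measurable (likelihood W H) :=
  (Real.measurable_exp.comp ((hW.measurable H).sub_const _)).ennreal_ofReal

/-- The Cameron–Martin formula: the part of the noise orthogonal to `H` is independent of `W(H)`,
so that only the law of the real variable `W(H)` is shifted. -/
theorem IsWhiteNoise.lintegral_shift (hW : IsWhiteNoise P W) (H : L2 d)
    {f : (L2 d → ℝ) → ℝ≥0∞} (hf : Measurable f) :
    ∫⁻ ω, f (fun φ => W φ ω + inner ℝ φ H) ∂P =
      ∫⁻ ω, f (fun φ => W φ ω) * likelihood W H ω ∂P := by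
  have hP : IsProbabilityMeasure P := hW.gaussian.isProbabilityMeasure
  by_cases hH : H = 0
  · subst hH
    have h0 : W 0 =ᵐ[P] 0 := by
      have h1 := hW.covariance 0 0
      rw [inner_zero_left, integral_eq_zero_iff_of_nonneg
        (fun ω => mul_self_nonneg (W 0 ω)) (hW.integrable_mul 0 0)] at h1
      filter_upwards [h1] with ω hω
      exact mul_self_eq_zero.1 hω
    refine lintegral_congr_ae ?_
    filter_upwards [h0] with ω hω
    simp [likelihood, hω]
  set s : NNReal := ‖H‖₊ ^ 2 with hs
  have hs0 : s ≠ 0 := by simpa [hs] using hH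
  have hsr : (s : ℝ) = ‖H‖ ^ 2 := by simp [hs]
  have hsr0 : (s : ℝ) ≠ 0 := by exact_mod_cast hs0
  set c : L2 d → ℝ := fun φ => inner ℝ φ H / s with hc
  -- the part of the noise orthogonal to `H`
  set U : L2 d → Ω → ℝ := fun φ ω => W φ ω - c φ * W H ω with hU
  have hind : IndepFun (fun ω φ => U φ ω) (fun ω (_ : Unit) => W H ω) P := by
    refine IsGaussianProcess.indepFun_of_covariance_eq_zero (X := U) (Y := fun _ : Unit => W H)
      ?_ (fun φ => ((hW.measurable φ).sub ((hW.measurable H).const_mul _)).aemeasurable)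
      (fun _ => (hW.measurable H).aemeasurable) ?_
    · classical
      refine hW.gaussian.of_isGaussianProcess fun t => ?_
      rcases t with φ | u
      · refine ⟨{φ, H}, ContinuousLinearMap.proj (R := ℝ) (φ := fun _ : ({φ, H} : Finset (L2 d)) => ℝ)
          ⟨φ, by simp⟩ - c φ • ContinuousLinearMap.proj (R := ℝ)
            (φ := fun _ : ({φ, H} : Finset (L2 d)) => ℝ) ⟨H, by simp⟩, fun ω => ?_⟩
        simp [hU]
      · refine ⟨{H}, ContinuousLinearMap.proj (R := ℝ) (φ := fun _ : ({H} : Finset (L2 d)) => ℝ)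
          ⟨H, by simp⟩, fun ω => ?_⟩
        simp
    · intro φ u
      have hint : ∫ ω, U φ ω ∂P = 0 := by
        simp only [hU]
        rw [integral_sub (hW.integrable φ) ((hW.integrable H).const_mul _), integral_const_mul,
          hW.centered, hW.centered]
        simp
      rw [ProbabilityTheory.covariance, hint, hW.centered]
      simp only [sub_zero, hU, sub_mul, mul_assoc]
      rw [integral_sub (hW.integrable_mul φ H) ((hW.integrable_mul H H).const_mul _),
        integral_const_mul, hW.covariance, hW.covariance, real_inner_self_eq_norm_sq, ← hsr, hc]
      field_simp
      ring
  have hind2 : IndepFun (fun ω φ => U φ ω) (W H) P :=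
    hind.comp (φ := id) (ψ := fun g : Unit → ℝ => g ()) measurable_id (measurable_pi_apply _)
  have hUm : Measurable fun ω φ => U φ ω :=
    measurable_pi_lambda _ fun φ => (hW.measurable φ).sub ((hW.measurable H).const_mul _)
  have hprod := (indepFun_iff_map_prod_eq_prod_map_map hUm.aemeasurable
    (hW.measurable H).aemeasurable).1 hind2
  rw [hW.map_eval H, ← hs] at hprod
  have hΦ : Measurable fun p : (L2 d → ℝ) × ℝ => f fun φ => p.1 φ + c φ * p.2 :=
    hf.comp (measurable_pi_lambda _ fun φ =>
      ((measurable_pi_apply φ).comp measurable_fst).add (measurable_snd.const_mul _))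
  have hΦ1 : Measurable fun p : (L2 d → ℝ) × ℝ => f fun φ => p.1 φ + c φ * (p.2 + s) :=
    hΦ.comp (measurable_fst.prodMk (measurable_snd.add_const _))
  have hΦ2 : Measurable fun p : (L2 d → ℝ) × ℝ => (f fun φ => p.1 φ + c φ * p.2) *
      ENNReal.ofReal (Real.exp (p.2 - s / 2)) := hΦ.mul (by fun_prop)
  have hpm : Measurable fun ω => ((fun φ => U φ ω), W H ω) := hUm.prodMk (hW.measurable H)
  have hν : IsProbabilityMeasure (P.map fun ω φ => U φ ω) :=
    Measure.isProbabilityMeasure_map hUm.aemeasurable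
  calc ∫⁻ ω, f (fun φ => W φ ω + inner ℝ φ H) ∂P
      = ∫⁻ p, (f fun φ => p.1 φ + c φ * (p.2 + s))
          ∂(P.map fun ω => ((fun φ => U φ ω), W H ω)) := by
        rw [lintegral_map hΦ1 hpm]
        refine lintegral_congr fun ω => ?_
        congr 1
        funext φ
        simp only [hU, hc]
        field_simp
        ring
    _ = ∫⁻ u, ∫⁻ n, (f fun φ => u φ + c φ * (n + s)) ∂(gaussianReal 0 s)
          ∂(P.map fun ω φ => U φ ω) := by
        rw [hprod, lintegral_prod _ hΦ1.aemeasurable]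
    _ = ∫⁻ u, ∫⁻ n, (f fun φ => u φ + c φ * n) * ENNReal.ofReal (Real.exp (n - s / 2))
          ∂(gaussianReal 0 s) ∂(P.map fun ω φ => U φ ω) := by
        refine lintegral_congr fun u => ?_
        exact lintegral_gaussianReal_add (f := fun n => f fun φ => u φ + c φ * n) hs0
          (hΦ.comp measurable_prodMk_left)
    _ = ∫⁻ p, (f fun φ => p.1 φ + c φ * p.2) * ENNReal.ofReal (Real.exp (p.2 - s / 2))
          ∂(P.map fun ω => ((fun φ => U φ ω), W H ω)) := by
        rw [hprod, lintegral_prod _ hΦ2.aemeasurable]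
    _ = _ := by
        rw [lintegral_map hΦ2 hpm]
        refine lintegral_congr fun ω => ?_
        rw [likelihood, ← hsr]
        congr 2
        funext φ
        simp [hU]

theorem IsWhiteNoise.lintegral_likelihood (hW : IsWhiteNoise P W) (H : L2 d) :
    ∫⁻ ω, likelihood W H ω ∂P = 1 := by
  have hP : IsProbabilityMeasure P := hW.gaussian.isProbabilityMeasure
  have := hW.lintegral_shift H (f := fun _ => 1) measurable_const
  simpa using this.symm

/-- The likelihood ratios of nearly orthogonal shifts are nearly uncorrelated. -/
theorem IsWhiteNoise.lintegral_likelihood_mul (hW : IsWhiteNoise P W) (H H' : L2 d) :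
    ∫⁻ ω, likelihood W H' ω * likelihood W H ω ∂P =
      ENNReal.ofReal (Real.exp (inner ℝ H' H)) := by
  have hm : Measurable fun y : L2 d → ℝ => ENNReal.ofReal (Real.exp (y H' - ‖H'‖ ^ 2 / 2)) :=
    (Real.measurable_exp.comp ((measurable_pi_apply H').sub_const _)).ennreal_ofReal
  have h := hW.lintegral_shift H hm
  have e : ∀ ω, ENNReal.ofReal (Real.exp (W H' ω + inner ℝ H' H - ‖H'‖ ^ 2 / 2)) =
      ENNReal.ofReal (Real.exp (inner ℝ H' H)) * likelihood W H' ω := fun ω => by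
    rw [likelihood, ← ENNReal.ofReal_mul (Real.exp_pos _).le, ← Real.exp_add]
    congr 2; ring
  simp_rw [e] at h
  rw [lintegral_const_mul _ (hW.measurable_likelihood H'), hW.lintegral_likelihood, mul_one] at h
  exact h.symm

end CameronMartin

/-! ### Testing a point against a mixture -/

section Testing

variable {Ω : Type*} [MeasurableSpace Ω] {P : Measure Ω}

/-- If the likelihood ratio `Λ` has a bounded second moment, no statistic is close to `0` under `P`
and close to `s` under `Λ P`. -/
theorem rpow_div_le_of_likelihood {Λ : Ω → ℝ≥0∞} (hΛ : Measurable Λ) (h1 : ∫⁻ ω, Λ ω ∂P = 1)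
    (h2 : ∫⁻ ω, Λ ω * Λ ω ∂P ≤ 4) {t : Ω → ℝ} (ht : Measurable t) {s r : ℝ} (hr : 0 < r)
    {R : ℝ≥0∞} (hR0 : ∫⁻ ω, ENNReal.ofReal |t ω| ^ r ∂P ≤ R)
    (hR1 : ∫⁻ ω, ENNReal.ofReal |t ω - s| ^ r * Λ ω ∂P ≤ R) :
    ENNReal.ofReal (s / 2) ^ r * 16⁻¹ ≤ R := by
  set B : Set Ω := {ω | s / 2 ≤ |t ω|} with hB
  have hBm : MeasurableSet B := measurableSet_le measurable_const (measurable_norm.comp ht)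
  by_cases hPB : 16⁻¹ ≤ P B
  · refine le_trans ?_ hR0
    calc ENNReal.ofReal (s / 2) ^ r * 16⁻¹ ≤ ENNReal.ofReal (s / 2) ^ r * P B := by gcongr
      _ = ∫⁻ _ in B, ENNReal.ofReal (s / 2) ^ r ∂P := by rw [setLIntegral_const]
      _ ≤ ∫⁻ ω in B, ENNReal.ofReal |t ω| ^ r ∂P := by
        refine setLIntegral_mono' hBm fun ω hω => ?_
        gcongr
        exact hω
      _ ≤ _ := setLIntegral_le_lintegral _ _
  · -- a linearized Cauchy–Schwarz inequality, adapted to `P B ≤ 1 / 16`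
    have hpt : ∀ ω, Λ ω ≤ 16⁻¹ * (Λ ω * Λ ω) + 4 := by
      intro ω
      by_cases htop : Λ ω = ∞
      · simp [htop, ENNReal.mul_top]
      lift Λ ω to NNReal using htop with a
      have : (a : ℝ) ≤ 16⁻¹ * (a * a) + 4 := by nlinarith [sq_nonneg ((a : ℝ) - 8)]
      have h3 : a ≤ 16⁻¹ * (a * a) + 4 := by exact_mod_cast this
      have h4 : ((16⁻¹ : NNReal) : ℝ≥0∞) = 16⁻¹ := by
        rw [ENNReal.coe_inv (by norm_num)]; norm_num
      rw [← h4]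
      exact_mod_cast h3
    have hΛΛ : Measurable fun ω => Λ ω * Λ ω := hΛ.mul hΛ
    have hΛB : ∫⁻ ω in B, Λ ω ∂P ≤ 2⁻¹ := by
      calc ∫⁻ ω in B, Λ ω ∂P ≤ ∫⁻ ω in B, (16⁻¹ * (Λ ω * Λ ω) + 4) ∂P := lintegral_mono fun ω => hpt ω
        _ = 16⁻¹ * ∫⁻ ω in B, Λ ω * Λ ω ∂P + 4 * P B := by
          rw [lintegral_add_right _ measurable_const, lintegral_const_mul _ hΛΛ,
            setLIntegral_const]
        _ ≤ 16⁻¹ * 4 + 4 * 16⁻¹ := by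
          gcongr
          · exact (setLIntegral_le_lintegral _ _).trans h2
          · exact (not_le.1 hPB).le
        _ = 2⁻¹ := by
          rw [mul_comm (4 : ℝ≥0∞), ← mul_add]
          have : (16 : ℝ≥0∞) = 2 * (4 + 4) := by norm_num
          rw [this, ENNReal.mul_inv (by norm_num) (by norm_num), mul_assoc,
            ENNReal.inv_mul_cancel (by norm_num) (by finiteness), mul_one]
    have hΛc : 2⁻¹ ≤ ∫⁻ ω in Bᶜ, Λ ω ∂P := by
      rw [← lintegral_add_compl Λ hBm] at h1
      by_contra! hlt
      have : ∫⁻ ω in B, Λ ω ∂P + ∫⁻ ω in Bᶜ, Λ ω ∂P < 2⁻¹ + 2⁻¹ :=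
        ENNReal.add_lt_add_of_le_of_lt (ne_top_of_le_ne_top (by simp) hΛB) hΛB hlt
      rw [h1, ENNReal.inv_two_add_inv_two] at this
      exact lt_irrefl _ this
    refine le_trans ?_ hR1
    calc ENNReal.ofReal (s / 2) ^ r * 16⁻¹ ≤ ENNReal.ofReal (s / 2) ^ r * ∫⁻ ω in Bᶜ, Λ ω ∂P := by
          gcongr
          refine le_trans ?_ hΛc
          exact ENNReal.inv_le_inv.2 (by norm_num)
      _ = ∫⁻ ω in Bᶜ, ENNReal.ofReal (s / 2) ^ r * Λ ω ∂P := by rw [lintegral_const_mul _ hΛ]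
      _ ≤ ∫⁻ ω in Bᶜ, ENNReal.ofReal |t ω - s| ^ r * Λ ω ∂P := by
        refine setLIntegral_mono' hBm.compl fun ω hω => ?_
        gcongr
        have h3 : |t ω| < s / 2 := not_le.1 hω
        have h4 := abs_lt.1 h3
        rw [abs_sub_comm]
        exact le_trans (by linarith) (le_abs_self _)
      _ ≤ _ := setLIntegral_le_lintegral _ _

variable {d : ℕ} {W : L2 d → Ω → ℝ}

/-- The risk over zero and a finite family of nearly orthogonal functions with the same value `s` at
`x` is at least of the order of `s`: the estimator cannot tell zero from the uniform mixture of the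
family. -/
theorem IsWhiteNoise.ofReal_le_of_pointwiseRisk_le [IsProbabilityMeasure P] (hW : IsWhiteNoise P W) {ε r s : ℝ} (hε : 0 < ε)
    (hr : 0 < r) {x : E d} {M : ℕ} (hM : M ≠ 0) {F : Fin M → E d → ℝ}
    (hF : ∀ i, MemLp (F i) 2 (domMeasure d)) (hFx : ∀ i, F i x = s)
    (hgram : ∑ i, ∑ j, Real.exp (ε⁻¹ ^ 2 * inner ℝ (toL2 (F i)) (toL2 (F j))) ≤ 4 * (M : ℝ) ^ 2)
    {T : (L2 d → ℝ) → ℝ} (hT : Measurable T) {R : ℝ≥0∞}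
    (hR0 : pointwiseRisk P W ε r x T (fun _ => 0) ≤ R)
    (hR : ∀ i, pointwiseRisk P W ε r x T (F i) ≤ R) :
    ENNReal.ofReal (s / 2 * (1 / 16) ^ (1 / r)) ≤ R := by
  have hpow : ∀ {I : ℝ≥0∞}, I ^ (1 / r) ≤ R → I ≤ R ^ r := fun {I} h => by
    have := ENNReal.rpow_le_rpow h hr.le
    rwa [← ENNReal.rpow_mul, one_div_mul_cancel hr.ne', ENNReal.rpow_one] at this
  have hM0 : (M : ℝ≥0∞) ≠ 0 := by exact_mod_cast hM
  have hMt : (M : ℝ≥0∞) ≠ ∞ := ENNReal.natCast_ne_top M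
  set H : Fin M → L2 d := fun i => ε⁻¹ • toL2 (F i) with hH
  set Λ : Ω → ℝ≥0∞ := fun ω => (M : ℝ≥0∞)⁻¹ * ∑ i, likelihood W (H i) ω with hΛ
  set t : Ω → ℝ := fun ω => T fun φ => ε * W φ ω with ht
  have hlm : ∀ i, Measurable (likelihood W (H i)) := fun i => hW.measurable_likelihood _
  have htm : Measurable t :=
    hT.comp (measurable_pi_lambda _ fun φ => (hW.measurable φ).const_mul ε)
  have hllm : ∀ i j, Measurable fun ω => likelihood W (H i) ω * likelihood W (H j) ω := fun i j =>
    (hlm i).mul (hlm j)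
  have hΛm : Measurable Λ := (Finset.measurable_sum _ fun i _ => hlm i).const_mul _
  have e1 : ∫⁻ ω, Λ ω ∂P = 1 := by
    rw [hΛ, lintegral_const_mul _ (Finset.measurable_sum _ fun i _ => hlm i),
      lintegral_finsetSum _ fun i _ => hlm i]
    simp [hW.lintegral_likelihood, ENNReal.inv_mul_cancel hM0 hMt]
  have e2 : ∫⁻ ω, Λ ω * Λ ω ∂P ≤ 4 := by
    have e : ∀ ω, Λ ω * Λ ω = ((M : ℝ≥0∞)⁻¹ * (M : ℝ≥0∞)⁻¹) *
        ∑ i, ∑ j, likelihood W (H i) ω * likelihood W (H j) ω := fun ω => by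
      rw [hΛ, ← Finset.sum_mul_sum]; ring
    simp_rw [e]
    rw [lintegral_const_mul _ (Finset.measurable_sum _ fun i _ =>
        Finset.measurable_sum _ fun j _ => hllm i j),
      lintegral_finsetSum _ fun i _ => Finset.measurable_sum _ fun j _ => hllm i j]
    have e' : ∑ i, ∫⁻ ω, ∑ j, likelihood W (H i) ω * likelihood W (H j) ω ∂P =
        ENNReal.ofReal (∑ i, ∑ j, Real.exp (ε⁻¹ ^ 2 * inner ℝ (toL2 (F i)) (toL2 (F j)))) := by
      rw [ENNReal.ofReal_sum_of_nonneg fun i _ => Finset.sum_nonneg fun j _ => (Real.exp_pos _).le]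
      refine Finset.sum_congr rfl fun i _ => ?_
      rw [ENNReal.ofReal_sum_of_nonneg fun j _ => (Real.exp_pos _).le,
        lintegral_finsetSum _ fun j _ => hllm i j]
      refine Finset.sum_congr rfl fun j _ => ?_
      rw [hW.lintegral_likelihood_mul, hH]
      simp only [inner_smul_left, inner_smul_right, conj_trivial]
      congr 2; ring
    rw [e']
    calc (M : ℝ≥0∞)⁻¹ * (M : ℝ≥0∞)⁻¹ * _ ≤
          (M : ℝ≥0∞)⁻¹ * (M : ℝ≥0∞)⁻¹ * ENNReal.ofReal (4 * (M : ℝ) ^ 2) := by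
          gcongr
      _ = 4 * ((M : ℝ≥0∞)⁻¹ * M * ((M : ℝ≥0∞)⁻¹ * M)) := by
        rw [ENNReal.ofReal_mul (by norm_num), ENNReal.ofReal_pow (by positivity),
          ENNReal.ofReal_natCast, ENNReal.ofReal_ofNat]
        ring
      _ = 4 := by rw [ENNReal.inv_mul_cancel hM0 hMt]; norm_num
  have hf0 : ∫⁻ ω, ENNReal.ofReal |t ω| ^ r ∂P ≤ R ^ r := by
    refine le_of_eq_of_le ?_ (hpow hR0)
    simp [obs, ht]
  have hfi : ∀ i, ∫⁻ ω, ENNReal.ofReal |t ω - s| ^ r * likelihood W (H i) ω ∂P ≤ R ^ r := by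
    intro i
    refine le_of_eq_of_le ?_ (hpow (hR i))
    have hmε : Measurable fun (y : L2 d → ℝ) φ => ε * y φ :=
      measurable_pi_lambda _ fun φ => by
        have : Measurable fun y : L2 d → ℝ => y φ := measurable_pi_apply φ
        exact this.const_mul ε
    have hm : Measurable fun y : L2 d → ℝ => ENNReal.ofReal |T (fun φ => ε * y φ) - s| ^ r :=
      ((measurable_norm.comp ((hT.comp hmε).sub_const s)).ennreal_ofReal).pow_const r
    rw [← hW.lintegral_shift (H i) hm]
    refine lintegral_congr fun ω => ?_
    rw [hFx]
    congr 5
    funext φ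
    rw [obs_eq_inner (hF i)]
    simp only [hH, inner_smul_right]
    field_simp
    ring
  have hfΛ : ∫⁻ ω, ENNReal.ofReal |t ω - s| ^ r * Λ ω ∂P ≤ R ^ r := by
    have hm : Measurable fun ω => ENNReal.ofReal |t ω - s| ^ r :=
      ((measurable_norm.comp (htm.sub_const s)).ennreal_ofReal).pow_const r
    have hml : ∀ i, Measurable fun ω => ENNReal.ofReal |t ω - s| ^ r * likelihood W (H i) ω :=
      fun i => hm.mul (hlm i)
    have e : ∀ ω, ENNReal.ofReal |t ω - s| ^ r * Λ ω = (M : ℝ≥0∞)⁻¹ *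
        ∑ i, ENNReal.ofReal |t ω - s| ^ r * likelihood W (H i) ω := fun ω => by
      rw [hΛ, ← Finset.mul_sum]; ring
    simp_rw [e]
    rw [lintegral_const_mul _ (Finset.measurable_sum _ fun i _ => hml i),
      lintegral_finsetSum _ fun i _ => hml i]
    calc _ ≤ (M : ℝ≥0∞)⁻¹ * ∑ _i : Fin M, R ^ r := by
          gcongr with i
          exact hfi i
      _ = R ^ r := by
        rw [Finset.sum_const, Finset.card_univ, Fintype.card_fin, nsmul_eq_mul, ← mul_assoc,
          ENNReal.inv_mul_cancel hM0 hMt, one_mul]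
  have key := rpow_div_le_of_likelihood hΛm e1 e2 htm hr hf0 hfΛ
  have := ENNReal.rpow_le_rpow key (one_div_pos.2 hr).le
  rw [← ENNReal.rpow_mul, mul_one_div_cancel hr.ne', ENNReal.rpow_one,
    ENNReal.mul_rpow_of_nonneg _ _ (one_div_pos.2 hr).le, ← ENNReal.rpow_mul,
    mul_one_div_cancel hr.ne', ENNReal.rpow_one] at this
  refine le_of_eq_of_le ?_ this
  rw [ENNReal.ofReal_mul' (by positivity), ← ENNReal.ofReal_rpow_of_pos (by norm_num),
    one_div (16 : ℝ), ENNReal.ofReal_inv_of_pos (by norm_num), ENNReal.ofReal_ofNat]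

end Testing

/-! ### Localized functions of the Hölder class -/

/-- A bump in the Hölder class. -/
theorem exists_bump_mem_holderClass {β : ℝ} (hβ : 0 < β) :
    ∃ g : ℝ → ℝ, 0 < g 0 ∧ (∀ u, 1 ≤ |u| → g u = 0) ∧ g ∈ holderClass β 1 := by
  obtain ⟨hm1, hm2⟩ := lt_of_mInt hβ
  set m := mInt β
  let φ : ContDiffBump (0 : ℝ) := ⟨1 / 2, 1, by norm_num, by norm_num⟩
  have hφ : ContDiff ℝ (m + 1 : ℕ) φ := φ.contDiff
  have hbd : ∀ k ≤ m + 1, ∃ B, ∀ u, |iteratedDeriv k φ u| ≤ B := by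
    intro k hk
    have hc : Continuous (iteratedFDeriv ℝ k φ) := hφ.continuous_iteratedFDeriv (by exact_mod_cast hk)
    obtain ⟨B, hB⟩ := (φ.hasCompactSupport.iteratedFDeriv (𝕜 := ℝ) k).exists_bound_of_continuous hc
    refine ⟨B, fun u => ?_⟩
    have := hB u
    rwa [norm_iteratedFDeriv_eq_norm_iteratedDeriv, Real.norm_eq_abs] at this
  choose! B hB using hbd
  set A := 1 + ∑ k ∈ Finset.range (m + 2), |B k| with hA
  have hA1 : 1 ≤ A := by
    have : 0 ≤ ∑ k ∈ Finset.range (m + 2), |B k| := Finset.sum_nonneg fun k _ => abs_nonneg _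
    linarith
  have hbA : ∀ k ≤ m + 1, ∀ u, |iteratedDeriv k φ u| ≤ A := by
    intro k hk u
    have h1 : |B k| ≤ ∑ k ∈ Finset.range (m + 2), |B k| :=
      Finset.single_le_sum (f := fun k => |B k|) (fun k _ => abs_nonneg _)
        (Finset.mem_range.2 (by omega))
    linarith [hB k hk u, le_abs_self (B k)]
  have hinc : ∀ t δ : ℝ, 0 < δ →
      |iteratedDeriv m φ (t + δ) - iteratedDeriv m φ t| ≤ 2 * A * δ ^ (β - m) := by
    intro t δ hδ
    by_cases hδ1 : δ ≤ 1
    · have hd : Differentiable ℝ (iteratedDeriv m φ) :=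
        hφ.differentiable_iteratedDeriv m (by exact_mod_cast Nat.lt_succ_self m)
      have h1 := convex_univ.norm_image_sub_le_of_norm_deriv_le (f := iteratedDeriv m φ) (C := A)
        (x := t) (y := t + δ) (fun u _ => hd u)
        (fun u _ => by
          rw [← iteratedDeriv_succ, Real.norm_eq_abs]
          exact hbA _ le_rfl u) (mem_univ _) (mem_univ _)
      rw [Real.norm_eq_abs, Real.norm_eq_abs, add_sub_cancel_left, abs_of_pos hδ] at h1
      have h2 : δ ≤ δ ^ (β - m) := by
        conv_lhs => rw [← Real.rpow_one δ]
        exact Real.rpow_le_rpow_of_exponent_ge hδ hδ1 (by linarith)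
      have h3 : A * δ ≤ A * δ ^ (β - m) := by gcongr
      have : 0 ≤ A * δ := by positivity
      linarith
    · have h1 := hbA m (by omega) (t + δ)
      have h2 := hbA m (by omega) t
      have h3 : 1 ≤ δ ^ (β - m) := Real.one_le_rpow (by linarith) (by linarith)
      have h4 := abs_sub (iteratedDeriv m φ (t + δ)) (iteratedDeriv m φ t)
      nlinarith
  have hc0 : 0 < (2 * A)⁻¹ := by positivity
  refine ⟨fun u => (2 * A)⁻¹ * φ u, ?_, fun u hu => ?_, ?_⟩
  · exact mul_pos hc0 (φ.pos_of_mem_ball (Metric.mem_ball_self (by norm_num)))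
  · simp only
    rw [φ.zero_of_le_dist (by simpa [φ] using hu), mul_zero]
  · have hφm : ContDiff ℝ m φ := φ.contDiff
    have hit : ∀ k ≤ m, ∀ u, iteratedDeriv k (fun u => (2 * A)⁻¹ * φ u) u =
        (2 * A)⁻¹ * iteratedDeriv k φ u := fun k _ u =>
      iteratedDeriv_const_mul _ φ.contDiffAt
    refine ⟨contDiff_const.mul hφm, fun k hk u => ?_, fun t δ hδ => ?_⟩
    · rw [hit k hk, abs_mul, abs_of_pos hc0, inv_mul_le_one₀ (by positivity)]
      linarith [hbA k (by omega) u]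
    · rw [hit _ le_rfl, hit _ le_rfl, ← mul_sub, abs_mul, abs_of_pos hc0, one_mul,
        inv_mul_le_iff₀ (by positivity)]
      exact hinc t δ hδ

/-- The scaling of the Hölder classes; narrow bumps have the smaller derivatives of lower order. -/
theorem scale_mem_holderClass {β L h : ℝ} (hβ : 0 < β) (hL : 0 < L) (hh : h ∈ Ioc (0 : ℝ) 1)
    {g : ℝ → ℝ} (hg : g ∈ holderClass β 1) (y : ℝ) :
    (fun u => L * h ^ β * g (h⁻¹ * (u - y))) ∈ holderClass β L := by
  obtain ⟨hm1, hm2⟩ := lt_of_mInt hβ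
  obtain ⟨g1, g2, g3⟩ := hg
  set m := mInt β
  have hh0 := hh.1
  have hit : ∀ k ≤ m, ∀ u, iteratedDeriv k (fun u => L * h ^ β * g (h⁻¹ * (u - y))) u =
      L * h ^ (β - k) * iteratedDeriv k g (h⁻¹ * (u - y)) := by
    intro k hk u
    have gk : ContDiff ℝ k g := g1.of_le (by exact_mod_cast hk)
    have gc : ContDiff ℝ k fun u => g (h⁻¹ * (u - y)) := gk.comp (by fun_prop)
    rw [iteratedDeriv_const_mul _ gc.contDiffAt,
      iteratedDeriv_comp_sub_const k (fun u => g (h⁻¹ * u)) y,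
      iteratedDeriv_comp_const_mul gk, Real.rpow_sub hh0, Real.rpow_natCast]
    simp only [inv_pow]
    ring
  refine ⟨?_, fun k hk u => ?_, fun t δ hδ => ?_⟩
  · have : ContDiff ℝ m fun u => g (h⁻¹ * (u - y)) := g1.comp (by fun_prop)
    exact contDiff_const.mul this
  · have hkm : (k : ℝ) ≤ m := by exact_mod_cast hk
    rw [hit k hk, abs_mul, abs_of_nonneg (by positivity)]
    have h1 : h ^ (β - k) ≤ 1 := Real.rpow_le_one hh0.le hh.2 (by linarith)
    calc L * h ^ (β - k) * |iteratedDeriv k g (h⁻¹ * (u - y))| ≤ L * 1 * 1 := by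
          gcongr
          exact g2 k hk _
      _ = L := by ring
  · rw [hit _ le_rfl, hit _ le_rfl, ← mul_sub, abs_mul, abs_of_nonneg (by positivity)]
    have h1 := g3 (h⁻¹ * (t - y)) (h⁻¹ * δ) (by positivity)
    have e : h⁻¹ * (t + δ - y) = h⁻¹ * (t - y) + h⁻¹ * δ := by ring
    rw [e]
    calc _ ≤ L * h ^ (β - m) * (1 * (h⁻¹ * δ) ^ (β - m)) := by gcongr
      _ = L * (h * (h⁻¹ * δ)) ^ (β - m) := by
        rw [Real.mul_rpow hh0.le (by positivity)]; ring
      _ = _ := by rw [mul_inv_cancel_left₀ hh0.ne']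

theorem zero_mem_singleIndexClass {d : ℕ} (hd : 2 ≤ d) {β L : ℝ} (hβ : 0 < β) (hL : 0 < L) :
    (fun _ => 0) ∈ singleIndexClass d β L := by
  obtain ⟨hm1, hm2⟩ := lt_of_mInt hβ
  refine ⟨fun _ => 0, ⟨contDiff_const, fun m _ t => ?_, fun t h hh => ?_⟩,
    EuclideanSpace.single ⟨0, by omega⟩ 1, by simp, fun z => rfl⟩
  · simp [hL.le]
  · simp only [iteratedDeriv_const, sub_self, abs_zero]
    positivity

/-! ### Ridge functions in different directions are nearly orthogonal -/

section Ridge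

variable {d : ℕ} {i₀ i₁ : Fin d}

/-- The volume of the part of the cube between two parallel hyperplanes and within a strip: a
transvection maps it into a box. -/
theorem volume_slab_le (hi : i₀ ≠ i₁) (a c₀ c₁ : ℝ) {r₀ r₁ : ℝ} (h₀ : 0 ≤ r₀) (h₁ : 0 ≤ r₁) :
    volume ({t : E d | |t i₀ + a * t i₁ - c₀| ≤ r₀ ∧ |t i₁ - c₁| ≤ r₁} ∩ domain d) ≤
      ENNReal.ofReal (2 * r₀ * (2 * r₁) * 2 ^ (d - 2)) := by
  classical
  set I : Fin d → Set ℝ := fun k => if k = i₀ then Icc (c₀ - r₀) (c₀ + r₀) else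
    if k = i₁ then Icc (c₁ - r₁) (c₁ + r₁) else Icc (-1) 1 with hI
  set τ : Matrix.TransvectionStruct (Fin d) ℝ := ⟨i₀, i₁, hi, a⟩ with hτ
  have hτ0 : ∀ t : Fin d → ℝ, Matrix.toLin' τ.toMatrix t i₀ = t i₀ + a * t i₁ := by
    intro t
    simp [hτ, Matrix.TransvectionStruct.toMatrix, Matrix.transvection,
      Matrix.single_mulVec]
  have hτk : ∀ (t : Fin d → ℝ) (k : Fin d), k ≠ i₀ → Matrix.toLin' τ.toMatrix t k = t k := by
    intro t k hk
    simp [hτ, Matrix.TransvectionStruct.toMatrix, Matrix.transvection,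
      Matrix.single_mulVec, hk]
  have hIm : MeasurableSet (univ.pi I) := .univ_pi fun k => by
    simp only [hI]
    split_ifs <;> exact measurableSet_Icc
  have hvol : volume (univ.pi I) = ENNReal.ofReal (2 * r₀ * (2 * r₁) * 2 ^ (d - 2)) := by
    rw [volume_pi_pi, ← Finset.mul_prod_erase _ _ (Finset.mem_univ i₀),
      ← Finset.mul_prod_erase _ _ (Finset.mem_erase.2 ⟨hi.symm, Finset.mem_univ i₁⟩)]
    have e : ∀ k ∈ (Finset.univ.erase i₀).erase i₁, volume (I k) = 2 := by
      intro k hk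
      rw [Finset.mem_erase, Finset.mem_erase] at hk
      simp only [hI, hk.1, hk.2.1, if_false, Real.volume_Icc]
      norm_num
    rw [Finset.prod_congr rfl e, Finset.prod_const, Finset.card_erase_of_mem
      (Finset.mem_erase.2 ⟨hi.symm, Finset.mem_univ i₁⟩), Finset.card_erase_of_mem
      (Finset.mem_univ i₀), Finset.card_univ, Fintype.card_fin, Nat.sub_sub]
    simp only [hI, if_true, hi.symm, if_false, Real.volume_Icc]
    rw [ENNReal.ofReal_mul (by positivity), ENNReal.ofReal_mul (by positivity),
      ENNReal.ofReal_pow (by norm_num), ENNReal.ofReal_ofNat, ← mul_assoc]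
    congr 3 <;> ring_nf
  have hτv := Real.volume_preserving_transvectionStruct τ
  have hof := PiLp.volume_preserving_ofLp (Fin d)
  calc _ ≤ volume (WithLp.ofLp (p := 2) (V := Fin d → ℝ) ⁻¹'
        (Matrix.toLin' τ.toMatrix ⁻¹' univ.pi I)) := by
        refine measure_mono ?_
        rintro t ⟨⟨t1, t2⟩, t3⟩ k -
        by_cases hk : k = i₀
        · subst hk
          rw [hτ0]
          simp only [hI, if_true]
          exact ⟨by linarith [(abs_le.1 t1).1], by linarith [(abs_le.1 t1).2]⟩
        · rw [hτk _ _ hk]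
          by_cases hk1 : k = i₁
          · subst hk1
            simp only [hI, hk, if_true, if_false]
            exact ⟨by linarith [(abs_le.1 t2).1], by linarith [(abs_le.1 t2).2]⟩
          · simp only [hI, hk, hk1, if_false]
            exact t3 k
    _ = _ := by
        rw [hof.measure_preimage (hτv.measurable hIm).nullMeasurableSet,
          hτv.measure_preimage hIm.nullMeasurableSet, hvol]

/-- The direction of the vector `e₀ + a e₁`. -/
def slopeDir (i₀ i₁ : Fin d) (a : ℝ) : E d :=
  (√(1 + a ^ 2))⁻¹ • (EuclideanSpace.single i₀ 1 + a • EuclideanSpace.single i₁ 1)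

theorem inner_slopeDir (a : ℝ) (z : E d) :
    (inner ℝ z (slopeDir i₀ i₁ a) : ℝ) = (√(1 + a ^ 2))⁻¹ * (z i₀ + a * z i₁) := by
  rw [slopeDir, inner_smul_right, inner_add_right, inner_smul_right]
  simp [EuclideanSpace.inner_single_right]

theorem slopeDir_mem_sph (hi : i₀ ≠ i₁) (a : ℝ) : slopeDir i₀ i₁ a ∈ Sph d := by
  have hp : 0 < 1 + a ^ 2 := by positivity
  have h1 : (inner ℝ (slopeDir i₀ i₁ a) (slopeDir i₀ i₁ a) : ℝ) = 1 := by
    rw [inner_slopeDir]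
    simp only [slopeDir, PiLp.smul_apply, PiLp.add_apply, PiLp.single_apply, hi, hi.symm,
      if_true, if_false, smul_eq_mul]
    have := Real.sq_sqrt hp.le
    have h0 : √(1 + a ^ 2) ≠ 0 := by positivity
    field_simp
    nlinarith
  rw [mem_sphere_zero_iff_norm]
  rw [real_inner_self_eq_norm_sq] at h1
  exact (pow_eq_one_iff_of_nonneg (norm_nonneg _) two_ne_zero).1 h1

/-- The ridge function with amplitude `A`, profile `g` and width `h` through `x`, in the direction of
slope `a`. -/
def ridge (i₀ i₁ : Fin d) (A h : ℝ) (g : ℝ → ℝ) (x : E d) (a : ℝ) (z : E d) : ℝ :=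
  A * g (h⁻¹ * (inner ℝ z (slopeDir i₀ i₁ a) - inner ℝ x (slopeDir i₀ i₁ a)))

theorem abs_le_of_ridge_ne_zero {A h : ℝ} (hh : 0 < h) {g : ℝ → ℝ} (hg : ∀ u, 1 ≤ |u| → g u = 0)
    {x z : E d} {a : ℝ} (ha : a ∈ Icc (0 : ℝ) 1) (hne : ridge i₀ i₁ A h g x a z ≠ 0) :
    |z i₀ + a * z i₁ - (x i₀ + a * x i₁)| ≤ 2 * h := by
  have h1 : |h⁻¹ * (inner ℝ z (slopeDir i₀ i₁ a) - inner ℝ x (slopeDir i₀ i₁ a))| < 1 := by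
    by_contra! hcon
    exact hne (by rw [ridge, hg _ hcon, mul_zero])
  have hs0 : 0 < √(1 + a ^ 2) := by positivity
  have hs : √(1 + a ^ 2) ≤ 2 := by
    rw [Real.sqrt_le_left (by norm_num)]
    nlinarith [ha.1, ha.2]
  rw [inner_slopeDir, inner_slopeDir, ← mul_sub, abs_mul, abs_mul, abs_of_pos (inv_pos.2 hh),
    abs_of_pos (inv_pos.2 hs0), inv_mul_lt_iff₀ hh, inv_mul_lt_iff₀ hs0] at h1
  nlinarith

theorem inner_ridge_le (hi : i₀ ≠ i₁) {A h : ℝ} (hh : 0 < h) {g : ℝ → ℝ}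
    (hgc : Continuous g) (hg : ∀ u, 1 ≤ |u| → g u = 0) (hg1 : ∀ u, |g u| ≤ 1) {x : E d} {a a' : ℝ}
    (ha : a ∈ Icc (0 : ℝ) 1) {c r : ℝ} (hr : 0 ≤ r)
    (H : ∀ t ∈ domain d, ridge i₀ i₁ A h g x a t ≠ 0 → ridge i₀ i₁ A h g x a' t ≠ 0 →
      |t i₁ - c| ≤ r) :
    (inner ℝ (toL2 (ridge i₀ i₁ A h g x a)) (toL2 (ridge i₀ i₁ A h g x a')) : ℝ) ≤
      A ^ 2 * (4 * h * (2 * r) * 2 ^ (d - 2)) := by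
  have hcont : ∀ a, Continuous (ridge i₀ i₁ A h g x a) := fun a => by
    unfold ridge; fun_prop
  have hbd : ∀ a t, |ridge i₀ i₁ A h g x a t| ≤ |A| := fun a t => by
    rw [ridge, abs_mul]
    exact mul_le_of_le_one_right (abs_nonneg _) (hg1 _)
  have hmem : ∀ a, MemLp (ridge i₀ i₁ A h g x a) 2 (domMeasure d) := fun a =>
    memLp_of_continuous_of_bound (hcont a) (hbd a)
  set S : Set (E d) := {t | |t i₀ + a * t i₁ - (x i₀ + a * x i₁)| ≤ 2 * h ∧ |t i₁ - c| ≤ r} with hS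
  have hSm : MeasurableSet S := by
    have c1 : Continuous fun t : E d => |t i₀ + a * t i₁ - (x i₀ + a * x i₁)| := by fun_prop
    have c2 : Continuous fun t : E d => |t i₁ - c| := by fun_prop
    exact ((isClosed_le c1 continuous_const).inter (isClosed_le c2 continuous_const)).measurableSet
  have hSv : (domMeasure d).real S ≤ 4 * h * (2 * r) * 2 ^ (d - 2) := by
    rw [measureReal_def, domMeasure, Measure.restrict_apply hSm]
    refine ENNReal.toReal_le_of_le_ofReal (by positivity) ?_
    refine (volume_slab_le hi a _ c (by positivity) hr).trans_eq ?_
    congr 1; ring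
  rw [inner_toL2 (hmem a')]
  calc ∫ t, toL2 (ridge i₀ i₁ A h g x a) t * ridge i₀ i₁ A h g x a' t ∂(domMeasure d)
      = ∫ t, ridge i₀ i₁ A h g x a t * ridge i₀ i₁ A h g x a' t ∂(domMeasure d) := by
        refine integral_congr_ae ?_
        filter_upwards [toL2_ae_eq (hmem a)] with t ht
        rw [ht]
    _ ≤ ∫ t, S.indicator (fun _ => A ^ 2) t ∂(domMeasure d) := by
        refine integral_mono_ae ((hmem a).integrable_mul (hmem a'))
          ((integrable_const _).indicator hSm) ?_
        filter_upwards [ae_mem_domain d] with t ht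
        by_cases h0 : ridge i₀ i₁ A h g x a t * ridge i₀ i₁ A h g x a' t = 0
        · rw [h0]
          exact indicator_nonneg (fun _ _ => sq_nonneg A) t
        · have hne := mul_ne_zero_iff.1 h0
          rw [indicator_of_mem (show t ∈ S from
            ⟨abs_le_of_ridge_ne_zero hh hg ha hne.1, H t ht hne.1 hne.2⟩)]
          calc _ ≤ |ridge i₀ i₁ A h g x a t * ridge i₀ i₁ A h g x a' t| := le_abs_self _
            _ = |ridge i₀ i₁ A h g x a t| * |ridge i₀ i₁ A h g x a' t| := abs_mul _ _
            _ ≤ |A| * |A| := mul_le_mul (hbd _ _) (hbd _ _) (abs_nonneg _) (abs_nonneg _)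
            _ = A ^ 2 := by rw [abs_mul_abs_self, sq]
    _ = A ^ 2 * (domMeasure d).real S := by
        rw [integral_indicator_const _ hSm, smul_eq_mul, mul_comm]
    _ ≤ _ := by gcongr

theorem inner_ridge_self_le (hi : i₀ ≠ i₁) (hd : 2 ≤ d) {A h : ℝ} (hh : 0 < h) {g : ℝ → ℝ}
    (hgc : Continuous g) (hg : ∀ u, 1 ≤ |u| → g u = 0) (hg1 : ∀ u, |g u| ≤ 1) {x : E d} {a : ℝ}
    (ha : a ∈ Icc (0 : ℝ) 1) :
    (inner ℝ (toL2 (ridge i₀ i₁ A h g x a)) (toL2 (ridge i₀ i₁ A h g x a)) : ℝ) ≤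
      2 ^ (d + 1) * (A ^ 2 * h) := by
  refine (inner_ridge_le hi hh hgc hg hg1 ha (c := 0) (r := 1) zero_le_one
    fun t ht _ _ => ?_).trans_eq ?_
  · rw [sub_zero, abs_le]
    exact ht i₁
  · obtain ⟨k, rfl⟩ := Nat.exists_eq_add_of_le hd
    rw [Nat.add_sub_cancel_left]
    ring

/-- The strips in which two ridge functions live are transversal, and meet in a set of diameter of the
order of the width divided by the difference of the slopes. -/
theorem inner_ridge_ne_le (hi : i₀ ≠ i₁) (hd : 2 ≤ d) {A h : ℝ} (hh : 0 < h) {g : ℝ → ℝ}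
    (hgc : Continuous g) (hg : ∀ u, 1 ≤ |u| → g u = 0) (hg1 : ∀ u, |g u| ≤ 1) {x : E d} {a a' : ℝ}
    (ha : a ∈ Icc (0 : ℝ) 1) (ha' : a' ∈ Icc (0 : ℝ) 1) (hne : a ≠ a') :
    (inner ℝ (toL2 (ridge i₀ i₁ A h g x a)) (toL2 (ridge i₀ i₁ A h g x a')) : ℝ) ≤
      2 ^ (d + 3) * (A ^ 2 * h) * (h / |a - a'|) := by
  have hp : 0 < |a - a'| := abs_pos.2 (sub_ne_zero.2 hne)
  refine (inner_ridge_le hi hh hgc hg hg1 ha (c := x i₁) (r := 4 * h / |a - a'|) (by positivity)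
    fun t _ h1 h2 => ?_).trans_eq ?_
  · have k1 := abs_le_of_ridge_ne_zero hh hg ha h1
    have k2 := abs_le_of_ridge_ne_zero hh hg ha' h2
    rw [le_div_iff₀ hp, ← abs_mul]
    have e : (t i₁ - x i₁) * (a - a') = (t i₀ + a * t i₁ - (x i₀ + a * x i₁)) -
      (t i₀ + a' * t i₁ - (x i₀ + a' * x i₁)) := by ring
    rw [e]
    exact (abs_sub _ _).trans (by linarith)
  · obtain ⟨k, rfl⟩ := Nat.exists_eq_add_of_le hd
    rw [Nat.add_sub_cancel_left]
    ring

end Ridge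

/-! ### The lower bound -/

theorem exists_forall_log_rpow_le {a δ : ℝ} (ha : 0 < a) (hδ : 0 < δ) :
    ∃ ε₀ : ℝ, 0 < ε₀ ∧ ∀ ε : ℝ, 0 < ε → ε < ε₀ →
      1 ≤ Real.log (1 / ε) ∧ Real.log (1 / ε) ^ (1 + a) * ε ^ a ≤ δ := by
  have h := (isLittleO_log_rpow_rpow_atTop (1 + a) ha).bound hδ
  obtain ⟨X, hX⟩ := Filter.eventually_atTop.1 h
  set Y := max X (Real.exp 1) with hY
  have hY0 : 0 < Y := lt_of_lt_of_le (Real.exp_pos 1) (le_max_right _ _)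
  refine ⟨Y⁻¹, inv_pos.2 hY0, fun ε hε hlt => ?_⟩
  have h1 : Y < 1 / ε := by rw [one_div]; exact (lt_inv_comm₀ hY0 hε).2 hlt
  have hl : 1 ≤ Real.log (1 / ε) := by
    rw [Real.le_log_iff_exp_le (by positivity)]
    exact (le_max_right _ _).trans h1.le
  refine ⟨hl, ?_⟩
  have h2 := hX (1 / ε) ((le_max_left _ _).trans h1.le)
  rw [Real.norm_of_nonneg (by positivity), Real.norm_of_nonneg (by positivity), one_div,
    Real.inv_rpow hε.le, ← one_div ε, ← div_eq_mul_inv, le_div_iff₀ (by positivity)] at h2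
  exact h2

/-- The lower bound. It is witnessed by about `ε ^ (-a)`, `a = 1 / (2 β + 1)`, ridge functions of
amplitude `L h ^ β` and width `h`, where `L ^ 2 h ^ (2 β + 1)` is a small multiple of
`ε ^ 2 log (1 / ε)`: the logarithm is the price for not knowing the direction. -/
theorem exists_lower_bound {d : ℕ} {r β : ℝ} (hd : 2 ≤ d) (hr : 0 < r) (hβ : 0 < β) :
    ∃ κ : ℝ, 0 < κ ∧ ∀ L : ℝ, 0 < L → ∃ ε₀ : ℝ, 0 < ε₀ ∧ ∀ ε : ℝ, 0 < ε → ε < ε₀ →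
      ∀ (x : E d) (Ω : Type*) [MeasurableSpace Ω] (P : Measure Ω) [IsProbabilityMeasure P]
        (W : L2 d → Ω → ℝ), IsWhiteNoise P W → ∀ T : (L2 d → ℝ) → ℝ, Measurable T →
        ENNReal.ofReal (κ * rate ε β L) ≤
          ⨆ F ∈ singleIndexClass d β L, pointwiseRisk P W ε r x T F := by
  obtain ⟨g, hg0, hgs, hgH⟩ := exists_bump_mem_holderClass hβ
  have hgc := continuous_of_mem_holderClass hgH
  have hg1 := fun u => abs_le_of_mem_holderClass hgH u
  set a := 1 / (2 * β + 1) with ha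
  have ha0 : 0 < a := by positivity
  -- with this constant the diagonal terms of the second moment are at most `ε ^ (-a)`
  set c := a / 2 ^ (d + 1) with hc
  have hc0 : 0 < c := by positivity
  refine ⟨g 0 * c ^ (β * a) / 2 * (1 / 16) ^ (1 / r), by positivity, fun L hL => ?_⟩
  set B := (c / L ^ 2) ^ a with hB
  have hB0 : 0 < B := by positivity
  -- bounds the width by one, and the off-diagonal exponents by one
  set δ := min 1 (1 / (2 ^ (d + 4) * c)) with hδ
  have hδ0 : 0 < δ := by positivity
  obtain ⟨ε₀, hε₀, H⟩ := exists_forall_log_rpow_le ha0 (div_pos hδ0 hB0)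
  refine ⟨ε₀, hε₀, fun ε hε hlt x Ω _ P _ W hW T hT => ?_⟩
  obtain ⟨hl1, hsmall⟩ := H ε hε hlt
  set l := Real.log (1 / ε) with hl
  have hl0 : 0 < l := by linarith
  have hexpl : ∀ b : ℝ, Real.exp (b * l) = (ε⁻¹) ^ b := fun b => by
    rw [hl, one_div, Real.rpow_def_of_pos (by positivity), mul_comm]
  have hε1 : 1 ≤ ε⁻¹ := by
    have := hexpl 1
    rw [Real.rpow_one] at this
    rw [← this]
    exact Real.one_le_exp (by linarith)
  set h := (c * (ε ^ 2 * l) / L ^ 2) ^ a with hh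
  have hh0 : 0 < h := by positivity
  have hheq : h * (ε⁻¹) ^ a * l = B * (l ^ (1 + a) * ε ^ a) := by
    have e1 : c * (ε ^ 2 * l) / L ^ 2 = c / L ^ 2 * (ε * ε * l) := by ring
    rw [hh, e1, Real.mul_rpow (by positivity) (by positivity), Real.mul_rpow (by positivity) hl0.le,
      Real.mul_rpow hε.le hε.le, Real.inv_rpow hε.le, Real.rpow_add hl0, Real.rpow_one, ← hB]
    field_simp
  have hhl : h * (ε⁻¹) ^ a * l ≤ δ := by
    rw [hheq, mul_comm]
    exact (le_div_iff₀ hB0).1 hsmall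
  have hεa : 1 ≤ (ε⁻¹) ^ a := Real.one_le_rpow hε1 ha0.le
  have hh1 : h ≤ 1 := by
    calc h = h * 1 * 1 := by ring
      _ ≤ h * (ε⁻¹) ^ a * l := by gcongr
      _ ≤ 1 := hhl.trans (min_le_left _ _)
  have hlin : (2 * β + 1) * a = 1 := by rw [ha]; field_simp
  set A := L * h ^ β with hA
  have hA2 : A ^ 2 * h = c * (ε ^ 2 * l) := by
    have e1 : h ^ β * h ^ β * h = h ^ (2 * β + 1) := by
      rw [← Real.rpow_add hh0, ← Real.rpow_add_one hh0.ne', ← two_mul]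
    have e2 : h ^ (2 * β + 1) = c * (ε ^ 2 * l) / L ^ 2 := by
      rw [hh, ← Real.rpow_mul (by positivity), mul_comm a, hlin, Real.rpow_one]
    calc A ^ 2 * h = L ^ 2 * (h ^ β * h ^ β * h) := by rw [hA]; ring
      _ = _ := by rw [e1, e2]; field_simp
  set M := ⌈(ε⁻¹) ^ a⌉₊ with hM
  have hM1 : (ε⁻¹) ^ a ≤ M := Nat.le_ceil _
  have hM0 : (0 : ℝ) < M := by linarith
  have hM2 : (M : ℝ) ≤ 2 * (ε⁻¹) ^ a := by
    have := Nat.ceil_lt_add_one (show 0 ≤ (ε⁻¹) ^ a by positivity)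
    linarith
  set i₀ : Fin d := ⟨0, by omega⟩ with hi₀
  set i₁ : Fin d := ⟨1, by omega⟩ with hi₁
  have hi : i₀ ≠ i₁ := by simp [hi₀, hi₁]
  set F : Fin M → E d → ℝ := fun i => ridge i₀ i₁ A h g x (i / M) with hF
  have hFmem : ∀ i, F i ∈ singleIndexClass d β L := fun i =>
    ⟨_, scale_mem_holderClass hβ hL ⟨hh0, hh1⟩ hgH (inner ℝ x (slopeDir i₀ i₁ (i / M))),
      slopeDir i₀ i₁ (i / M), slopeDir_mem_sph hi _, fun z => rfl⟩
  have hslope : ∀ i : Fin M, (i / M : ℝ) ∈ Icc (0 : ℝ) 1 := fun i =>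
    ⟨by positivity, (div_le_one hM0).2 (by exact_mod_cast i.2.le)⟩
  have hsame : ∀ i, Real.exp (ε⁻¹ ^ 2 * inner ℝ (toL2 (F i)) (toL2 (F i))) ≤ M := by
    intro i
    have h1 := inner_ridge_self_le hi hd (A := A) hh0 hgc hgs hg1 (x := x) (hslope i)
    rw [hA2] at h1
    refine le_trans ?_ hM1
    rw [← hexpl a, Real.exp_le_exp]
    calc ε⁻¹ ^ 2 * inner ℝ (toL2 (F i)) (toL2 (F i)) ≤
          ε⁻¹ ^ 2 * (2 ^ (d + 1) * (c * (ε ^ 2 * l))) := by gcongr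
      _ = a * l := by rw [hc]; field_simp
  have hdiff : ∀ i j, i ≠ j → Real.exp (ε⁻¹ ^ 2 * inner ℝ (toL2 (F i)) (toL2 (F j))) ≤ 3 := by
    intro i j hij
    have hne : (i / M : ℝ) ≠ j / M := by
      intro he
      rw [div_left_inj' hM0.ne'] at he
      exact hij (Fin.ext (by exact_mod_cast he))
    have hgap : 1 / (M : ℝ) ≤ |(i / M : ℝ) - j / M| := by
      rw [← sub_div, abs_div, abs_of_pos hM0]
      gcongr
      have hz : ((i : ℕ) : ℤ) - ((j : ℕ) : ℤ) ≠ 0 := by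
        intro h0
        exact hij (Fin.ext (by omega))
      have := Int.one_le_abs hz
      exact_mod_cast this
    have h1 := inner_ridge_ne_le hi hd (A := A) hh0 hgc hgs hg1 (x := x) (hslope i) (hslope j) hne
    rw [hA2] at h1
    have h2 : h / |(i / M : ℝ) - j / M| ≤ h * M := by
      rw [div_le_iff₀ (lt_of_lt_of_le (by positivity) hgap)]
      calc h = h * M * (1 / M) := by field_simp
        _ ≤ _ := by gcongr
    refine le_trans ?_ (Real.exp_one_lt_d9.le.trans (by norm_num))
    rw [Real.exp_le_exp]
    calc ε⁻¹ ^ 2 * inner ℝ (toL2 (F i)) (toL2 (F j)) ≤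
          ε⁻¹ ^ 2 * (2 ^ (d + 3) * (c * (ε ^ 2 * l)) * (h * M)) := by
          gcongr
          exact h1.trans (by gcongr)
      _ = 2 ^ (d + 3) * c * (h * M * l) := by field_simp
      _ ≤ 2 ^ (d + 3) * c * (h * (2 * (ε⁻¹) ^ a) * l) := by gcongr
      _ = 2 ^ (d + 4) * c * (h * (ε⁻¹) ^ a * l) := by ring
      _ ≤ 2 ^ (d + 4) * c * (1 / (2 ^ (d + 4) * c)) := by
        gcongr
        exact hhl.trans (min_le_right _ _)
      _ = 1 := mul_one_div_cancel (by positivity)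
  have hgram : ∑ i, ∑ j, Real.exp (ε⁻¹ ^ 2 * inner ℝ (toL2 (F i)) (toL2 (F j))) ≤
      4 * (M : ℝ) ^ 2 := by
    have hrow : ∀ i, ∑ j, Real.exp (ε⁻¹ ^ 2 * inner ℝ (toL2 (F i)) (toL2 (F j))) ≤ 4 * M := by
      intro i
      rw [← Finset.add_sum_erase _ _ (Finset.mem_univ i)]
      have h1 : ∑ j ∈ Finset.univ.erase i,
          Real.exp (ε⁻¹ ^ 2 * inner ℝ (toL2 (F i)) (toL2 (F j))) ≤ M * 3 := by
        refine (Finset.sum_le_card_nsmul _ _ 3 fun j hj =>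
          hdiff i j (Finset.ne_of_mem_erase hj).symm).trans ?_
        rw [nsmul_eq_mul]
        gcongr
        have := Finset.card_erase_le (s := Finset.univ) (a := i)
        rwa [Finset.card_univ, Fintype.card_fin] at this
      linarith [hsame i]
    refine (Finset.sum_le_sum fun i _ => hrow i).trans_eq ?_
    rw [Finset.sum_const, Finset.card_univ, Fintype.card_fin, nsmul_eq_mul]
    ring
  have hval : g 0 * c ^ (β * a) / 2 * (1 / 16) ^ (1 / r) * rate ε β L =
      A * g 0 / 2 * (1 / 16) ^ (1 / r) := by
    have e1 : rate ε β L = L ^ a * (ε ^ 2 * l) ^ (β * a) := by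
      have e3 : 2 * β / (2 * β + 1) = 2 * (β * a) := by rw [ha]; ring
      rw [rate, ← hl, ← ha, e3, Real.rpow_mul (by positivity), Real.rpow_two, mul_pow,
        Real.sq_sqrt hl0.le]
    have e2 : A = L ^ a * (c ^ (β * a) * (ε ^ 2 * l) ^ (β * a)) := by
      have e4 : L ^ a = L * ((L ^ 2) ^ (β * a))⁻¹ := by
        have : a = 1 - 2 * (β * a) := by linarith
        conv_lhs => rw [this]
        rw [Real.rpow_sub hL, Real.rpow_one, Real.rpow_mul hL.le, Real.rpow_two, div_eq_mul_inv]
      rw [hA, hh, ← Real.rpow_mul (by positivity), mul_comm a β,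
        Real.div_rpow (by positivity) (by positivity), Real.mul_rpow hc0.le (by positivity), e4]
      ring
    rw [e1, e2]; ring
  rw [hval]
  refine hW.ofReal_le_of_pointwiseRisk_le hε hr (M := M) (by exact_mod_cast hM0.ne')
    (fun i => memLp_of_mem_singleIndexClass (hFmem i)) (fun i => ?_) hgram hT
    (le_iSup₂_of_le _ (zero_mem_singleIndexClass hd hβ hL) le_rfl)
    (fun i => le_iSup₂_of_le _ (hFmem i) le_rfl)
  simp [hF, ridge]

end SingleIndex

end

theorem theorem2 :
    -- upper bound, with constants depending only on `r` and the kernel (and on `L`, for `C₂`)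
    (∀ (K : ℝ → ℝ) (r : ℝ), SingleIndex.IsKernel K → 0 < r →
      ∃ (C C₁ : ℝ) (C₂ : ℝ → ℝ),
        ∀ b : ℝ, 0 < b → SingleIndex.VanishingMoments K b →
        ∀ ε : ℝ, 0 < ε → ε < 1 →
        ∀ x ∈ SingleIndex.innerCube 2,
        ∀ (Ω : Type*) [MeasurableSpace Ω] (P : Measure Ω) [IsProbabilityMeasure P]
          (W : SingleIndex.L2 2 → Ω → ℝ), SingleIndex.IsWhiteNoise P W →
          -- the estimator is a well-defined function of the observation only
          (∃ T : (SingleIndex.L2 2 → ℝ) → ℝ, Measurable T ∧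
            ∀ F ∈ SingleIndex.adaptationClass b,
              SingleIndex.IsSelectedEstimator P K C ε x (SingleIndex.obs ε W F)
                (fun ω => T (fun φ => SingleIndex.obs ε W F φ ω))) ∧
          -- its maximal risk over every class
          ∀ T : (SingleIndex.L2 2 → ℝ) → ℝ, Measurable T →
            (∀ F ∈ SingleIndex.adaptationClass b,
              SingleIndex.IsSelectedEstimator P K C ε x (SingleIndex.obs ε W F)
                (fun ω => T (fun φ => SingleIndex.obs ε W F φ ω))) →
            ∀ β L : ℝ, 0 < β → β ≤ b → 0 < L →
              ε ≤ Real.exp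
                (-max 1 ((2 * L * SingleIndex.l1Norm K * (SingleIndex.supNorm K)⁻¹) ^ 2)) →
              ⨆ F ∈ SingleIndex.singleIndexClass 2 β L,
                  SingleIndex.pointwiseRisk P W ε r x T F ≤
                ENNReal.ofReal (SingleIndex.supNorm K ^ 2 *
                  (C₁ * SingleIndex.rate ε β L + C₂ L * (ε * √(Real.log (1 / ε)))))) ∧
    -- lower bound
    (∀ (d : ℕ) (r β : ℝ), 2 ≤ d → 0 < r → 0 < β →
      ∃ κ : ℝ, 0 < κ ∧ ∀ L : ℝ, 0 < L →
        ∃ ε₀ : ℝ, 0 < ε₀ ∧ ∀ ε : ℝ, 0 < ε → ε < ε₀ →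
        ∀ x ∈ SingleIndex.innerCube d,
        ∀ (Ω : Type*) [MeasurableSpace Ω] (P : Measure Ω) [IsProbabilityMeasure P]
          (W : SingleIndex.L2 d → Ω → ℝ), SingleIndex.IsWhiteNoise P W →
          ENNReal.ofReal (κ * SingleIndex.rate ε β L) ≤
            ⨅ (T : (SingleIndex.L2 d → ℝ) → ℝ) (_ : Measurable T),
              ⨆ F ∈ SingleIndex.singleIndexClass d β L,
                SingleIndex.pointwiseRisk P W ε r x T F) := by
  refine ⟨fun K r hK hr => ?_, fun d r β hd hr hβ => ?_⟩
  · obtain ⟨C, C₁, C₂, hC, H⟩ := hK.exists_risk_bound hr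
    refine ⟨C, C₁, C₂, fun b _ hmom ε hε hε1 x hx Ω _ P _ W hW => ⟨?_, ?_⟩⟩
    · obtain ⟨T, hT, hsel⟩ := hK.exists_isSelectedEstimator hε hε1 hC hx hW
      refine ⟨T, hT, fun F hF => ?_⟩
      obtain ⟨β, L, -, -, -, hF⟩ := hF
      exact hsel F (SingleIndex.memLp_of_mem_singleIndexClass hF)
    · intro T hT hsel β L hβ hβb hL hεL
      exact iSup₂_le fun F hF => H b hmom ε hε hε1 x hx Ω P W hW T hT β L hβ hβb hL hεL F hF
        (hsel F ⟨β, L, hβ, hβb, hL, hF⟩)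
  · obtain ⟨κ, hκ, H⟩ := SingleIndex.exists_lower_bound (d := d) hd hr hβ
    refine ⟨κ, hκ, fun L hL => ?_⟩
    obtain ⟨ε₀, hε₀, H'⟩ := H L hL
    exact ⟨ε₀, hε₀, fun ε hε hlt x _ Ω _ P _ W hW =>
      le_iInf₂ fun T hT => H' ε hε hlt x Ω P W hW T hT⟩
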